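/- **Definitions.** For a bipartite graph $H$ with left vertex set $U$, $|U|=k$, and right vertex set $V$, let $\mathcal B(H)$ be the system of polynomial equations in the variables $(x_u)_{u\in U},(y_v)_{v\in V}$ $$x_u^2=x_u\ (u\in U),\qquad y_v^2=y_v\ (v\in V),\qquad |x|+|y|=k,\qquad x_uy_v=0\ \text{ whenever } \{u,v\} \text{ is not an edge of } H,$$ where $|x|=\sum_{u}x_u$, $|y|=\sum_{v}y_v$, and each equation $f=0$ is read as the two inequalities $f\ge 0$, $-f\ge0$. A system $\{f_1\ge 0,\dots,f_m\ge 0\}$ has a *degree-$d$ sum-of-squares proof* of $g\ge 0$ if $g=\sum_{S\subseteq[m]}s_S\prod_{i\in S}f_i$ with all $s_S$ sums of squares of polynomials and all summands of degree at most $d$. If all these polynomials have rational coefficients, the *total bit complexity* of the proof is the number of bits needed to write down all coefficients of the $f_i$, of $g$ and of the $s_S$. For real $b$ we say that $\mathcal B(H)$ *certifies $|x|^a|y|\le b$ in degree $d$ and bit complexity $B$* if it has a degree-$d$ sum-of-squares proof of $b-|x|^a|y|\ge 0$, and, for some rational $c\le b$, a degree-$d$ sum-of-squares proof of $c-|x|^a|y|\ge0$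 of total bit complexity at most $B$. Let $B(k,m,p)$ be the random bipartite graph with $k$ left and $m$ right vertices in which each of the $km$ possible edges is present independently with probability $p$. **Theorem.** There are absolute constants $A>0$ and $K\in\mathbb N$ such that for every $\varepsilon>0$ there is $N$ with the following property. Let $1\le k\le n$ be integers, let $0<p<1$, and let $H\sim B(k,n-k,p)$. With probability at least $0.99$ both of the following hold. 1. If $n\ge N$ and $p,\,1-p\ge n^{-(1-\varepsilon)}$, then $\mathcal B(H)$ certifies $$|x|\,|y|\le A\,\frac{np}{1-p}$$ in degree $4$ and bit complexity $Kn^{K}$. 2. For every integer $r\ge1$ with $$k\ \ge\ A\,\max\left\{\sqrt{rn\log n}\;\frac{\max\{\frac{p}{1-p},\frac{1-p}{p}\}^{r}\,p^{r}}{(1-p)^{r+1}},\ \ \frac{p\log n}{1-p}\right\},$$ $\mathcal B(H)$ certifies $$|x|^{4r}|y|\le(1000r)^{10r}\,n\left(\frac{n\,\max\{\frac{p}{1-p},\frac{1-p}{p}\}^{r}\,p^{r}}{k\,(1-p)^{r+1}}\right)^{4}$$ in degree $6r+2$ and bit complexity $Kn^{Kr}$. (For $p\ge\frac12$ the first term in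 the lower bound on $k$ is $\sqrt{rn\log n}\,p^{2r}/(1-p)^{2r+1}$.) -/

import Mathlib

open MvPolynomial MeasureTheory ProbabilityTheory

noncomputable section

/-- A bipartite graph with left vertex set `Fin k` and right vertex set `Fin m`, given by its
adjacency table: `{u, v}` is an edge iff `H (u, v) = true`. -/
abbrev BipGraph (k m : ℕ) : Type := Fin k × Fin m → Bool

/-- The random bipartite graph `B(k, m, p)`: each of the `k * m` possible edges is present with
probability `p`, independently. -/
def randomBip (k m : ℕ) (p : unitInterval) : Measure (BipGraph k m) :=
  Measure.pi fun _ => bernoulliMeasure true false p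

/-- Sum-of-squares proofs with real coefficients: `{f i ≥ 0 | i}` derives `g ≥ 0` in degree `d` if
`g = ∑_S s_S * ∏_{i ∈ S} f i`, the sum running over all sets `S` of constraints, where every `s_S`
is a sum of squares and every summand has degree at most `d`. -/
def SoSDerives {σ ι : Type} [Fintype ι] (f : ι → MvPolynomial σ ℝ) (d : ℕ)
    (g : MvPolynomial σ ℝ) : Prop :=
  ∃ s : Finset ι → MvPolynomial σ ℝ,
    (∀ S, IsSumSq (s S)) ∧
    (∀ S, (s S * ∏ i ∈ S, f i).totalDegree ≤ d) ∧
    g = ∑ S, s S * ∏ i ∈ S, f i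

/-- The number of bits of a rational number in lowest terms: a sign bit and the binary lengths of
numerator and denominator. -/
def ratBits (q : ℚ) : ℕ := 1 + q.num.natAbs.size + q.den.size

/-- The number of bits needed to write down the (nonzero) coefficients of a rational polynomial. -/
def polyBits {σ : Type} (f : MvPolynomial σ ℚ) : ℕ := ∑ a ∈ f.support, ratBits (f.coeff a)

/-- Sum-of-squares proofs of bounded total bit complexity: `{f i ≥ 0 | i}` derives `g ≥ 0` in degree
`d` and total bit complexity `B` if all polynomials of the proof have rational coefficients, and the
coefficients of all the constraints `f i`, of the conclusion `g` and of all the multipliers `s_S`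
take at most `B` bits altogether. The multipliers have rational coefficients and are sums of squares
of real polynomials. -/
def SoSDerivesBits {σ ι : Type} [Fintype ι] (f : ι → MvPolynomial σ ℚ) (d B : ℕ)
    (g : MvPolynomial σ ℚ) : Prop :=
  ∃ s : Finset ι → MvPolynomial σ ℚ,
    (∀ S, IsSumSq (MvPolynomial.map (algebraMap ℚ ℝ) (s S))) ∧
    (∀ S, (s S * ∏ i ∈ S, f i).totalDegree ≤ d) ∧
    g = ∑ S, s S * ∏ i ∈ S, f i ∧
    (∑ i, polyBits (f i)) + polyBits g + ∑ S, polyBits (s S) ≤ B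

/-- The polynomial `|x| = ∑_u x_u` in the variables `x_u` (`u` a left vertex), `y_v` (`v` a right
vertex). -/
def sizeX (R : Type) [CommRing R] (k m : ℕ) : MvPolynomial (Fin k ⊕ Fin m) R :=
  ∑ u : Fin k, X (Sum.inl u)

/-- The polynomial `|y| = ∑_v y_v`. -/
def sizeY (R : Type) [CommRing R] (k m : ℕ) : MvPolynomial (Fin k ⊕ Fin m) R :=
  ∑ v : Fin m, X (Sum.inr v)

/-- Names of the equations of the biclique system: one for each left vertex, one for each right
vertex, one for the total size, one for each non-edge. -/
abbrev BicliqueIdx {k m : ℕ} (H : BipGraph k m) : Type :=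
  Fin k ⊕ Fin m ⊕ Unit ⊕ {e : Fin k × Fin m // H e = false}

/-- The biclique system `B(H)` of a bipartite graph with `k` left vertices, each polynomial standing
for the equation "polynomial = 0": `x_u² = x_u`, `y_v² = y_v`, `|x| + |y| = k`, and `x_u y_v = 0`
for every non-edge. -/
def bicliqueEq (R : Type) [CommRing R] {k m : ℕ} (H : BipGraph k m) :
    BicliqueIdx H → MvPolynomial (Fin k ⊕ Fin m) R
  | .inl u => X (Sum.inl u) ^ 2 - X (Sum.inl u)
  | .inr (.inl v) => X (Sum.inr v) ^ 2 - X (Sum.inr v)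
  | .inr (.inr (.inl _)) => sizeX R k m + sizeY R k m - C (k : R)
  | .inr (.inr (.inr e)) => X (Sum.inl e.1.1) * X (Sum.inr e.1.2)

/-- The biclique system as a system of inequalities "polynomial `≥ 0`": each equation `f = 0` is the
pair `f ≥ 0`, `-f ≥ 0`. -/
def bicliqueSystem (R : Type) [CommRing R] {k m : ℕ} (H : BipGraph k m) :
    BicliqueIdx H × Bool → MvPolynomial (Fin k ⊕ Fin m) R
  | (i, true) => bicliqueEq R H i
  | (i, false) => - bicliqueEq R H i

/-- `B(H)` has a degree-`d` sum-of-squares proof of `|x|^a * |y| ≤ b`, of total bit complexity at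
most `B`. Since the real number `b` need not be rational, the bit complexity is that of a proof of
`|x|^a * |y| ≤ c` for some rational `c ≤ b`. -/
def BicliqueCertificate {k m : ℕ} (H : BipGraph k m) (d a : ℕ) (b : ℝ) (B : ℕ) : Prop :=
  SoSDerives (bicliqueSystem ℝ H) d (C b - sizeX ℝ k m ^ a * sizeY ℝ k m) ∧
  ∃ c : ℚ, (c : ℝ) ≤ b ∧
    SoSDerivesBits (bicliqueSystem ℚ H) d B (C c - sizeX ℚ k m ^ a * sizeY ℚ k m)

end

/-!
Give the edges of `H` the weight `1 - p` and the non-edges the weight `-p`, rounded to integers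
`w ≈ (1 - p) n` and `-s ≈ -p n`. On a biclique every weight is `w`, hence
`y_v * (∑ u, a_uv * x_u) ^ (2 * r) = y_v * (w * |x|) ^ (2 * r)`, and summing over `v` gives
`w ^ (2 * r) * |x| ^ (2 * r) * |y| ≤ ∑ v, (∑ u, a_uv * x_u) ^ (2 * r)`.

For `r = 1` the right-hand side is at most `‖a‖² * |x|`, since `x_u² = x_u`. The norm is bounded by
a moment of order `n * p * (1 - p)`. Every monomial in the trace of the moment is a closed walk,
and its expectation is at most that for a matrix of centered signs restricted to a random set of
vertices of density `p * (1 - p)`, up to the factor `(p * (1 - p))⁻¹`, because a closed walk has at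
most one vertex more than it has distinct edges. The restricted matrix is so small that a net
bounds its norm.

For larger `r` the right-hand side is a sum over tuples of `2 * r` left vertices. Unless every
entry of the tuple is repeated, its coefficient is a centered sum over the right vertices, which is
small by Hoeffding's inequality. The other tuples use at most `r` vertices and contribute a
multiple of `|x| ^ r`. Since all degrees are bounded away from `k`, the equation `|x| + |y| = k`
forces `|y|` to be large unless it is zero, so the first kind of tuple is absorbed in the left-hand
side, which bounds `|x| ^ r`.

All certificates are built over the integers, where degrees and coefficient sizes are easy to track.
-/

/-! ### Integer sum-of-squares certificates -/

section L1Norm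
variable {σ : Type*}

/-- The sum of the absolute values of the coefficients of an integer polynomial. It is the size
measure that survives sums and products, and it bounds the bit complexity from above. -/
def l1Norm (p : MvPolynomial σ ℤ) : ℕ := ∑ a ∈ p.support, (p.coeff a).natAbs

lemma l1Norm_eq_sum_of_subset (p : MvPolynomial σ ℤ) {s : Finset (σ →₀ ℕ)} (h : p.support ⊆ s) :
    l1Norm p = ∑ a ∈ s, (p.coeff a).natAbs :=
  Finset.sum_subset h fun a _ ha => by rw [notMem_support_iff.mp ha, Int.natAbs_zero]

lemma l1Norm_zero : l1Norm (0 : MvPolynomial σ ℤ) = 0 := by simp [l1Norm]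

lemma l1Norm_monomial (a : σ →₀ ℕ) (c : ℤ) : l1Norm (monomial a c) = c.natAbs := by
  classical
  rw [l1Norm_eq_sum_of_subset _ support_monomial_subset]
  simp

lemma l1Norm_add_le (p q : MvPolynomial σ ℤ) : l1Norm (p + q) ≤ l1Norm p + l1Norm q := by
  classical
  rw [l1Norm_eq_sum_of_subset (p + q) support_add,
    l1Norm_eq_sum_of_subset p (Finset.subset_union_left (s₂ := q.support)),
    l1Norm_eq_sum_of_subset q (Finset.subset_union_right (s₁ := p.support)),
    ← Finset.sum_add_distrib]
  exact Finset.sum_le_sum fun a _ => by rw [coeff_add]; exact Int.natAbs_add_le _ _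

lemma l1Norm_neg (p : MvPolynomial σ ℤ) : l1Norm (-p) = l1Norm p := by
  simp [l1Norm, support_neg]

lemma l1Norm_sum_le {ι : Type*} (s : Finset ι) (f : ι → MvPolynomial σ ℤ) :
    l1Norm (∑ i ∈ s, f i) ≤ ∑ i ∈ s, l1Norm (f i) :=
  Finset.le_sum_of_subadditive _ l1Norm_zero.le l1Norm_add_le s f

lemma l1Norm_monomial_mul_le (a : σ →₀ ℕ) (c : ℤ) (q : MvPolynomial σ ℤ) :
    l1Norm (monomial a c * q) ≤ c.natAbs * l1Norm q := by
  conv_lhs => rw [q.as_sum, Finset.mul_sum]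
  refine (l1Norm_sum_le _ _).trans ?_
  rw [l1Norm, Finset.mul_sum]
  exact Finset.sum_le_sum fun b _ => by rw [monomial_mul, l1Norm_monomial, Int.natAbs_mul]

lemma l1Norm_mul_le (p q : MvPolynomial σ ℤ) : l1Norm (p * q) ≤ l1Norm p * l1Norm q := by
  conv_lhs => rw [p.as_sum, Finset.sum_mul]
  refine (l1Norm_sum_le _ _).trans ?_
  rw [l1Norm, Finset.sum_mul]
  exact Finset.sum_le_sum fun a _ => l1Norm_monomial_mul_le a _ q

/-- `p` has total degree at most `d` and coefficients of total absolute value at most `L`. -/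
structure SizeLE (p : MvPolynomial σ ℤ) (d L : ℕ) : Prop where
  totalDegree_le : p.totalDegree ≤ d
  l1Norm_le : l1Norm p ≤ L

namespace SizeLE
variable {p q : MvPolynomial σ ℤ} {d e L M : ℕ}

lemma mono (h : SizeLE p d L) (hd : d ≤ e) (hL : L ≤ M) : SizeLE p e M :=
  ⟨h.1.trans hd, h.2.trans hL⟩

lemma zero : SizeLE (0 : MvPolynomial σ ℤ) d L := ⟨by simp, by simp [l1Norm_zero]⟩

lemma intConst (c : ℤ) : SizeLE (C c : MvPolynomial σ ℤ) d c.natAbs :=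
  ⟨by rw [totalDegree_C]; exact d.zero_le, by rw [C_apply, l1Norm_monomial]⟩

lemma natCast (c : ℕ) : SizeLE (c : MvPolynomial σ ℤ) d c := by
  simpa using intConst (σ := σ) (d := d) (c : ℤ)

lemma one : SizeLE (1 : MvPolynomial σ ℤ) d 1 := by simpa using natCast (σ := σ) (d := d) 1

lemma X (i : σ) : SizeLE (MvPolynomial.X i : MvPolynomial σ ℤ) 1 1 :=
  ⟨by simp, by rw [MvPolynomial.X, l1Norm_monomial]; rfl⟩

lemma add (hp : SizeLE p d L) (hq : SizeLE q d M) : SizeLE (p + q) d (L + M) :=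
  ⟨(totalDegree_add _ _).trans (max_le hp.1 hq.1),
    (l1Norm_add_le _ _).trans (Nat.add_le_add hp.2 hq.2)⟩

lemma neg (hp : SizeLE p d L) : SizeLE (-p) d L :=
  ⟨(totalDegree_neg p).trans_le hp.1, (l1Norm_neg p).trans_le hp.2⟩

lemma sub (hp : SizeLE p d L) (hq : SizeLE q d M) : SizeLE (p - q) d (L + M) := by
  rw [sub_eq_add_neg]; exact hp.add hq.neg

lemma mul (hp : SizeLE p d L) (hq : SizeLE q e M) : SizeLE (p * q) (d + e) (L * M) :=
  ⟨(totalDegree_mul _ _).trans (Nat.add_le_add hp.1 hq.1),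
    (l1Norm_mul_le _ _).trans (Nat.mul_le_mul hp.2 hq.2)⟩

lemma sum {ι : Type*} {s : Finset ι} {f : ι → MvPolynomial σ ℤ}
    (h : ∀ i ∈ s, SizeLE (f i) d L) : SizeLE (∑ i ∈ s, f i) d (s.card * L) :=
  ⟨totalDegree_finsetSum_le fun i hi => (h i hi).1,
    (l1Norm_sum_le _ _).trans (Finset.sum_le_card_nsmul _ _ _ fun i hi => (h i hi).2)⟩

lemma prod {ι : Type*} {s : Finset ι} {f : ι → MvPolynomial σ ℤ}
    (h : ∀ i ∈ s, SizeLE (f i) d L) : SizeLE (∏ i ∈ s, f i) (s.card * d) (L ^ s.card) := by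
  classical
  induction s using Finset.induction_on with
  | empty => simpa using one (σ := σ) (d := 0)
  | insert a s ha ih =>
    rw [Finset.prod_insert ha, Finset.card_insert_of_notMem ha, Nat.succ_mul, add_comm, pow_succ']
    exact (h a (by simp)).mul (ih fun i hi => h i (by simp [hi]))

lemma pow (hp : SizeLE p d L) (r : ℕ) : SizeLE (p ^ r) (r * d) (L ^ r) := by
  simpa using prod (s := Finset.range r) fun _ _ => hp

end SizeLE
end L1Norm

section IsRealSumSq
variable {σ : Type*} {p q : MvPolynomial σ ℤ}

/-- An integer polynomial that is a sum of squares of real polynomials, as the multipliers of a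
rational sum-of-squares proof are allowed to be. -/
def IsRealSumSq (p : MvPolynomial σ ℤ) : Prop :=
  IsSumSq (MvPolynomial.map (Int.castRingHom ℝ) p)

namespace IsRealSumSq

lemma zero : IsRealSumSq (0 : MvPolynomial σ ℤ) := by
  rw [IsRealSumSq, map_zero]; exact IsSumSq.zero

lemma sq (p : MvPolynomial σ ℤ) : IsRealSumSq (p ^ 2) := by
  rw [IsRealSumSq, pow_two, map_mul]; exact IsSumSq.mul_self _

lemma add (hp : IsRealSumSq p) (hq : IsRealSumSq q) : IsRealSumSq (p + q) := by
  rw [IsRealSumSq, map_add]; exact IsSumSq.add hp hq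

lemma mul (hp : IsRealSumSq p) (hq : IsRealSumSq q) : IsRealSumSq (p * q) := by
  rw [IsRealSumSq, map_mul]; exact IsSumSq.mul hp hq

lemma sum {ι : Type*} {s : Finset ι} {f : ι → MvPolynomial σ ℤ}
    (h : ∀ i ∈ s, IsRealSumSq (f i)) : IsRealSumSq (∑ i ∈ s, f i) := by
  rw [IsRealSumSq, map_sum]; exact IsSumSq.sum h

lemma natCast (c : ℕ) : IsRealSumSq (c : MvPolynomial σ ℤ) := by
  rw [IsRealSumSq, map_natCast]; exact IsSumSq.natCast c

lemma one : IsRealSumSq (1 : MvPolynomial σ ℤ) := by simpa using natCast (σ := σ) 1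

end IsRealSumSq
end IsRealSumSq

section IntSoSDerives
variable {σ ι : Type*} [Fintype ι] {f : ι → MvPolynomial σ ℤ} {d e L M : ℕ}
  {G G' q : MvPolynomial σ ℤ}

/-- A sum-of-squares proof of `G ≥ 0` from `{f i ≥ 0 | i}` with integer coefficients,
`G = t + ∑ i, s i * f i`, that uses no products of constraints: the multipliers are sums of squares
of real polynomials with coefficients of total absolute value at most `L`, and all summands have
degree at most `d`. -/
def IntSoSDerives (f : ι → MvPolynomial σ ℤ) (d L : ℕ) (G : MvPolynomial σ ℤ) : Prop :=
  ∃ (t : MvPolynomial σ ℤ) (s : ι → MvPolynomial σ ℤ),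
    IsRealSumSq t ∧ SizeLE t d L ∧
    (∀ i, IsRealSumSq (s i) ∧ (s i * f i).totalDegree ≤ d ∧ l1Norm (s i) ≤ L) ∧
    G = t + ∑ i, s i * f i

namespace IntSoSDerives

lemma congr (h : IntSoSDerives f d L G) (e : G' = G) : IntSoSDerives f d L G' := e ▸ h

lemma mono (h : IntSoSDerives f d L G) (hd : d ≤ e) (hL : L ≤ M) : IntSoSDerives f e M G := by
  obtain ⟨t, s, ht, htL, hs, hG⟩ := h
  exact ⟨t, s, ht, htL.mono hd hL,
    fun i => ⟨(hs i).1, (hs i).2.1.trans hd, (hs i).2.2.trans hL⟩, hG⟩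

lemma of_sumSq (h : IsRealSumSq q) (hq : SizeLE q d L) : IntSoSDerives f d L q :=
  ⟨q, 0, h, hq, fun _ => ⟨IsRealSumSq.zero, by simp, by simp [l1Norm_zero]⟩, by simp⟩

lemma zero : IntSoSDerives f d L 0 := of_sumSq IsRealSumSq.zero SizeLE.zero

lemma add (h : IntSoSDerives f d L G) (h' : IntSoSDerives f d M G') :
    IntSoSDerives f d (L + M) (G + G') := by
  obtain ⟨t, s, ht, htL, hs, rfl⟩ := h
  obtain ⟨t', s', ht', htL', hs', rfl⟩ := h'
  refine ⟨t + t', s + s', ht.add ht', htL.add htL', fun i => ⟨(hs i).1.add (hs' i).1, ?_,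
    (l1Norm_add_le _ _).trans (Nat.add_le_add (hs i).2.2 (hs' i).2.2)⟩, ?_⟩
  · rw [Pi.add_apply, add_mul]
    exact (totalDegree_add _ _).trans (max_le (hs i).2.1 (hs' i).2.1)
  · simp only [Pi.add_apply, add_mul, Finset.sum_add_distrib]
    ring

lemma sum {κ : Type*} {s : Finset κ} {g : κ → MvPolynomial σ ℤ}
    (h : ∀ j ∈ s, IntSoSDerives f d L (g j)) :
    IntSoSDerives f d (s.card * L) (∑ j ∈ s, g j) := by
  classical
  induction s using Finset.induction_on with
  | empty => simpa using zero
  | insert a s ha ih =>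
    rw [Finset.sum_insert ha, Finset.card_insert_of_notMem ha, Nat.succ_mul, add_comm (_ * L)]
    exact (h a (by simp)).add (ih fun j hj => h j (by simp [hj]))

lemma sumSq_mul (h : IntSoSDerives f d L G) (hq : IsRealSumSq q) (hqM : SizeLE q e M) :
    IntSoSDerives f (e + d) (M * L) (q * G) := by
  obtain ⟨t, s, ht, htL, hs, rfl⟩ := h
  refine ⟨q * t, fun i => q * s i, hq.mul ht, hqM.mul htL, fun i => ⟨hq.mul (hs i).1, ?_,
    (l1Norm_mul_le _ _).trans (Nat.mul_le_mul hqM.2 (hs i).2.2)⟩, ?_⟩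
  · rw [mul_assoc]
    exact (totalDegree_mul _ _).trans (Nat.add_le_add hqM.1 (hs i).2.1)
  · simp only [mul_add, Finset.mul_sum, mul_assoc]

lemma natCast_mul (h : IntSoSDerives f d L G) (c : ℕ) : IntSoSDerives f d (c * L) (c * G) := by
  simpa using h.sumSq_mul (IsRealSumSq.natCast c) (SizeLE.natCast (d := 0) c)

lemma sumSq_mul_constraint (hq : IsRealSumSq q) (hqM : SizeLE q e M) (i : ι)
    (hf : (f i).totalDegree ≤ d) : IntSoSDerives f (e + d) M (q * f i) := by
  classical
  refine ⟨0, Pi.single i q, IsRealSumSq.zero, SizeLE.zero, fun j => ?_, ?_⟩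
  · obtain rfl | hji := eq_or_ne j i
    · rw [Pi.single_eq_same]
      exact ⟨hq, (totalDegree_mul _ _).trans (Nat.add_le_add hqM.1 hf), hqM.2⟩
    · rw [Pi.single_eq_of_ne hji]
      exact ⟨IsRealSumSq.zero, by simp, by simp [l1Norm_zero]⟩
  · simp [Pi.single_apply]

end IntSoSDerives
end IntSoSDerives

/-- The system of inequalities that expresses the equations `f i = 0`. -/
noncomputable def eqnSystem {R σ ι : Type*} [CommRing R] (f : ι → MvPolynomial σ R) :
    ι × Bool → MvPolynomial σ R
  | (i, true) => f i
  | (i, false) => -f i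

lemma totalDegree_eqnSystem {R σ ι : Type*} [CommRing R] (f : ι → MvPolynomial σ R)
    (i : ι × Bool) : (eqnSystem f i).totalDegree = (f i.1).totalDegree := by
  rcases i with ⟨i, _ | _⟩
  exacts [totalDegree_neg _, rfl]

section IdealDerives
variable {σ ι : Type*} [Fintype ι] {f : ι → MvPolynomial σ ℤ} {d e D L M : ℕ}
  {G G' q : MvPolynomial σ ℤ}

/-- A Nullstellensatz proof of `G = 0` from `{f i = 0 | i}`: `G` is a combination of the `f i` with
integer multipliers of degree at most `e` and coefficients of total absolute value at most `L`. -/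
def IdealDerives (f : ι → MvPolynomial σ ℤ) (e L : ℕ) (G : MvPolynomial σ ℤ) : Prop :=
  ∃ h : ι → MvPolynomial σ ℤ, (∀ i, SizeLE (h i) e L) ∧ G = ∑ i, h i * f i

namespace IdealDerives

lemma congr (h : IdealDerives f d L G) (e : G' = G) : IdealDerives f d L G' := e ▸ h

lemma mono (h : IdealDerives f d L G) (hd : d ≤ e) (hL : L ≤ M) : IdealDerives f e M G := by
  obtain ⟨t, ht, hG⟩ := h
  exact ⟨t, fun i => (ht i).mono hd hL, hG⟩

lemma zero : IdealDerives f d L 0 := ⟨0, fun _ => SizeLE.zero, by simp⟩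

lemma equation (i : ι) : IdealDerives f d 1 (f i) := by
  classical
  refine ⟨fun j => if j = i then 1 else 0, fun j => ?_, by simp⟩
  dsimp only
  split_ifs
  exacts [SizeLE.one, SizeLE.zero]

lemma add (h : IdealDerives f d L G) (h' : IdealDerives f d M G') :
    IdealDerives f d (L + M) (G + G') := by
  obtain ⟨t, ht, rfl⟩ := h
  obtain ⟨t', ht', rfl⟩ := h'
  exact ⟨t + t', fun i => (ht i).add (ht' i), by
    simp only [Pi.add_apply, add_mul, Finset.sum_add_distrib]⟩

lemma neg (h : IdealDerives f d L G) : IdealDerives f d L (-G) := by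
  obtain ⟨t, ht, rfl⟩ := h
  exact ⟨-t, fun i => (ht i).neg, by simp⟩

lemma sum {κ : Type*} {s : Finset κ} {g : κ → MvPolynomial σ ℤ}
    (h : ∀ j ∈ s, IdealDerives f d L (g j)) :
    IdealDerives f d (s.card * L) (∑ j ∈ s, g j) := by
  classical
  induction s using Finset.induction_on with
  | empty => simpa using zero
  | insert a s ha ih =>
    rw [Finset.sum_insert ha, Finset.card_insert_of_notMem ha, Nat.succ_mul, add_comm (_ * L)]
    exact (h a (by simp)).add (ih fun j hj => h j (by simp [hj]))

lemma mul (h : IdealDerives f d L G) (hq : SizeLE q e M) :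
    IdealDerives f (e + d) (M * L) (q * G) := by
  obtain ⟨t, ht, rfl⟩ := h
  exact ⟨fun i => q * t i, fun i => hq.mul (ht i), by simp only [Finset.mul_sum, mul_assoc]⟩

-- `4 h f = (h + 1)² f + (h - 1)² (-f)` turns an arbitrary multiplier into two squares.
lemma four_mul_intSoSDerives (h : IdealDerives f e L G) (hf : ∀ i, (f i).totalDegree ≤ D) :
    IntSoSDerives (eqnSystem f) (2 * e + D) ((L + 1) ^ 2) (4 * G) := by
  obtain ⟨t, ht, rfl⟩ := h
  have size_sq (i : ι) (b : Bool) :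
      SizeLE ((t i + if b then 1 else -1) ^ 2) (2 * e) ((L + 1) ^ 2) := by
    refine ((ht i).add ?_).pow 2
    cases b
    exacts [SizeLE.one.neg, SizeLE.one]
  refine ⟨0, fun i => (t i.1 + if i.2 then 1 else -1) ^ 2, IsRealSumSq.zero, SizeLE.zero,
    fun i => ⟨IsRealSumSq.sq _, (totalDegree_mul _ _).trans (Nat.add_le_add (size_sq _ _).1 ?_),
      (size_sq _ _).2⟩, ?_⟩
  · exact (totalDegree_eqnSystem f i).trans_le (hf i.1)
  · rw [Fintype.sum_prod_type, Finset.mul_sum, zero_add]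
    refine Finset.sum_congr rfl fun i _ => ?_
    simp only [Fintype.sum_bool, eqnSystem, if_true, Bool.false_eq_true, if_false]
    ring

end IdealDerives
end IdealDerives

section RationalProofs

lemma ratBits_div_le (z : ℤ) (hz : z ≠ 0) {W : ℕ} (hW : 0 < W) :
    ratBits ((z : ℚ) / W) ≤ z.natAbs * (2 + W.size) := by
  have h_divInt : (z : ℚ) / W = Rat.divInt z (W : ℤ) := by rw [Rat.divInt_eq_div]; simp
  have h_num : ((z : ℚ) / W).num.natAbs ≤ z.natAbs := by
    rw [h_divInt]
    exact Nat.le_of_dvd (Int.natAbs_pos.mpr hz)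
      (Int.natAbs_dvd_natAbs.mpr (Rat.num_dvd z (by positivity)))
  have h_den : ((z : ℚ) / W).den ≤ W := by
    rw [h_divInt]
    exact Nat.le_of_dvd hW (by exact_mod_cast Rat.den_dvd z W)
  have h_size : z.natAbs.size ≤ z.natAbs := Nat.size_le.mpr Nat.lt_two_pow_self
  have h_pos : 1 ≤ z.natAbs := Int.natAbs_pos.mpr hz
  have := Nat.size_le_size h_num
  have := Nat.size_le_size h_den
  unfold ratBits
  nlinarith

/-- The rational polynomial `p / W`: clearing denominators in reverse. -/
noncomputable def ratDiv {σ : Type*} (W : ℕ) (p : MvPolynomial σ ℤ) : MvPolynomial σ ℚ :=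
  C (1 / (W : ℚ)) * MvPolynomial.map (Int.castRingHom ℚ) p

lemma polyBits_ratDiv_le {σ : Type} {W : ℕ} (hW : 0 < W) (p : MvPolynomial σ ℤ) :
    polyBits (ratDiv W p) ≤ l1Norm p * (2 + W.size) := by
  have h_coeff (a) : (ratDiv W p).coeff a = ((p.coeff a : ℤ) : ℚ) / W := by
    rw [ratDiv, coeff_C_mul, coeff_map, eq_intCast, one_div_mul_eq_div]
  have h_support : (ratDiv W p).support ⊆ p.support := fun a ha => by
    contrapose! ha
    rw [notMem_support_iff] at ha ⊢
    rw [h_coeff, ha, Int.cast_zero, zero_div]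
  rw [polyBits, l1Norm, Finset.sum_mul]
  refine le_trans (Finset.sum_le_sum fun a ha => ?_) (Finset.sum_le_sum_of_subset h_support)
  rw [h_coeff]
  exact ratBits_div_le _ (mem_support_iff.mp (h_support ha)) hW

lemma polyBits_map_intCast_le {σ : Type} (p : MvPolynomial σ ℤ) :
    polyBits (MvPolynomial.map (Int.castRingHom ℚ) p) ≤ 3 * l1Norm p := by
  simpa [ratDiv, mul_comm] using polyBits_ratDiv_le Nat.one_pos p

lemma totalDegree_map_intCast_le {σ R : Type*} [CommRing R] (p : MvPolynomial σ ℤ) :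
    (MvPolynomial.map (Int.castRingHom R) p).totalDegree ≤ p.totalDegree :=
  Finset.sup_mono (support_map_subset _ _)

lemma totalDegree_ratDiv_mul_map_le {σ : Type*} (W : ℕ) (p q : MvPolynomial σ ℤ) :
    (ratDiv W p * MvPolynomial.map (Int.castRingHom ℚ) q).totalDegree ≤ (p * q).totalDegree := by
  rw [ratDiv, mul_assoc, ← map_mul]
  refine (totalDegree_mul _ _).trans ?_
  rw [totalDegree_C, zero_add]
  exact totalDegree_map_intCast_le _

lemma isSumSq_C {σ : Type*} {r : ℝ} (hr : 0 ≤ r) : IsSumSq (C r : MvPolynomial σ ℝ) := by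
  rw [← Real.mul_self_sqrt hr, map_mul]; exact IsSumSq.mul_self _

lemma IsRealSumSq.map_ratDiv {σ : Type*} {p : MvPolynomial σ ℤ} (hp : IsRealSumSq p) (W : ℕ) :
    IsSumSq (MvPolynomial.map (algebraMap ℚ ℝ) (ratDiv W p)) := by
  rw [ratDiv, map_mul, map_C, MvPolynomial.map_map, RingHom.ext_int ((algebraMap ℚ ℝ).comp _)]
  exact (isSumSq_C (by simp)).mul hp

lemma option_toFinset_injective {α : Type*} :
    Function.Injective (Option.toFinset : Option α → Finset α) :=
  fun a b h => Option.ext fun i => by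
    rw [← Option.mem_def, ← Option.mem_toFinset, h, Option.mem_toFinset, Option.mem_def]

variable {σ ι : Type} [Fintype ι] {d B : ℕ}

lemma sosDerivesBits_of_option {f : ι → MvPolynomial σ ℚ} (u : Option ι → MvPolynomial σ ℚ)
    (hsos : ∀ o, IsSumSq (MvPolynomial.map (algebraMap ℚ ℝ) (u o)))
    (hdeg : ∀ o, (u o * ∏ i ∈ o.toFinset, f i).totalDegree ≤ d) {g : MvPolynomial σ ℚ}
    (hg : g = ∑ o, u o * ∏ i ∈ o.toFinset, f i)
    (hB : (∑ i, polyBits (f i)) + polyBits g + ∑ o, polyBits (u o) ≤ B) :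
    SoSDerivesBits f d B g := by
  let s : Finset ι → MvPolynomial σ ℚ := Function.extend Option.toFinset u 0
  have s_toFinset (o : Option ι) : s o.toFinset = u o :=
    option_toFinset_injective.extend_apply u (0 : Finset ι → MvPolynomial σ ℚ) o
  have s_other (S) (hS : S ∉ Set.range (Option.toFinset : Option ι → Finset ι)) : s S = 0 :=
    Function.extend_apply' u (0 : Finset ι → MvPolynomial σ ℚ) S hS
  have forall_s {P : Finset ι → MvPolynomial σ ℚ → Prop}
      (h : ∀ o : Option ι, P o.toFinset (u o)) (h0 : ∀ S, P S 0) (S) : P S (s S) := by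
    by_cases hS : S ∈ Set.range (Option.toFinset : Option ι → Finset ι)
    · obtain ⟨o, rfl⟩ := hS
      rw [s_toFinset]; exact h o
    · rw [s_other S hS]; exact h0 S
  refine ⟨s, forall_s (P := fun _ p => IsSumSq (MvPolynomial.map (algebraMap ℚ ℝ) p)) hsos ?_,
    forall_s (P := fun S p => (p * ∏ i ∈ S, f i).totalDegree ≤ d) hdeg ?_, ?_, ?_⟩
  · intro _; rw [map_zero]; exact IsSumSq.zero
  · intro _; simp
  · rw [hg]
    refine Fintype.sum_of_injective _ option_toFinset_injective _ _ (fun S hS => ?_) fun o => ?_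
    · rw [s_other S hS, zero_mul]
    · rw [s_toFinset]
  · rwa [← Fintype.sum_of_injective _ option_toFinset_injective (fun o => polyBits (u o)) _
      (fun S hS => ?_) fun o => ?_]
    · rw [s_other S hS]; simp [polyBits]
    · rw [s_toFinset]

theorem IntSoSDerives.sosDerivesBits {f : ι → MvPolynomial σ ℤ} {L W : ℕ} {G : MvPolynomial σ ℤ}
    (hW : 0 < W) (h : IntSoSDerives f d L ((W : MvPolynomial σ ℤ) * G))
    (hB : 3 * ∑ i, l1Norm (f i) + 3 * l1Norm G
      + (1 + Fintype.card ι) * (L * (2 + W.size)) ≤ B) :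
    SoSDerivesBits (fun i => MvPolynomial.map (Int.castRingHom ℚ) (f i)) d B
      (MvPolynomial.map (Int.castRingHom ℚ) G) := by
  obtain ⟨t, s, ht, htL, hs, hG⟩ := h
  have h_bits {p : MvPolynomial σ ℤ} (hp : l1Norm p ≤ L) :
      polyBits (ratDiv W p) ≤ L * (2 + W.size) :=
    (polyBits_ratDiv_le hW p).trans (by gcongr)
  refine sosDerivesBits_of_option (fun o => ratDiv W (o.elim t s)) ?_ ?_ ?_ (le_trans ?_ hB)
  · rintro (_ | i)
    exacts [ht.map_ratDiv W, (hs i).1.map_ratDiv W]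
  · rintro (_ | i)
    · simpa using (totalDegree_ratDiv_mul_map_le W t 1).trans ((mul_one t).symm ▸ htL.1)
    · simpa using (totalDegree_ratDiv_mul_map_le W (s i) (f i)).trans (hs i).2.1
  · have h_div :
        MvPolynomial.map (Int.castRingHom ℚ) G = ratDiv W ((W : MvPolynomial σ ℤ) * G) := by
      have hW' : (W : ℚ) ≠ 0 := by positivity
      rw [ratDiv, map_mul, map_natCast, ← mul_assoc, ← map_natCast (C (σ := σ)), ← C_mul,
        one_div_mul_cancel hW', C_1, one_mul]
    rw [h_div, hG, Fintype.sum_option]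
    simp [ratDiv, mul_add, Finset.mul_sum, mul_assoc]
  · rw [Fintype.sum_option, add_mul, one_mul, Finset.mul_sum]
    gcongr
    · exact polyBits_map_intCast_le _
    · exact polyBits_map_intCast_le G
    · exact h_bits htL.2
    · exact Finset.sum_le_card_nsmul _ _ _ fun i _ => h_bits (hs i).2.2

lemma SoSDerivesBits.sosDerives_map {f : ι → MvPolynomial σ ℚ} {g : MvPolynomial σ ℚ}
    (h : SoSDerivesBits f d B g) :
    SoSDerives (fun i => MvPolynomial.map (algebraMap ℚ ℝ) (f i)) d
      (MvPolynomial.map (algebraMap ℚ ℝ) g) := by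
  obtain ⟨s, hs, hdeg, rfl, -⟩ := h
  refine ⟨fun S => MvPolynomial.map (algebraMap ℚ ℝ) (s S), hs, fun S => ?_, by simp⟩
  rw [← map_prod, ← map_mul]
  exact (Finset.sup_mono (support_map_subset _ _)).trans (hdeg S)

lemma SoSDerives.add_const {f : ι → MvPolynomial σ ℝ} {g : MvPolynomial σ ℝ}
    (h : SoSDerives f d g) {r : ℝ} (hr : 0 ≤ r) : SoSDerives f d (g + C r) := by
  classical
  obtain ⟨s, hs, hdeg, rfl⟩ := h
  refine ⟨s + (Pi.single ∅ (C r) : Finset ι → MvPolynomial σ ℝ), fun S => (hs S).add ?_,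
    fun S => ?_, ?_⟩
  · obtain rfl | hS := eq_or_ne S ∅
    · rw [Pi.single_eq_same]; exact isSumSq_C hr
    · rw [Pi.single_eq_of_ne hS]; exact IsSumSq.zero
  · rw [Pi.add_apply, add_mul]
    refine (totalDegree_add _ _).trans (max_le (hdeg S) ?_)
    obtain rfl | hS := eq_or_ne S ∅
    · simp
    · simp [Pi.single_eq_of_ne hS]
  · simp [add_mul, Finset.sum_add_distrib, Pi.single_apply]

end RationalProofs

section Biclique

/-- Integer polynomials in the indicators of the left and of the right vertices, the ring in which
all certificates are constructed. -/
abbrev BicliquePoly (k m : ℕ) : Type := MvPolynomial (Fin k ⊕ Fin m) ℤ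

variable {k m : ℕ} {H : BipGraph k m}

lemma map_sizeX {R S : Type} [CommRing R] [CommRing S] (φ : R →+* S) :
    MvPolynomial.map φ (sizeX R k m) = sizeX S k m := by simp [sizeX]

lemma map_sizeY {R S : Type} [CommRing R] [CommRing S] (φ : R →+* S) :
    MvPolynomial.map φ (sizeY R k m) = sizeY S k m := by simp [sizeY]

lemma map_bicliqueSystem {R S : Type} [CommRing R] [CommRing S] (φ : R →+* S) (H : BipGraph k m)
    (i : BicliqueIdx H × Bool) :
    MvPolynomial.map φ (bicliqueSystem R H i) = bicliqueSystem S H i := by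
  rcases i with ⟨u | v | _ | e, _ | _⟩ <;>
    simp [bicliqueSystem, bicliqueEq, map_sizeX, map_sizeY]

lemma bicliqueSystem_eq_eqnSystem (R : Type) [CommRing R] (H : BipGraph k m) :
    bicliqueSystem R H = eqnSystem (bicliqueEq R H) := by
  ext1 ⟨i, _ | _⟩ <;> rfl

lemma sizeLE_sum_X {σ ι : Type*} [Fintype ι] (x : ι → σ) :
    SizeLE (∑ i, X (x i) : MvPolynomial σ ℤ) 1 (Fintype.card ι) := by
  simpa using SizeLE.sum (s := Finset.univ) fun i _ => SizeLE.X (x i)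

lemma sizeLE_sizeX : SizeLE (sizeX ℤ k m) 1 k := by
  simpa [sizeX] using sizeLE_sum_X (Sum.inl : Fin k → Fin k ⊕ Fin m)

lemma sizeLE_sizeY : SizeLE (sizeY ℤ k m) 1 m := by
  simpa [sizeY] using sizeLE_sum_X (Sum.inr : Fin m → Fin k ⊕ Fin m)

lemma sizeLE_bicliqueEq (H : BipGraph k m) (i : BicliqueIdx H) :
    SizeLE (bicliqueEq ℤ H i) 2 (2 * k + m + 2) := by
  have h_bool (z : Fin k ⊕ Fin m) : SizeLE (X z ^ 2 - X z : MvPolynomial _ ℤ) 2 (2 * k + m + 2) :=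
    (((SizeLE.X z).pow 2).sub ((SizeLE.X z).mono one_le_two le_rfl)).mono le_rfl (by lia)
  rcases i with u | v | _ | e
  · exact h_bool _
  · exact h_bool _
  · refine ((sizeLE_sizeX.add sizeLE_sizeY).sub (SizeLE.intConst _)).mono one_le_two ?_
    rw [Int.natAbs_natCast]
    lia
  · exact ((SizeLE.X _).mul (SizeLE.X _)).mono le_rfl (by lia)

lemma totalDegree_bicliqueSystem_le (H : BipGraph k m) (i : BicliqueIdx H × Bool) :
    (bicliqueSystem ℤ H i).totalDegree ≤ 2 := by
  rw [bicliqueSystem_eq_eqnSystem, totalDegree_eqnSystem]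
  exact (sizeLE_bicliqueEq H i.1).1

lemma l1Norm_bicliqueSystem_le (H : BipGraph k m) (i : BicliqueIdx H × Bool) :
    l1Norm (bicliqueSystem ℤ H i) ≤ 2 * k + m + 2 := by
  rcases i with ⟨i, _ | _⟩
  exacts [(sizeLE_bicliqueEq H i).neg.2, (sizeLE_bicliqueEq H i).2]

lemma card_bicliqueIdx_le (H : BipGraph k m) :
    Fintype.card (BicliqueIdx H) ≤ k + m + 1 + k * m := by
  have : Fintype.card {e : Fin k × Fin m // H e = false} ≤ k * m := by
    simpa using Fintype.card_subtype_le fun e : Fin k × Fin m => H e = false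
  simp only [Fintype.card_sum, Fintype.card_fin, Fintype.card_unit]
  lia

theorem bicliqueCertificate_of_sosDerivesBits {a d B : ℕ} {b : ℝ} {c : ℚ} (hc : (c : ℝ) ≤ b)
    (h : SoSDerivesBits (bicliqueSystem ℚ H) d B (C c - sizeX ℚ k m ^ a * sizeY ℚ k m)) :
    BicliqueCertificate H d a b B := by
  refine ⟨?_, c, hc, h⟩
  have h_real := h.sosDerives_map.add_const (sub_nonneg.mpr hc)
  simp only [map_bicliqueSystem, map_sub, map_mul, map_pow, map_sizeX, map_sizeY, map_C,
    eq_ratCast] at h_real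
  convert h_real using 1
  ring

theorem IntSoSDerives.bicliqueCertificate {a d c W L B : ℕ} {b : ℝ} (hW : 0 < W) (hc : (c : ℝ) ≤ b)
    (h : IntSoSDerives (bicliqueSystem ℤ H) d L
      ((W : BicliquePoly k m) * (c - sizeX ℤ k m ^ a * sizeY ℤ k m)))
    (hB : 2 * (k + m + 1 + k * m) * (3 * (2 * k + m + 2)) + 3 * (c + k ^ a * m)
      + (1 + 2 * (k + m + 1 + k * m)) * (L * (2 + W.size)) ≤ B) :
    BicliqueCertificate H d a b B := by
  refine bicliqueCertificate_of_sosDerivesBits (c := c) (by exact_mod_cast hc) ?_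
  have h_card : Fintype.card (BicliqueIdx H × Bool) ≤ 2 * (k + m + 1 + k * m) := by
    rw [Fintype.card_prod, Fintype.card_bool]
    have := card_bicliqueIdx_le H
    lia
  have h_system : ∑ i, l1Norm (bicliqueSystem ℤ H i)
      ≤ 2 * (k + m + 1 + k * m) * (2 * k + m + 2) :=
    (Finset.sum_le_card_nsmul _ _ _ fun i _ => l1Norm_bicliqueSystem_le H i).trans
      (Nat.mul_le_mul_right _ h_card)
  have h_goal : l1Norm ((c : BicliquePoly k m) - sizeX ℤ k m ^ a * sizeY ℤ k m)
      ≤ c + k ^ a * m :=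
    ((SizeLE.natCast c).sub ((sizeLE_sizeX.pow a).mul sizeLE_sizeY)).2
  have h_bits := h.sosDerivesBits hW (B := B) <| le_trans (by
    rw [mul_left_comm (2 * _)]
    gcongr) hB
  simpa only [map_bicliqueSystem, map_sub, map_mul, map_pow, map_sizeX, map_sizeY, map_natCast]
    using h_bits

end Biclique

/-! ### Sizes bounded by powers of a fixed base -/

section PowerSizes
variable {σ ι : Type*} [Fintype ι] {f : ι → MvPolynomial σ ℤ} {p q G G' : MvPolynomial σ ℤ}
  {n a b d e D : ℕ}

lemma pow_add_pow_le_pow_succ (hn : 2 ≤ n) (a : ℕ) : n ^ a + n ^ a ≤ n ^ (a + 1) := by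
  rw [pow_succ, ← mul_two]; gcongr

namespace SizeLE

lemma mono_pow (h : SizeLE p d (n ^ a)) (hn : 1 ≤ n) (hd : d ≤ e) (hab : a ≤ b) :
    SizeLE p e (n ^ b) :=
  h.mono hd (Nat.pow_le_pow_right hn hab)

lemma add_pow (hp : SizeLE p d (n ^ a)) (hq : SizeLE q d (n ^ a)) (hn : 2 ≤ n) :
    SizeLE (p + q) d (n ^ (a + 1)) :=
  (hp.add hq).mono le_rfl (pow_add_pow_le_pow_succ hn a)

lemma sub_pow (hp : SizeLE p d (n ^ a)) (hq : SizeLE q d (n ^ a)) (hn : 2 ≤ n) :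
    SizeLE (p - q) d (n ^ (a + 1)) :=
  (hp.sub hq).mono le_rfl (pow_add_pow_le_pow_succ hn a)

lemma mul_pow (hp : SizeLE p d (n ^ a)) (hq : SizeLE q e (n ^ b)) :
    SizeLE (p * q) (d + e) (n ^ (a + b)) :=
  (hp.mul hq).mono le_rfl (pow_add n a b).ge

lemma sum_pow {κ : Type*} [Fintype κ] {g : κ → MvPolynomial σ ℤ} (hκ : Fintype.card κ ≤ n)
    (h : ∀ i, SizeLE (g i) d (n ^ a)) : SizeLE (∑ i, g i) d (n ^ (a + 1)) :=
  (sum fun i _ => h i).mono le_rfl ((Nat.mul_le_mul_right _ hκ).trans (pow_succ' n a).ge)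

lemma pow_pow (hp : SizeLE p d (n ^ a)) (r : ℕ) : SizeLE (p ^ r) (r * d) (n ^ (a * r)) :=
  (hp.pow r).mono le_rfl (pow_mul n a r).ge

end SizeLE

namespace IntSoSDerives

lemma mono_pow (h : IntSoSDerives f d (n ^ a) G) (hn : 1 ≤ n) (hd : d ≤ e) (hab : a ≤ b) :
    IntSoSDerives f e (n ^ b) G :=
  h.mono hd (Nat.pow_le_pow_right hn hab)

lemma add_pow (h : IntSoSDerives f d (n ^ a) G) (h' : IntSoSDerives f d (n ^ a) G') (hn : 2 ≤ n) :
    IntSoSDerives f d (n ^ (a + 1)) (G + G') :=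
  (h.add h').mono le_rfl (pow_add_pow_le_pow_succ hn a)

lemma sum_pow {κ : Type*} [Fintype κ] {g : κ → MvPolynomial σ ℤ} (hκ : Fintype.card κ ≤ n)
    (h : ∀ i, IntSoSDerives f d (n ^ a) (g i)) : IntSoSDerives f d (n ^ (a + 1)) (∑ i, g i) :=
  (sum fun i _ => h i).mono le_rfl ((Nat.mul_le_mul_right _ hκ).trans (pow_succ' n a).ge)

lemma natCast_mul_pow (h : IntSoSDerives f d (n ^ a) G) {c : ℕ} (hc : c ≤ n ^ b) :
    IntSoSDerives f d (n ^ (b + a)) (c * G) :=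
  (h.natCast_mul c).mono le_rfl ((Nat.mul_le_mul_right _ hc).trans (pow_add n b a).ge)

lemma sumSq_mul_pow (h : IntSoSDerives f d (n ^ a) G) {q : MvPolynomial σ ℤ} {e : ℕ}
    (hq : IsRealSumSq q) (hqM : SizeLE q e (n ^ b)) :
    IntSoSDerives f (e + d) (n ^ (b + a)) (q * G) :=
  (h.sumSq_mul hq hqM).mono le_rfl (pow_add n b a).ge

end IntSoSDerives

namespace IdealDerives

lemma sum_pow {κ : Type*} [Fintype κ] {g : κ → MvPolynomial σ ℤ} (hκ : Fintype.card κ ≤ n)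
    (h : ∀ i, IdealDerives f d (n ^ a) (g i)) : IdealDerives f d (n ^ (a + 1)) (∑ i, g i) :=
  (sum fun i _ => h i).mono le_rfl ((Nat.mul_le_mul_right _ hκ).trans (pow_succ' n a).ge)

lemma mul_pow (h : IdealDerives f d (n ^ a) G) (hq : SizeLE q e (n ^ b)) :
    IdealDerives f (e + d) (n ^ (b + a)) (q * G) :=
  (h.mul hq).mono le_rfl (pow_add n b a).ge

lemma four_mul_intSoSDerives_pow (h : IdealDerives f e (n ^ a) G) (hn : 2 ≤ n)
    (hf : ∀ i, (f i).totalDegree ≤ D) :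
    IntSoSDerives (eqnSystem f) (2 * e + D) (n ^ (2 * (a + 1))) (4 * G) := by
  refine (h.four_mul_intSoSDerives hf).mono le_rfl ?_
  rw [mul_comm 2, pow_mul]
  gcongr
  exact (Nat.add_le_add_left (Nat.one_le_pow _ _ (by lia)) _).trans (pow_add_pow_le_pow_succ hn a)

end IdealDerives
end PowerSizes

section SumSquares

open scoped MatrixOrder in
lemma isSumSq_quadForm {σ κ : Type*} [Fintype κ] {A : Matrix κ κ ℝ}
    (hA : A.PosSemidef) (e : κ → σ) :
    IsSumSq (∑ j, ∑ l, C (A j l) * (X (e j) * X (e l)) : MvPolynomial σ ℝ) := by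
  classical
  obtain ⟨B, rfl⟩ := CStarAlgebra.nonneg_iff_eq_star_mul_self.mp hA.nonneg
  have h_factor : (∑ j, ∑ l, C ((star B * B) j l) * (X (e j) * X (e l)) : MvPolynomial σ ℝ)
      = ∑ i, (∑ j, C (B i j) * X (e j)) * (∑ j, C (B i j) * X (e j)) := by
    simp only [Matrix.mul_apply, Matrix.star_apply, star_trivial, map_sum, map_mul,
      Finset.sum_mul_sum]
    simp only [Finset.sum_mul]
    rw [Finset.sum_congr rfl fun j _ => Finset.sum_comm, Finset.sum_comm]
    exact Finset.sum_congr rfl fun i _ => Finset.sum_congr rfl fun j _ =>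
      Finset.sum_congr rfl fun l _ => by ring
  rw [h_factor]
  exact IsSumSq.sum_mul_self _ _

lemma posSemidef_smul_one_sub_mul_transpose {ι κ : Type*} [Fintype ι] [DecidableEq ι] [Fintype κ]
    (M : Matrix ι κ ℝ) {Λ : ℝ}
    (hΛ : ∀ x : ι → ℝ, ∑ v, (∑ u, M u v * x u) ^ 2 ≤ Λ * ∑ u, x u ^ 2) :
    (Λ • (1 : Matrix ι ι ℝ) - M * M.transpose).PosSemidef := by
  rw [Matrix.posSemidef_iff_dotProduct_mulVec]
  refine ⟨?_, fun x => ?_⟩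
  · simp [Matrix.IsHermitian, Matrix.conjTranspose_eq_transpose_of_trivial]
  · have h_vecMul : Matrix.vecMul x M = fun v => ∑ u, M u v * x u := by
      ext v; simp [Matrix.vecMul, dotProduct, mul_comm]
    rw [star_trivial, Matrix.sub_mulVec, dotProduct_sub, ← Matrix.mulVec_mulVec,
      Matrix.dotProduct_mulVec x M, Matrix.mulVec_transpose, h_vecMul, Matrix.smul_mulVec,
      Matrix.one_mulVec, dotProduct_smul, smul_eq_mul, sub_nonneg]
    simpa only [dotProduct, pow_two] using hΛ x

lemma isSumSq_spectral {σ ι κ : Type*} [Fintype ι] [Fintype κ] (e : ι → σ)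
    (M : Matrix ι κ ℝ) {Λ : ℝ}
    (hΛ : ∀ x : ι → ℝ, ∑ v, (∑ u, M u v * x u) ^ 2 ≤ Λ * ∑ u, x u ^ 2) :
    IsSumSq (C Λ * ∑ u, X (e u) ^ 2 - ∑ v, (∑ u, C (M u v) * X (e u)) ^ 2 : MvPolynomial σ ℝ) := by
  classical
  convert isSumSq_quadForm (posSemidef_smul_one_sub_mul_transpose M hΛ) e using 1
  simp only [Matrix.sub_apply, Matrix.smul_apply, Matrix.mul_apply, Matrix.transpose_apply,
    map_sub, sub_mul, Finset.sum_sub_distrib, map_sum, map_mul, smul_eq_mul]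
  congr 1
  · simp [Matrix.one_apply, Finset.mul_sum, pow_two, apply_ite C, ite_mul]
  · simp only [pow_two, Finset.sum_mul_sum]
    rw [Finset.sum_comm]
    refine Finset.sum_congr rfl fun j _ => ?_
    simp only [Finset.sum_mul]
    rw [Finset.sum_comm]
    exact Finset.sum_congr rfl fun l _ => Finset.sum_congr rfl fun v _ => by ring

lemma two_mul_lagrange {R ι : Type*} [CommRing R] [Fintype ι] (y f : ι → R) :
    2 * ((∑ v, y v ^ 2) * ∑ v, f v ^ 2 - (∑ v, y v * f v) ^ 2)
      = ∑ v, ∑ v', (y v * f v' - y v' * f v) ^ 2 := by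
  have h_expand (v v') : (y v * f v' - y v' * f v) ^ 2
      = y v ^ 2 * f v' ^ 2 + f v ^ 2 * y v' ^ 2 - 2 * ((y v * f v) * (y v' * f v')) := by
    ring
  simp_rw [h_expand, Finset.sum_sub_distrib, Finset.sum_add_distrib, ← Finset.mul_sum,
    ← Finset.sum_mul]
  ring

end SumSquares

/-! ### Certificates from spectral bounds -/

/-- The weight of a pair of vertices in the signed adjacency matrix: `w` for an edge, `-s` for a
non-edge. A random graph is centered by taking `w : s = 1 - p : p`. -/
def signedWeight (w s : ℕ) (b : Bool) : ℤ := if b then w else -s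

lemma natAbs_signedWeight_le (w s : ℕ) (b : Bool) : (signedWeight w s b).natAbs ≤ w + s := by
  cases b <;> simp [signedWeight]

/-- The pairing of the indicator `x` of the left part with the column of the right vertex `v` in the
signed adjacency matrix. -/
noncomputable def colForm {k m : ℕ} (H : BipGraph k m) (w s : ℕ) (v : Fin m) :
    BicliquePoly k m :=
  ∑ u, C (signedWeight w s (H (u, v))) * X (Sum.inl u)

section ColForm
variable {k m n w s : ℕ} {H : BipGraph k m}

lemma sizeLE_colForm (hk : k ≤ n) (hws : w + s ≤ n) (v : Fin m) :
    SizeLE (colForm H w s v) 1 (n ^ 2) :=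
  SizeLE.sum_pow (a := 1) (by simpa using hk) fun u =>
    (((SizeLE.intConst (d := 0) _).mono le_rfl ((natAbs_signedWeight_le w s _).trans hws)).mul
      (SizeLE.X _)).mono (by simp) (by simp)

lemma IdealDerives.X_mul_sub_colForm (hk : k ≤ n) (hws : w + s ≤ n) (v : Fin m) :
    IdealDerives (bicliqueEq ℤ H) 0 (n ^ 2)
      (X (Sum.inr v) * ((w : BicliquePoly k m) * sizeX ℤ k m - colForm H w s v)) := by
  have h_nonEdges :
      X (Sum.inr v) * ((w : BicliquePoly k m) * sizeX ℤ k m - colForm H w s v)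
        = ∑ u, C (w - signedWeight w s (H (u, v))) * (X (Sum.inl u) * X (Sum.inr v)) := by
    rw [sizeX, colForm, Finset.mul_sum, ← Finset.sum_sub_distrib, Finset.mul_sum]
    refine Finset.sum_congr rfl fun u _ => ?_
    simp only [C_sub, map_natCast]
    ring
  rw [h_nonEdges]
  refine IdealDerives.sum_pow (a := 1) (by simpa using hk) fun u => ?_
  by_cases h : H (u, v) = true
  · simpa [h, signedWeight] using IdealDerives.zero
  · have h_size : SizeLE (C (w - signedWeight w s (H (u, v))) : BicliquePoly k m) 0 n :=
      (SizeLE.intConst _).mono le_rfl (by simp [signedWeight, h]; lia)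
    let nonEdge : {e : Fin k × Fin m // H e = false} := ⟨(u, v), by simpa using h⟩
    have h_equation := (IdealDerives.equation (f := bicliqueEq ℤ H) (d := 0)
      (.inr (.inr (.inr nonEdge)))).mul h_size
    exact h_equation.mono le_rfl (by simp)

lemma isRealSumSq_spectral {Λ : ℕ} (hΛ : ∀ x : Fin k → ℝ,
      ∑ v, (∑ u, (signedWeight w s (H (u, v)) : ℝ) * x u) ^ 2 ≤ Λ * ∑ u, x u ^ 2) :
    IsRealSumSq ((Λ : BicliquePoly k m) * ∑ u : Fin k, X (Sum.inl u) ^ 2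
      - ∑ v, colForm H w s v ^ 2) := by
  simpa [IsRealSumSq, colForm] using isSumSq_spectral (Sum.inl : Fin k → Fin k ⊕ Fin m)
    (fun u v => (signedWeight w s (H (u, v)) : ℝ)) hΛ

lemma sizeLE_sum_X_sq {σ ι : Type*} [Fintype ι] (hι : Fintype.card ι ≤ n) (x : ι → σ) :
    SizeLE (∑ i, X (x i) ^ 2 : MvPolynomial σ ℤ) 2 (n ^ 1) :=
  SizeLE.sum_pow (a := 0) hι fun i => ((SizeLE.X (x i)).pow 2).mono le_rfl (by simp)

lemma IntSoSDerives.correlation_sq_le {Λ : ℕ} (hn : 2 ≤ n) (hk : k ≤ n) (hm : m ≤ n)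
    (hws : w + s ≤ n) (hΛn : Λ ≤ n ^ 6)
    (hΛ : ∀ x : Fin k → ℝ,
      ∑ v, (∑ u, (signedWeight w s (H (u, v)) : ℝ) * x u) ^ 2 ≤ Λ * ∑ u, x u ^ 2) :
    IntSoSDerives (bicliqueSystem ℤ H) 4 (n ^ 11)
      (2 * ((Λ : BicliquePoly k m) * (∑ u, X (Sum.inl u) ^ 2) * (∑ v, X (Sum.inr v) ^ 2)
        - (∑ v, X (Sum.inr v) * colForm H w s v) ^ 2)) := by
  set Sx : BicliquePoly k m := ∑ u : Fin k, X (Sum.inl u) ^ 2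
  set Sy : BicliquePoly k m := ∑ v : Fin m, X (Sum.inr v) ^ 2
  have h_col (v) : SizeLE (colForm H w s v) 1 (n ^ 2) := sizeLE_colForm hk hws v
  have h_lagrange : IntSoSDerives (bicliqueSystem ℤ H) 4 (n ^ 10)
      (∑ v, ∑ v', (X (Sum.inr v) * colForm H w s v' - X (Sum.inr v') * colForm H w s v) ^ 2) := by
    have h_term (v v') : SizeLE (X (Sum.inr v) * colForm H w s v') 2 (n ^ 2) :=
      ((SizeLE.X _).mul (h_col _)).mono le_rfl (one_mul _).le
    exact .mono_pow (.sum_pow (by simpa using hm) fun v => .sum_pow (by simpa using hm) fun v' =>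
      .of_sumSq (.sq _) (((h_term v v').sub_pow (h_term v' v) hn).pow_pow 2))
      (by lia) le_rfl (by lia)
  have h_spectral : IntSoSDerives (bicliqueSystem ℤ H) 4 (n ^ 10)
      (2 * (Sy * ((Λ : BicliquePoly k m) * Sx - ∑ v, colForm H w s v ^ 2))) := by
    have h_x : SizeLE ((Λ : BicliquePoly k m) * Sx) 2 (n ^ 7) :=
      ((SizeLE.natCast (d := 0) Λ).mono le_rfl hΛn).mul_pow (sizeLE_sum_X_sq (by simpa) _)
    have h_cols : SizeLE (∑ v, colForm H w s v ^ 2) 2 (n ^ 5) :=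
      .sum_pow (by simpa) fun v => (h_col v).pow_pow 2
    have h_size := h_x.sub_pow (h_cols.mono_pow (by lia) le_rfl (by lia)) hn
    exact natCast_mul_pow (b := 1) (c := 2) (.of_sumSq
      ((IsRealSumSq.sum fun v _ => .sq _).mul (isRealSumSq_spectral hΛ))
      ((sizeLE_sum_X_sq (by simpa) _).mul_pow h_size)) (by simpa)
  refine (h_lagrange.add_pow h_spectral hn).congr ?_
  rw [← two_mul_lagrange]
  ring

lemma IntSoSDerives.mul_le_sum_sq_mul (hn : 4 ≤ n) (hk : k ≤ n) (hm : m ≤ n) :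
    IntSoSDerives (bicliqueSystem ℤ H) 4 (n ^ 7)
      (4 * (sizeX ℤ k m * sizeY ℤ k m
        - (∑ u, X (Sum.inl u) ^ 2) * ∑ v, X (Sum.inr v) ^ 2)) := by
  have h_left : IdealDerives (bicliqueEq ℤ H) 0 (n ^ 1)
      (sizeX ℤ k m - ∑ u, X (Sum.inl u) ^ 2) := by
    refine (IdealDerives.sum_pow (a := 0) (g := fun u => -bicliqueEq ℤ H (.inl u)) (by simpa)
      fun u => ?_).congr (by simp [sizeX, bicliqueEq])
    simpa using (IdealDerives.equation _).neg
  have h_right (v : Fin m) : IntSoSDerives (bicliqueSystem ℤ H) 4 (n ^ 1)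
      ((∑ u, X (Sum.inl u) ^ 2) * bicliqueSystem ℤ H (.inr (.inl v), false)) :=
    .sumSq_mul_constraint (IsRealSumSq.sum fun u _ => .sq _) (sizeLE_sum_X_sq (by simpa) _) _
      (totalDegree_bicliqueSystem_le H _)
  have h_ideal : IntSoSDerives (bicliqueSystem ℤ H) 4 (n ^ 6)
      (4 * (sizeY ℤ k m * (sizeX ℤ k m - ∑ u, X (Sum.inl u) ^ 2))) := by
    have h_size : SizeLE (sizeY ℤ k m) 1 (n ^ 1) := sizeLE_sizeY.mono le_rfl (by simpa)
    rw [bicliqueSystem_eq_eqnSystem]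
    exact (h_left.mul_pow h_size).four_mul_intSoSDerives_pow (by lia)
      fun i => (sizeLE_bicliqueEq H i).1
  refine (h_ideal.add_pow (((IntSoSDerives.sum_pow (by simpa) h_right).natCast_mul_pow (b := 1)
    (c := 4) (by simpa)).mono_pow (b := 6) (by lia) le_rfl (by lia)) (by lia)).congr ?_
  have h_sum : ∑ v, bicliqueSystem ℤ H (.inr (.inl v), false)
      = sizeY ℤ k m - ∑ v, X (Sum.inr v) ^ 2 := by
    simp [bicliqueSystem, bicliqueEq, sizeY]
  rw [← Finset.mul_sum, h_sum]
  push_cast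
  ring

lemma IdealDerives.mul_sub_correlation (hk : k ≤ n) (hm : m ≤ n) (hws : w + s ≤ n) :
    IdealDerives (bicliqueEq ℤ H) 0 (n ^ 3)
      (w * sizeX ℤ k m * sizeY ℤ k m - ∑ v, X (Sum.inr v) * colForm H w s v) := by
  refine (IdealDerives.sum_pow (by simpa) fun v => X_mul_sub_colForm (H := H) hk hws v).congr ?_
  simp only [mul_sub, Finset.sum_sub_distrib, ← Finset.sum_mul]
  rw [sizeY]
  ring

lemma IntSoSDerives.four_mul_sub_correlation_sq {Λ : ℕ} (hn : 4 ≤ n) (hk : k ≤ n) (hm : m ≤ n)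
    (hws : w + s ≤ n) (hΛn : Λ ≤ n ^ 6) :
    IntSoSDerives (bicliqueSystem ℤ H) 4 (n ^ 15)
      (4 * ((Λ : BicliquePoly k m) - w * ∑ v, X (Sum.inr v) * colForm H w s v) ^ 2) := by
  have h_term (v) : SizeLE (X (Sum.inr v) * colForm H w s v) 2 (n ^ 2) :=
    ((SizeLE.X _).mul (sizeLE_colForm hk hws v)).mono le_rfl (one_mul _).le
  have h_w : SizeLE (w : BicliquePoly k m) 0 (n ^ 1) := (SizeLE.natCast w).mono le_rfl (by lia)
  have h_wz := (h_w.mul_pow (SizeLE.sum_pow (by simpa) h_term)).mono_pow (b := 6) (by lia)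
    (by lia : 0 + 2 ≤ 2) (by lia)
  have h_sub := ((SizeLE.natCast Λ).mono le_rfl hΛn).sub_pow h_wz (by lia)
  exact natCast_mul_pow (b := 1) (c := 4) (.of_sumSq (.sq _) (h_sub.pow_pow 2)) (by lia)

/-- With `z = ∑ y_v f_v` for the column forms `f_v`, Cauchy-Schwarz and the spectral bound give
`z² ≤ Λ|x||y|`, while `z = w|x||y|`; the square of `Λ - w z` combines the two. -/
theorem IntSoSDerives.of_spectral {Λ c : ℕ} (hn : 20 ≤ n) (hk : k ≤ n) (hm : m ≤ n)
    (hws : w + s ≤ n) (hΛn : Λ ≤ n ^ 6) (hcn : c ≤ n ^ 6) (hc : Λ ≤ c * w ^ 2)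
    (hΛ : ∀ x : Fin k → ℝ,
      ∑ v, (∑ u, (signedWeight w s (H (u, v)) : ℝ) * x u) ^ 2 ≤ Λ * ∑ u, x u ^ 2) :
    IntSoSDerives (bicliqueSystem ℤ H) 4 (n ^ 20)
      (((4 * Λ * w ^ 2 : ℕ) : BicliquePoly k m) * (c - sizeX ℤ k m ^ 1 * sizeY ℤ k m)) := by
  have hw : w ^ 2 ≤ n ^ 2 := Nat.pow_le_pow_left (by lia) 2
  have h_square := (four_mul_sub_correlation_sq (H := H) (by lia) hk hm hws hΛn).mono_pow (b := 16)
    (by lia) le_rfl (by lia)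
  have h_correlation := ((correlation_sq_le (by lia) hk hm hws hΛn hΛ).natCast_mul_pow
    (c := 2 * w ^ 2) (b := 3) ((Nat.mul_le_mul (by lia) hw).trans (pow_succ' n 2).ge)).mono_pow
    (b := 16) (by lia) le_rfl (by lia)
  have h_ideal := (IdealDerives.mul_sub_correlation (H := H) hk hm hws).neg
    |>.four_mul_intSoSDerives_pow (by lia) (fun i => (sizeLE_bicliqueEq H i).1)
    |>.natCast_mul_pow (c := 2 * Λ * w) (b := 8)
      (by rw [show n ^ 8 = n * n ^ 6 * n by ring]; gcongr <;> lia)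
  rw [← bicliqueSystem_eq_eqnSystem] at h_ideal
  have h_product := ((mul_le_sum_sq_mul (H := H) (by lia) hk hm).natCast_mul_pow
    (c := w ^ 2 * Λ) (b := 8) ((Nat.mul_le_mul hw hΛn).trans_eq (by ring))).mono_pow (b := 16)
    (by lia) le_rfl (by lia)
  have h_const : IntSoSDerives (bicliqueSystem ℤ H) 4 (n ^ 16)
      ((4 * Λ * (c * w ^ 2 - Λ) : ℕ) : BicliquePoly k m) := by
    refine .of_sumSq (.natCast _) ((SizeLE.natCast _).mono le_rfl ?_)
    calc 4 * Λ * (c * w ^ 2 - Λ) ≤ n * n ^ 6 * (n ^ 6 * n ^ 2) := by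
          gcongr
          · lia
          · exact (Nat.sub_le _ _).trans (by gcongr)
      _ ≤ n ^ 16 := by rw [← pow_succ', ← pow_add, ← pow_add]; gcongr <;> lia
  refine (((h_square.add_pow h_correlation (by lia)).add_pow
    ((h_ideal.mono_pow (b := 16) (by lia) (by lia) (by lia)).add_pow h_product (by lia))
      (by lia)).add_pow
    (h_const.mono_pow (b := 18) (by lia) le_rfl (by lia)) (by lia)).mono_pow (by lia) le_rfl
      (by lia) |>.congr ?_
  push_cast [Nat.cast_sub hc]
  ring

end ColForm

/-! ### Monomials indexed by tuples of left vertices -/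

section AllRepeated
variable {α : Type*} {j r : ℕ} {t : Fin j → α}

/-- Every value of the tuple is attained at least twice. In the expansion of a moment of a centered
random sum, these are the only tuples whose terms can have nonzero expectation. -/
def AllRepeated (t : Fin j → α) : Prop := ∀ i, ∃ i', i' ≠ i ∧ t i' = t i

lemma AllRepeated.two_mul_card_image_le [DecidableEq α] (ht : AllRepeated t) :
    2 * (Finset.univ.image t).card ≤ j := by
  have h_fiber (b) (hb : b ∈ Finset.univ.image t) :
      2 ≤ (Finset.univ.filter fun i => t i = b).card := by
    obtain ⟨i, -, rfl⟩ := Finset.mem_image.mp hb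
    obtain ⟨i', hne, he⟩ := ht i
    exact Finset.one_lt_card.mpr ⟨i', by simp [he], i, by simp, hne⟩
  calc 2 * (Finset.univ.image t).card = ∑ b ∈ Finset.univ.image t, 2 := by simp [mul_comm]
    _ ≤ ∑ b ∈ Finset.univ.image t, (Finset.univ.filter fun i => t i = b).card :=
      Finset.sum_le_sum h_fiber
    _ = j := by rw [← Finset.card_eq_sum_card_image, Finset.card_univ, Fintype.card_fin]

lemma exists_factor_of_card_image_le [DecidableEq α] (hj : 0 < j)
    (hr : (Finset.univ.image t).card ≤ r) :
    ∃ (g : Fin r → α) (π : Fin j → Fin r),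
      t = g ∘ π ∧ Finset.univ.image g = Finset.univ.image t := by
  set S := Finset.univ.image t
  have h_mem (i) : t i ∈ S := Finset.mem_image_of_mem _ (Finset.mem_univ i)
  have : Nonempty S := ⟨⟨t ⟨0, hj⟩, h_mem _⟩⟩
  obtain ⟨e⟩ : Nonempty (S ↪ Fin r) := Function.Embedding.nonempty_of_card_le (by simpa using hr)
  have h_inv : Function.LeftInverse (Function.invFun e) e := Function.leftInverse_invFun e.injective
  refine ⟨fun i => (Function.invFun e i : S), fun i => e ⟨t i, h_mem i⟩, ?_, ?_⟩
  · funext i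
    simp [h_inv _]
  · ext b
    rw [Finset.mem_image]
    constructor
    · rintro ⟨i, -, rfl⟩
      exact (Function.invFun e i).2
    · exact fun hb => ⟨e ⟨b, hb⟩, Finset.mem_univ _, by rw [h_inv]⟩

end AllRepeated

section LeftMon
variable {k m n : ℕ} {H : BipGraph k m}

lemma IdealDerives.four_mul_biclique {e L : ℕ} {G : BicliquePoly k m}
    (h : IdealDerives (bicliqueEq ℤ H) e L G) :
    IntSoSDerives (bicliqueSystem ℤ H) (2 * e + 2) ((L + 1) ^ 2) (4 * G) := by
  rw [bicliqueSystem_eq_eqnSystem]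
  exact h.four_mul_intSoSDerives fun i => (sizeLE_bicliqueEq H i).1

lemma IdealDerives.four_mul_biclique_pow {e a : ℕ} {G : BicliquePoly k m} (hn : 2 ≤ n)
    (h : IdealDerives (bicliqueEq ℤ H) e (n ^ a) G) :
    IntSoSDerives (bicliqueSystem ℤ H) (2 * e + 2) (n ^ (2 * (a + 1))) (4 * G) := by
  rw [bicliqueSystem_eq_eqnSystem]
  exact h.four_mul_intSoSDerives_pow hn fun i => (sizeLE_bicliqueEq H i).1

/-- The monomial `∏ x_{t i}` of a tuple `t` of left vertices. -/
noncomputable def leftMon {k : ℕ} (m : ℕ) {j : ℕ} (t : Fin j → Fin k) : BicliquePoly k m :=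
  ∏ i, X (Sum.inl (t i))

lemma sizeLE_leftMon {j : ℕ} (t : Fin j → Fin k) : SizeLE (leftMon m t) j 1 := by
  simpa [leftMon] using
    SizeLE.prod (s := Finset.univ) fun i _ => SizeLE.X (Sum.inl (t i) : Fin k ⊕ Fin m)

lemma sizeX_pow (r : ℕ) : sizeX ℤ k m ^ r = ∑ t : Fin r → Fin k, leftMon m t := by
  rw [sizeX, Fintype.sum_pow]; rfl

/-- Modulo `x_u² = x_u`, a monomial only depends on the set of its variables. -/
lemma IdealDerives.mul_prod_sub_prod_image {κ : Type*} (t : κ → Fin k)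
    {d e : ℕ} {q : BicliquePoly k m} (hq : SizeLE q d 1) (s : Finset κ) (hde : d + s.card ≤ e + 2) :
    IdealDerives (bicliqueEq ℤ H) e s.card
      (q * (∏ i ∈ s, X (Sum.inl (t i)) - ∏ u ∈ s.image t, X (Sum.inl u))) := by
  classical
  induction s using Finset.induction_on generalizing q d with
  | empty => simpa using IdealDerives.zero
  | insert a s ha ih =>
    rw [Finset.card_insert_of_notMem ha] at hde ⊢
    rw [Finset.image_insert, Finset.prod_insert ha]
    by_cases h_repeated : t a ∈ s.image t
    · obtain ⟨b, hb, hba⟩ := Finset.mem_image.mp h_repeated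
      have h_rest : SizeLE (∏ i ∈ s.erase b, X (Sum.inl (t i)) : BicliquePoly k m)
          (s.card - 1) 1 := by
        simpa [Finset.card_erase_of_mem hb] using SizeLE.prod (s := s.erase b)
          fun i _ => SizeLE.X (Sum.inl (t i) : Fin k ⊕ Fin m)
      have h_square := ((IdealDerives.equation (f := bicliqueEq ℤ H) (d := 0) (.inl (t a))).mul
        (hq.mul h_rest)).mono (e := e) (M := 1) (by have := Finset.card_pos.mpr ⟨b, hb⟩; lia) le_rfl
      refine ((ih hq (by lia)).add h_square).congr ?_
      rw [Finset.insert_eq_of_mem h_repeated, ← Finset.mul_prod_erase s _ hb, hba]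
      simp only [bicliqueEq]
      ring
    · refine ((ih (hq.mul (SizeLE.X (Sum.inl (t a)))) (by lia)).mono le_rfl
        (Nat.le_succ _)).congr ?_
      rw [Finset.prod_insert h_repeated]
      ring

lemma IdealDerives.leftMon_sub_leftMon {i j e : ℕ} {g : Fin j → Fin k} {t : Fin i → Fin k}
    (h : Finset.univ.image g = Finset.univ.image t) (hi : i ≤ e + 2) (hj : j ≤ e + 2) :
    IdealDerives (bicliqueEq ℤ H) e (j + i) (leftMon m g - leftMon m t) := by
  have h_reduce {l : ℕ} (t : Fin l → Fin k) (hl : l ≤ e + 2) :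
      IdealDerives (bicliqueEq ℤ H) e l
        (leftMon m t - ∏ u ∈ Finset.univ.image t, X (Sum.inl u)) := by
    simpa [leftMon] using IdealDerives.mul_prod_sub_prod_image (m := m) (H := H) t
      (SizeLE.one (d := 0)) Finset.univ (by simpa using hl)
  refine ((h_reduce g hj).add (h_reduce t hi).neg).congr ?_
  rw [h]
  ring

lemma IntSoSDerives.four_mul_leftMon {j : ℕ} (t : Fin j → Fin k) :
    IntSoSDerives (bicliqueSystem ℤ H) (2 * j) (4 * j + 4) (4 * leftMon m t) := by
  induction j with
  | zero =>
    simpa [leftMon] using (of_sumSq (.natCast 4) (.natCast 4) :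
      IntSoSDerives (bicliqueSystem ℤ H) 0 4 ((4 : ℕ) : BicliquePoly k m))
  | succ j ih =>
    set tail : BicliquePoly k m := leftMon m fun i => t i.succ
    have h_square := (ih fun i => t i.succ).sumSq_mul (IsRealSumSq.sq (X (Sum.inl (t 0))))
      ((SizeLE.X (Sum.inl (t 0) : Fin k ⊕ Fin m)).pow 2)
    have h_ideal := ((IdealDerives.equation (f := bicliqueEq ℤ H) (d := 0) (.inl (t 0))).mul
      (sizeLE_leftMon fun i => t i.succ)).neg.four_mul_biclique
    refine ((h_square.mono (e := 2 * (j + 1)) (by lia) le_rfl).add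
      (h_ideal.mono (by lia) le_rfl)).mono le_rfl (by norm_num; lia) |>.congr ?_
    rw [leftMon, Fin.prod_univ_succ]
    change 4 * (_ * tail) = _ * (4 * tail) + 4 * -(tail * _)
    simp only [bicliqueEq]
    ring

lemma IntSoSDerives.sum_tuple_pow {σ ι : Type*} [Fintype ι] {f : ι → MvPolynomial σ ℤ}
    {a d j : ℕ} (hk : k ≤ n) {g : (Fin j → Fin k) → MvPolynomial σ ℤ}
    (h : ∀ t, IntSoSDerives f d (n ^ a) (g t)) : IntSoSDerives f d (n ^ (j + a)) (∑ t, g t) := by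
  refine (sum fun t _ => h t).mono le_rfl ?_
  rw [Finset.card_univ, Fintype.card_fun, Fintype.card_fin, Fintype.card_fin, pow_add]
  gcongr

lemma IntSoSDerives.sum_mul_leftMon {b j : ℕ} (hn : 20 ≤ n) (hk : k ≤ n) (hj : j ≤ 2 * n)
    {c : (Fin j → Fin k) → ℕ} (hc : ∀ t, c t ≤ n ^ b) :
    IntSoSDerives (bicliqueSystem ℤ H) (2 * j) (n ^ (j + (b + 2)))
      (4 * ∑ t, c t * leftMon m t) := by
  have h_mon (t : Fin j → Fin k) :
      IntSoSDerives (bicliqueSystem ℤ H) (2 * j) (n ^ 2) (4 * leftMon m t) :=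
    (IntSoSDerives.four_mul_leftMon t).mono le_rfl (by nlinarith)
  refine (sum_tuple_pow hk fun t => (h_mon t).natCast_mul_pow (hc t)).congr ?_
  rw [Finset.mul_sum]
  exact Finset.sum_congr rfl fun t _ => by ring

lemma IntSoSDerives.mul_sizeX_pow_sub_sum_leftMon {κ : Type*} [Fintype κ] {b N r : ℕ} (hn : 20 ≤ n)
    (hk : k ≤ n) (hr : r ≤ 2 * n) (hNn : N ≤ n ^ b) (g : κ → Fin r → Fin k)
    (hN : ∀ t, (Finset.univ.filter fun a => g a = t).card ≤ N) :
    IntSoSDerives (bicliqueSystem ℤ H) (2 * r) (n ^ (r + (b + 2)))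
      (4 * ((N : BicliquePoly k m) * sizeX ℤ k m ^ r - ∑ a, leftMon m (g a))) := by
  set fiber : (Fin r → Fin k) → Finset κ := fun t => Finset.univ.filter fun a => g a = t
  have h_fibers : ∑ a, leftMon m (g a)
      = ∑ t, ((fiber t).card : BicliquePoly k m) * leftMon m t := by
    rw [← Finset.sum_fiberwise Finset.univ g]
    refine Finset.sum_congr rfl fun t _ => ?_
    rw [Finset.sum_congr rfl fun a ha => by rw [(Finset.mem_filter.mp ha).2]]
    simp [fiber]
  refine (sum_mul_leftMon (m := m) hn hk hr (c := fun t => N - (fiber t).card)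
    fun t => (Nat.sub_le _ _).trans hNn).congr ?_
  rw [h_fibers, sizeX_pow, Finset.mul_sum, ← Finset.sum_sub_distrib]
  congr 1
  exact Finset.sum_congr rfl fun t _ => by rw [Nat.cast_sub (hN t)]; ring

/-- A tuple of length `2r` all of whose values are repeated has the same variables as a tuple of
length `r`, and each tuple of length `r` arises at most `r^(2r)` times. -/
lemma IntSoSDerives.sum_allRepeated_le {r : ℕ} (hn : 20 ≤ n) (hk : k ≤ n) (hr : 1 ≤ r)
    (hrn : r ≤ n) [Fintype {t : Fin (2 * r) → Fin k // AllRepeated t}] :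
    IntSoSDerives (bicliqueSystem ℤ H) (4 * r) (n ^ (4 * r + 7))
      (4 * (((r ^ (2 * r) : ℕ) : BicliquePoly k m) * sizeX ℤ k m ^ r
        - ∑ t : {t : Fin (2 * r) → Fin k // AllRepeated t}, leftMon m t.1)) := by
  classical
  choose g π h_factor h_image using fun t : {t : Fin (2 * r) → Fin k // AllRepeated t} =>
    exists_factor_of_card_image_le (t := t.1) (r := r) (by lia : 0 < 2 * r)
      (by have := t.2.two_mul_card_image_le; lia)
  have h_fiber (h : Fin r → Fin k) :
      (Finset.univ.filter fun t => g t = h).card ≤ r ^ (2 * r) := by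
    have h_card : (Finset.univ : Finset (Fin (2 * r) → Fin r)).card = r ^ (2 * r) := by simp
    rw [← h_card]
    refine Finset.card_le_card_of_injOn π (fun _ _ => Finset.mem_coe.mpr (Finset.mem_univ _)) ?_
    intro t ht t' ht' hπ
    simp only [Finset.coe_filter, Finset.mem_univ, true_and, Set.mem_ofPred_eq] at ht ht'
    exact Subtype.ext (by rw [h_factor t, h_factor t', ht, ht', hπ])
  have h_short := mul_sizeX_pow_sub_sum_leftMon (m := m) (H := H) hn hk (by lia)
    (Nat.pow_le_pow_left hrn (2 * r)) g h_fiber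
  have h_reduce : IdealDerives (bicliqueEq ℤ H) (2 * r - 1) (n ^ (2 * r + 2))
      (∑ t, (leftMon m (g t) - leftMon m t.1)) := by
    refine (IdealDerives.sum fun t _ => IdealDerives.leftMon_sub_leftMon (h_image t) (by lia)
      (by lia)).mono le_rfl ?_
    have h_card : Fintype.card {t : Fin (2 * r) → Fin k // AllRepeated t} ≤ n ^ (2 * r) :=
      (Fintype.card_subtype_le _).trans (by simpa using Nat.pow_le_pow_left hk (2 * r))
    rw [Finset.card_univ, pow_add]
    gcongr
    nlinarith
  refine ((h_short.mono_pow (b := 4 * r + 6) (by lia) (by lia) (by lia)).add_pow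
    ((h_reduce.four_mul_biclique_pow (by lia)).mono_pow (b := 4 * r + 6) (by lia) (by lia) (by lia))
    (by lia)).congr ?_
  rw [Finset.sum_sub_distrib]
  ring

end LeftMon

/-! ### Certificates from tuple sums -/

section TupleSum
variable {k m n w s r : ℕ} {H : BipGraph k m}

/-- The coefficient of the tuple `t` of left vertices in the moment `∑ v, (colForm H w s v) ^ j`. -/
def tupleSum (H : BipGraph k m) (w s : ℕ) {j : ℕ} (t : Fin j → Fin k) : ℤ :=
  ∑ v, ∏ i, signedWeight w s (H (t i, v))

lemma sum_colForm_pow (j : ℕ) :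
    ∑ v, colForm H w s v ^ j = ∑ t : Fin j → Fin k, C (tupleSum H w s t) * leftMon m t := by
  simp only [colForm, Fintype.sum_pow, Finset.prod_mul_distrib]
  rw [Finset.sum_comm]
  refine Finset.sum_congr rfl fun t _ => ?_
  rw [tupleSum, map_sum, Finset.sum_mul]
  exact Finset.sum_congr rfl fun v _ => by rw [map_prod]; rfl

lemma abs_tupleSum_le {μ j : ℕ} (hμ : ∀ b, |signedWeight w s b| ≤ μ) (t : Fin j → Fin k) :
    |tupleSum H w s t| ≤ (m * μ ^ j : ℕ) := by
  have h_prod (v) : |∏ i, signedWeight w s (H (t i, v))| ≤ (μ : ℤ) ^ j := by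
    rw [Finset.abs_prod]
    simpa using Finset.prod_le_prod (s := Finset.univ)
      (fun i _ => abs_nonneg (signedWeight w s (H (t i, v)))) fun i _ => hμ (H (t i, v))
  calc |tupleSum H w s t| ≤ ∑ v, |∏ i, signedWeight w s (H (t i, v))| :=
        Finset.abs_sum_le_sum_abs _ _
    _ ≤ ∑ _v : Fin m, (μ : ℤ) ^ j := Finset.sum_le_sum fun v _ => h_prod v
    _ = _ := by simp

lemma IntSoSDerives.sum_colForm_pow_le_allRepeated {N Δ : ℕ} (hn : 20 ≤ n) (hk : k ≤ n)
    (hrn : r ≤ n) (hNn : N ≤ n ^ (2 * r + 1)) (hΔn : Δ ≤ n ^ (2 * r + 1))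
    [DecidablePred fun t : Fin (2 * r) → Fin k => AllRepeated t]
    (hN : ∀ t : Fin (2 * r) → Fin k, |tupleSum H w s t| ≤ N)
    (hΔ : ∀ t : Fin (2 * r) → Fin k, ¬ AllRepeated t → tupleSum H w s t ≤ Δ) :
    IntSoSDerives (bicliqueSystem ℤ H) (4 * r) (n ^ (4 * r + 4))
      (4 * (Δ * sizeX ℤ k m ^ (2 * r)
        + N * ∑ t : {t : Fin (2 * r) → Fin k // AllRepeated t}, leftMon m t.1
        - ∑ v, colForm H w s v ^ (2 * r))) := by
  set c : (Fin (2 * r) → Fin k) → ℤ :=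
    fun t => Δ + (if AllRepeated t then (N : ℤ) else 0) - tupleSum H w s t
  have hc_nonneg (t) : 0 ≤ c t := by
    simp only [c]
    split_ifs with h
    · have := (abs_le.mp (hN t)).2
      lia
    · have := hΔ t h
      lia
  have hc_le (t) : (c t).toNat ≤ n ^ (2 * r + 2) := by
    have h_lower := (abs_le.mp (hN t)).1
    have h_sum : c t ≤ (Δ + N + N : ℕ) := by
      simp only [c]
      split_ifs <;> push_cast <;> lia
    have h_pow : 3 * n ^ (2 * r + 1) ≤ n ^ (2 * r + 2) := by
      rw [pow_succ' n (2 * r + 1)]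
      gcongr
      lia
    lia
  refine ((sum_mul_leftMon (m := m) hn hk (by lia) hc_le).mono_pow (by lia) (by lia)
    (by lia)).congr ?_
  have h_cast (t) : (((c t).toNat : ℕ) : BicliquePoly k m) = C (c t) := by
    rw [← map_natCast C, Int.natCast_toNat_eq_self.mpr (hc_nonneg t)]
  have h_sub : ∑ t : {t : Fin (2 * r) → Fin k // AllRepeated t}, leftMon m t.1
      = ∑ t : Fin (2 * r) → Fin k, if AllRepeated t then leftMon m t else 0 := by
    rw [← Finset.sum_filter]
    exact (Finset.sum_subtype _ (by simp) _).symm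
  rw [sum_colForm_pow, sizeX_pow, h_sub, Finset.mul_sum, Finset.mul_sum,
    ← Finset.sum_add_distrib, ← Finset.sum_sub_distrib]
  congr 1
  refine Finset.sum_congr rfl fun t _ => ?_
  rw [h_cast]
  simp only [c, C_sub, C_add]
  split_ifs <;> simp <;> ring

lemma IntSoSDerives.sum_colForm_pow_le {N Δ : ℕ} (hn : 20 ≤ n) (hk : k ≤ n)
    (hr : 1 ≤ r) (hrn : r ≤ n) (hNn : N ≤ n ^ (2 * r + 1)) (hΔn : Δ ≤ n ^ (2 * r + 1))
    (hN : ∀ t : Fin (2 * r) → Fin k, |tupleSum H w s t| ≤ N)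
    (hΔ : ∀ t : Fin (2 * r) → Fin k, ¬ AllRepeated t → tupleSum H w s t ≤ Δ) :
    IntSoSDerives (bicliqueSystem ℤ H) (4 * r) (n ^ (6 * r + 9))
      (4 * (((N * r ^ (2 * r) : ℕ) : BicliquePoly k m) * sizeX ℤ k m ^ r
        + Δ * sizeX ℤ k m ^ (2 * r) - ∑ v, colForm H w s v ^ (2 * r))) := by
  classical
  have h_long := sum_colForm_pow_le_allRepeated hn hk hrn hNn hΔn hN hΔ
  have h_short := (sum_allRepeated_le (m := m) (H := H) hn hk hr hrn).natCast_mul_pow hNn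
  refine ((h_long.mono_pow (b := 6 * r + 8) (by lia) le_rfl (by lia)).add_pow
    (h_short.mono_pow (by lia) le_rfl (by lia)) (by lia)).congr ?_
  push_cast
  ring

lemma IdealDerives.X_mul_pow_sub_colForm_pow (hk : k ≤ n) (hws : w + s ≤ n) (hr : 1 ≤ r)
    (hrn : 2 * r ≤ n ^ 2) (v : Fin m) :
    IdealDerives (bicliqueEq ℤ H) (2 * r - 1) (n ^ (4 * r + 2))
      (X (Sum.inr v) *
        (((w : BicliquePoly k m) * sizeX ℤ k m) ^ (2 * r) - colForm H w s v ^ (2 * r))) := by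
  have h_x : SizeLE ((w : BicliquePoly k m) * sizeX ℤ k m) 1 (n ^ 2) :=
    ((SizeLE.natCast (d := 0) w).mul sizeLE_sizeX).mono (by simp)
      ((Nat.mul_le_mul (by lia : w ≤ n) hk).trans_eq (by ring))
  have h_col := sizeLE_colForm (H := H) hk hws v
  have h_geom : SizeLE (∑ i ∈ Finset.range (2 * r),
      ((w : BicliquePoly k m) * sizeX ℤ k m) ^ i * colForm H w s v ^ (2 * r - 1 - i))
      (2 * r - 1) (n ^ (4 * r)) := by
    refine (SizeLE.sum (L := n ^ (4 * r - 2)) fun i hi => ?_).mono le_rfl ?_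
    · have hi' := Finset.mem_range.mp hi
      refine ((h_x.pow_pow i).mul_pow (h_col.pow_pow (2 * r - 1 - i))).mono (by lia) ?_
      rw [show 2 * i + 2 * (2 * r - 1 - i) = 4 * r - 2 by lia]
    · rw [Finset.card_range]
      exact (Nat.mul_le_mul_right _ hrn).trans_eq (by rw [← pow_add]; congr 1; lia)
  refine ((X_mul_sub_colForm (H := H) hk hws v).mul_pow h_geom).congr ?_
  rw [← geom_sum₂_mul]
  ring

lemma IntSoSDerives.X_mul_pow_le_colForm_pow (hn : 20 ≤ n) (hk : k ≤ n) (hws : w + s ≤ n)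
    (hr : 1 ≤ r) (hrn : r ≤ n) (v : Fin m) :
    IntSoSDerives (bicliqueSystem ℤ H) (4 * r) (n ^ (8 * r + 7))
      (4 * (colForm H w s v ^ (2 * r)
        - X (Sum.inr v) * ((w : BicliquePoly k m) * sizeX ℤ k m) ^ (2 * r))) := by
  set f := colForm H w s v
  have h_size : SizeLE (f ^ (2 * r)) (2 * r) (n ^ (4 * r)) :=
    ((sizeLE_colForm hk hws v).pow_pow (2 * r)).mono (by lia)
      (le_of_eq (by ring))
  have h_sumSq : IsRealSumSq (f ^ (2 * r)) := by
    rw [mul_comm 2 r, pow_mul]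
    exact .sq _
  have h_compl : IntSoSDerives (bicliqueSystem ℤ H) (4 * r) (n ^ (4 * r + 1))
      (f ^ (2 * r) * (1 - X (Sum.inr v)) ^ 2) :=
    (of_sumSq (h_sumSq.mul (.sq _)) (h_size.mul ((SizeLE.one.sub (SizeLE.X _)).pow 2))).mono
      (by lia) (by rw [pow_succ]; exact Nat.mul_le_mul_left _ (by lia))
  have h_idempotent : IntSoSDerives (bicliqueSystem ℤ H) (4 * r) (n ^ (4 * r + 1))
      (f ^ (2 * r) * bicliqueSystem ℤ H (.inr (.inl v), false)) :=
    (IntSoSDerives.sumSq_mul_constraint h_sumSq h_size _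
      (totalDegree_bicliqueSystem_le H _)).mono_pow (by lia) (by lia) (by lia)
  have h_ideal := (IdealDerives.X_mul_pow_sub_colForm_pow (H := H) hk hws hr (by nlinarith)
    v).neg.four_mul_biclique_pow (by lia)
  refine ((((h_compl.add_pow h_idempotent (by lia)).natCast_mul_pow (c := 4) (b := 1)
    (by lia)).mono_pow (b := 8 * r + 6) (by lia) le_rfl (by lia)).add_pow
    (h_ideal.mono_pow (by lia) (by lia) (by lia)) (by lia)).congr ?_
  simp only [bicliqueSystem, bicliqueEq]
  push_cast
  ring

/-- The polynomial `D |x|^r + Δ |x|^(2r) - w^(2r) |x|^(2r) |y|`: the moment bound obtained by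
averaging `(w |x|)^(2r) = (colForm H w s v)^(2r)` over the right vertices `v` of a biclique. -/
noncomputable def gapPoly (k m w r D Δ : ℕ) : BicliquePoly k m :=
  D * sizeX ℤ k m ^ r + Δ * sizeX ℤ k m ^ (2 * r)
    - (w : BicliquePoly k m) ^ (2 * r) * sizeX ℤ k m ^ (2 * r) * sizeY ℤ k m

lemma IntSoSDerives.four_mul_gapPoly {N Δ : ℕ} (hn : 20 ≤ n) (hk : k ≤ n) (hm : m ≤ n)
    (hws : w + s ≤ n) (hr : 1 ≤ r) (hrn : r ≤ n)
    (hNn : N ≤ n ^ (2 * r + 1)) (hΔn : Δ ≤ n ^ (2 * r + 1))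
    (hN : ∀ t : Fin (2 * r) → Fin k, |tupleSum H w s t| ≤ N)
    (hΔ : ∀ t : Fin (2 * r) → Fin k, ¬ AllRepeated t → tupleSum H w s t ≤ Δ) :
    IntSoSDerives (bicliqueSystem ℤ H) (4 * r) (n ^ (8 * r + 9))
      (4 * gapPoly k m w r (N * r ^ (2 * r)) Δ) := by
  have h_moment := sum_colForm_pow_le hn hk hr hrn hNn hΔn hN hΔ
  have h_columns := IntSoSDerives.sum_pow (by simpa using hm) fun v : Fin m =>
    X_mul_pow_le_colForm_pow (H := H) hn hk hws hr hrn v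
  refine ((h_moment.mono_pow (b := 8 * r + 8) (by lia) le_rfl (by lia)).add_pow h_columns
    (by lia)).congr ?_
  rw [← Finset.mul_sum, Finset.sum_sub_distrib, ← Finset.sum_mul, gapPoly, ← sizeY]
  ring

lemma IntSoSDerives.X_sq_mul_one_sub (u v : Fin k ⊕ Fin m) (i : BicliqueIdx H)
    (hi : bicliqueEq ℤ H i = X u ^ 2 - X u) :
    IntSoSDerives (bicliqueSystem ℤ H) 4 5 (X v ^ 2 * (1 - X u)) := by
  have h_v : SizeLE (X v ^ 2 : BicliquePoly k m) 2 1 :=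
    ((SizeLE.X v).pow 2).mono (by simp) (by simp)
  have h_compl := of_sumSq (f := bicliqueSystem ℤ H) ((IsRealSumSq.sq (X v)).mul (.sq (1 - X u)))
    (h_v.mul ((SizeLE.one.sub (SizeLE.X u)).pow 2))
  have h_idempotent := sumSq_mul_constraint (IsRealSumSq.sq (X v)) h_v (i, false)
    (totalDegree_bicliqueSystem_le H _)
  refine ((h_compl.add h_idempotent).mono (by simp) (by simp)).congr ?_
  simp only [bicliqueSystem, hi]
  ring

/-- A right vertex of the biclique with at most `k - δ` neighbours forces `|y| ≥ δ`. -/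
lemma IntSoSDerives.sq_mul_sizeY_sub {δ : ℕ} (hn : 20 ≤ n) (hk : k ≤ n) (v : Fin m)
    (hv : (Finset.univ.filter fun u => H (u, v) = true).card + δ ≤ k) :
    IntSoSDerives (bicliqueSystem ℤ H) 4 (n ^ 4)
      (4 * (X (Sum.inr v) ^ 2 * (sizeY ℤ k m - (δ : BicliquePoly k m)))) := by
  set y : BicliquePoly k m := X (Sum.inr v)
  set d := (Finset.univ.filter fun u => H (u, v) = true).card with hd
  have h_y : SizeLE (y ^ 2) 2 1 := ((SizeLE.X _).pow 2).mono (by simp) (by simp)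
  have h_total := (sumSq_mul_constraint (IsRealSumSq.sq y) h_y (.inr (.inr (.inl ())), true)
    (totalDegree_bicliqueSystem_le H _)).natCast_mul 4
  have h_const : IntSoSDerives (bicliqueSystem ℤ H) 4 n
      (((k - δ - d : ℕ) : BicliquePoly k m) * y ^ 2) :=
    of_sumSq ((IsRealSumSq.natCast _).mul (.sq _))
      (((SizeLE.natCast (d := 0) _).mul h_y).mono (by simp) (by lia))
  have h_left (u) : IntSoSDerives (bicliqueSystem ℤ H) 4 20
      (4 * ((if H (u, v) = true then y ^ 2 else 0) - y ^ 2 * X (Sum.inl u))) := by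
    split_ifs with h
    · refine ((X_sq_mul_one_sub (Sum.inl u) (Sum.inr v) (.inl u) rfl).natCast_mul 4).congr ?_
      push_cast
      ring
    · have h_nonEdge := ((IdealDerives.equation (f := bicliqueEq ℤ H) (d := 0)
        (.inr (.inr (.inr ⟨(u, v), by simpa using h⟩)))).mul (SizeLE.X (Sum.inr v))).neg
      refine (h_nonEdge.four_mul_biclique.mono (by simp) (by simp)).congr ?_
      simp only [bicliqueEq]
      ring
  have h_lefts := sum (s := Finset.univ) fun u _ => h_left u
  refine (((h_total.add (h_const.natCast_mul 4)).add h_lefts).mono le_rfl ?_).congr ?_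
  · rw [Finset.card_univ, Fintype.card_fin]
    nlinarith [Nat.mul_le_mul hn hn, Nat.pow_le_pow_left hn 3, pow_succ n 3]
  · rw [← Finset.mul_sum, Finset.sum_sub_distrib, ← Finset.mul_sum, ← Finset.sum_filter,
      Finset.sum_const, ← hd, ← sizeX, Nat.cast_sub (by lia), Nat.cast_sub (by lia)]
    simp only [bicliqueSystem, bicliqueEq, nsmul_eq_mul, map_natCast]
    push_cast
    ring

end TupleSum

section QuarticBound
variable {k m n w s r M D Δ δ : ℕ} {H : BipGraph k m}

lemma sizeLE_sizeX_pow (hk : k ≤ n) (e : ℕ) : SizeLE (sizeX ℤ k m ^ e) e (n ^ e) :=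
  ((sizeLE_sizeX.mono le_rfl hk).pow e).mono (by simp) le_rfl

lemma sizeLE_natCast {c a e : ℕ} (hc : c ≤ n ^ a) :
    SizeLE (c : BicliquePoly k m) e (n ^ a) :=
  (SizeLE.natCast c).mono le_rfl hc

lemma sizeLE_X_sq (z : Fin k ⊕ Fin m) : SizeLE (X z ^ 2 : BicliquePoly k m) 2 (n ^ 0) :=
  ((SizeLE.X z).pow 2).mono (by simp) (by simp)

/-- The constraint `|y| ≥ δ` turns the gap polynomial into one in `|x|` alone. -/
lemma IntSoSDerives.sq_mul_natCast_mul_sub (hn : 20 ≤ n) (hk : k ≤ n) (hw : w ≤ n) (hr : 1 ≤ r)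
    (hgap : IntSoSDerives (bicliqueSystem ℤ H) (4 * r) (n ^ (8 * r + 9)) (4 * gapPoly k m w r D Δ))
    (hM : M + Δ = w ^ (2 * r) * δ) (v : Fin m)
    (hv : (Finset.univ.filter fun u => H (u, v) = true).card + δ ≤ k) :
    IntSoSDerives (bicliqueSystem ℤ H) (4 * r + 2) (n ^ (8 * r + 10))
      (4 * (X (Sum.inr v) ^ 2 * ((D : BicliquePoly k m) * sizeX ℤ k m ^ r
        - (M : BicliquePoly k m) * (sizeX ℤ k m ^ r) ^ 2))) := by
  have h_gap := hgap.sumSq_mul_pow (.sq (X (Sum.inr v))) (sizeLE_X_sq _)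
  have h_right := ((sq_mul_sizeY_sub hn hk v hv).sumSq_mul_pow (.sq (sizeX ℤ k m ^ r))
    ((sizeLE_sizeX_pow hk r).pow_pow 2)).natCast_mul_pow (c := w ^ (2 * r)) (b := 2 * r)
    (Nat.pow_le_pow_left hw _)
  have hM' : (M : BicliquePoly k m) = (w : BicliquePoly k m) ^ (2 * r) * δ - Δ := by
    rw [eq_sub_iff_add_eq]
    exact_mod_cast congrArg (Nat.cast : ℕ → BicliquePoly k m) hM
  refine ((h_gap.mono_pow (b := 8 * r + 9) (by lia) (by lia) (by lia)).add_pow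
    (h_right.mono_pow (by lia) (by lia) (by lia)) (by lia)).congr ?_
  rw [gapPoly, hM']
  push_cast
  ring

/-- `D⁴ - M⁴z⁴ = E (D - Mz)² + 2M E (Dz - Mz²)` with `E = D² + M²z²`. -/
lemma IntSoSDerives.sq_mul_pow_four_sub (hn : 20 ≤ n) (hk : k ≤ n)
    (hD : D ≤ n ^ (4 * r + 1)) (hM : M ≤ n ^ (2 * r + 1)) (v : Fin m)
    (h : IntSoSDerives (bicliqueSystem ℤ H) (4 * r + 2) (n ^ (8 * r + 10))
      (4 * (X (Sum.inr v) ^ 2 * ((D : BicliquePoly k m) * sizeX ℤ k m ^ r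
        - (M : BicliquePoly k m) * (sizeX ℤ k m ^ r) ^ 2)))) :
    IntSoSDerives (bicliqueSystem ℤ H) (6 * r + 2) (n ^ (18 * r + 16))
      (4 * (X (Sum.inr v) ^ 2 * ((D : BicliquePoly k m) ^ 4
        - (M : BicliquePoly k m) ^ 4 * (sizeX ℤ k m ^ r) ^ 4))) := by
  set z := sizeX ℤ k m ^ r
  have h_z : SizeLE z r (n ^ r) := sizeLE_sizeX_pow hk r
  have h_D := sizeLE_natCast (k := k) (m := m) (e := 0) hD
  have h_M := sizeLE_natCast (k := k) (m := m) (e := 0) hM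
  have h_E : SizeLE ((D : BicliquePoly k m) ^ 2 + ((M : BicliquePoly k m) * z) ^ 2)
      (2 * r) (n ^ (8 * r + 3)) :=
    ((h_D.pow_pow 2).mono_pow (b := 8 * r + 2) (e := 2 * r) (by lia) (by lia) (by lia)).add_pow
      (((h_M.mul_pow h_z).pow_pow 2).mono_pow (by lia) (by lia) (by lia)) (by lia)
  have h_F : SizeLE (((D : BicliquePoly k m) - (M : BicliquePoly k m) * z) ^ 2)
      (2 * r) (n ^ (8 * r + 4)) :=
    (((h_D.mono_pow (b := 4 * r + 1) (e := r) (by lia) (by lia) (by lia)).sub_pow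
      ((h_M.mul_pow h_z).mono_pow (by lia) (by lia) (by lia)) (by lia)).pow_pow 2).mono_pow
      (by lia) (by lia) (by lia)
  have h_sumSq : IsRealSumSq ((D : BicliquePoly k m) ^ 2 + ((M : BicliquePoly k m) * z) ^ 2) :=
    (IsRealSumSq.sq _).add (.sq _)
  have h_square : IntSoSDerives (bicliqueSystem ℤ H) (2 + (2 * r + 2 * r))
      (n ^ (0 + (8 * r + 3 + (8 * r + 4)))) _ :=
    of_sumSq ((IsRealSumSq.sq (X (Sum.inr v))).mul
      (h_sumSq.mul (.sq ((D : BicliquePoly k m) - (M : BicliquePoly k m) * z))))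
      ((sizeLE_X_sq _).mul_pow (h_E.mul_pow h_F))
  have h_cross := (h.sumSq_mul_pow h_sumSq h_E).natCast_mul_pow (c := 2 * M) (b := 2 * r + 2)
    (by rw [pow_succ' n (2 * r + 1)]; gcongr; lia)
  refine (((h_square.natCast_mul_pow (c := 4) (b := 1) (by lia)).mono_pow (b := 18 * r + 15)
    (by lia) (by lia) (by lia)).add_pow (h_cross.mono_pow (by lia) (by lia) (by lia))
    (by lia)).congr ?_
  push_cast
  ring

lemma IntSoSDerives.pow_four_mul_one_sub_sq (hn : 20 ≤ n) (hD : D ≤ n ^ (4 * r + 1)) (v : Fin m) :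
    IntSoSDerives (bicliqueSystem ℤ H) 2 (n ^ (16 * r + 6))
      (4 * ((D : BicliquePoly k m) ^ 4 * (1 - X (Sum.inr v) ^ 2))) := by
  have h_compl := of_sumSq (f := bicliqueSystem ℤ H) (IsRealSumSq.sq (1 - X (Sum.inr v)))
    ((SizeLE.one.sub (SizeLE.X (Sum.inr v))).pow 2)
  have h_idempotent := (sumSq_mul_constraint IsRealSumSq.one (SizeLE.one (d := 0))
    (.inr (.inl v), false) (totalDegree_bicliqueSystem_le H _)).natCast_mul 2
  have h_sum := (h_compl.add (h_idempotent.mono (by simp) le_rfl)).mono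
    (e := 2) (M := n ^ 1) (by simp) (by simp; lia)
  refine (((h_sum.sumSq_mul_pow (.sq ((D : BicliquePoly k m) ^ 2))
    (((sizeLE_natCast (e := 0) hD).pow_pow 2).pow_pow 2)).natCast_mul_pow (c := 4) (b := 1)
    (by lia)).mono_pow (by lia) (by simp) (by lia)).congr ?_
  simp only [bicliqueSystem, bicliqueEq]
  push_cast
  ring

lemma IntSoSDerives.pow_four_mul_sq_sub (hn : 20 ≤ n) (hk : k ≤ n) (hM : M ≤ n ^ (2 * r + 1))
    (v : Fin m) :
    IntSoSDerives (bicliqueSystem ℤ H) (4 * r + 2) (n ^ (12 * r + 5))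
      (4 * ((M : BicliquePoly k m) ^ 4 * (sizeX ℤ k m ^ r) ^ 4
        * (X (Sum.inr v) ^ 2 - X (Sum.inr v)))) := by
  have h_size := (((sizeLE_natCast (k := k) (m := m) (e := 0) hM).mul_pow
    (sizeLE_sizeX_pow hk r)).pow_pow 2).pow_pow 2
  have h_idempotent := sumSq_mul_constraint (.sq _) h_size
    (.inr (.inl v), true) (totalDegree_bicliqueSystem_le H _)
  refine ((h_idempotent.natCast_mul_pow (c := 4) (b := 1) (by lia)).mono_pow (by lia) (by lia)
    (by lia)).congr ?_
  simp only [bicliqueSystem, bicliqueEq]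
  push_cast
  ring

lemma IntSoSDerives.natCast_sub_mul_X (hn : 20 ≤ n) (hk : k ≤ n)
    (hD : D ≤ n ^ (4 * r + 1)) (hM : M ≤ n ^ (2 * r + 1)) (v : Fin m)
    (h : IntSoSDerives (bicliqueSystem ℤ H) (4 * r + 2) (n ^ (8 * r + 10))
      (4 * (X (Sum.inr v) ^ 2 * ((D : BicliquePoly k m) * sizeX ℤ k m ^ r
        - (M : BicliquePoly k m) * (sizeX ℤ k m ^ r) ^ 2)))) :
    IntSoSDerives (bicliqueSystem ℤ H) (6 * r + 2) (n ^ (18 * r + 18))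
      (4 * ((D : BicliquePoly k m) ^ 4
        - (M : BicliquePoly k m) ^ 4 * (sizeX ℤ k m ^ r) ^ 4 * X (Sum.inr v))) := by
  have h_bound := sq_mul_pow_four_sub hn hk hD hM v h
  have h_left := pow_four_mul_one_sub_sq (H := H) hn hD v
  have h_right := pow_four_mul_sq_sub (H := H) hn hk hM v
  refine ((h_bound.add_pow (h_left.mono_pow (by lia) (by lia) (by lia)) (by lia)).add_pow
    (h_right.mono_pow (by lia) (by lia) (by lia)) (by lia)).congr ?_
  ring

theorem IntSoSDerives.of_tupleSum {μ c : ℕ} (hn : 20 ≤ n) (hk : k ≤ n) (hm : m ≤ n)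
    (hws : w + s ≤ n) (hμn : μ ≤ n) (hΔn : Δ ≤ n ^ (2 * r + 1)) (hr : 1 ≤ r) (hrn : r ≤ n)
    (hμ : ∀ b, |signedWeight w s b| ≤ μ)
    (hΔ : ∀ t : Fin (2 * r) → Fin k, ¬ AllRepeated t → tupleSum H w s t ≤ Δ)
    (hδ : ∀ v, (Finset.univ.filter fun u => H (u, v) = true).card + δ ≤ k)
    (hδn : δ ≤ n) (hM : M + Δ = w ^ (2 * r) * δ) (hcn : c ≤ n ^ (40 * r))
    (hc : m * (m * μ ^ (2 * r) * r ^ (2 * r)) ^ 4 ≤ c * M ^ 4) :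
    IntSoSDerives (bicliqueSystem ℤ H) (6 * r + 2) (n ^ (60 * r))
      (((4 * M ^ 4 : ℕ) : BicliquePoly k m) * (c - sizeX ℤ k m ^ (4 * r) * sizeY ℤ k m)) := by
  set D := m * μ ^ (2 * r) * r ^ (2 * r)
  have h_N : m * μ ^ (2 * r) ≤ n ^ (2 * r + 1) :=
    (Nat.mul_le_mul hm (Nat.pow_le_pow_left hμn _)).trans (pow_succ' n _).ge
  have h_D : D ≤ n ^ (4 * r + 1) :=
    (Nat.mul_le_mul h_N (Nat.pow_le_pow_left hrn _)).trans_eq (by ring)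
  have h_M : M ≤ n ^ (2 * r + 1) :=
    (by lia : M ≤ w ^ (2 * r) * δ).trans
      ((Nat.mul_le_mul (Nat.pow_le_pow_left (by lia) _) hδn).trans (pow_succ n _).ge)
  have h_gap := four_mul_gapPoly hn hk hm hws hr hrn h_N hΔn (abs_tupleSum_le hμ) hΔ
  have h_vertices := IntSoSDerives.sum_pow (by simpa using hm) fun v : Fin m =>
    natCast_sub_mul_X hn hk h_D h_M v
      (sq_mul_natCast_mul_sub hn hk (by lia) hr h_gap hM v (hδ v))
  have h_const : IntSoSDerives (bicliqueSystem ℤ H) (6 * r + 2) (n ^ (48 * r + 5))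
      ((4 * (c * M ^ 4 - m * D ^ 4) : ℕ) : BicliquePoly k m) := by
    refine .of_sumSq (.natCast _) (sizeLE_natCast ?_)
    calc 4 * (c * M ^ 4 - m * D ^ 4) ≤ n * (n ^ (40 * r) * (n ^ (2 * r + 1)) ^ 4) := by
          refine Nat.mul_le_mul (by lia) ((Nat.sub_le _ _).trans ?_)
          gcongr
      _ = n ^ (48 * r + 5) := by ring
  refine (((h_vertices.mono_pow (b := 48 * r + 5) (by lia) le_rfl (by lia)).add_pow h_const
    (by lia)).mono_pow (by lia) le_rfl (by lia)).congr ?_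
  rw [← Finset.mul_sum, Finset.sum_sub_distrib, ← Finset.mul_sum, Finset.sum_const,
    Finset.card_univ, Fintype.card_fin, nsmul_eq_mul, ← sizeY, pow_mul', Nat.cast_mul,
    Nat.cast_mul 4 (c * M ^ 4 - _), Nat.cast_sub hc]
  push_cast
  ring

end QuarticBound

/-! ### Concentration in the random graph -/

section Bernoulli
variable {ι : Type*} [Fintype ι] {p : unitInterval}

/-- The law of a family of independent Bernoulli variables; `randomBip k m p` is the case
`ι = Fin k × Fin m`. -/
noncomputable abbrev bernoulliProd (ι : Type*) [Fintype ι] (p : unitInterval) :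
    Measure (ι → Bool) :=
  Measure.pi fun _ => bernoulliMeasure true false p

instance (k m : ℕ) (p : unitInterval) : IsProbabilityMeasure (randomBip k m p) :=
  inferInstanceAs (IsProbabilityMeasure (bernoulliProd _ p))

lemma integral_bernoulliProd_prod (g : ι → Bool → ℝ) :
    ∫ c, ∏ i, g i (c i) ∂bernoulliProd ι p = ∏ i, (p * g i true + (1 - p) * g i false) := by
  rw [integral_fintype_prod_eq_prod g]
  simp only [integral_bernoulliMeasure, smul_eq_mul]

lemma measurePreserving_columns (k m : ℕ) (p : unitInterval) :
    MeasurePreserving (fun H v u => H (u, v)) (randomBip k m p)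
      (Measure.pi fun _ : Fin m => bernoulliProd (Fin k) p) where
  measurable := by fun_prop
  map_eq := by
    have h_curry := Measure.infinitePi_map_curry
      (fun (_ : Fin m) (_ : Fin k) => bernoulliMeasure true false p)
    have h_swap := (measurePreserving_piCongrLeft
      (fun _ : Fin m × Fin k => bernoulliMeasure true false p)
      (Equiv.prodComm (Fin k) (Fin m))).map_eq
    simp only [Measure.infinitePi_eq_pi] at h_curry
    rw [← h_curry, ← h_swap, Measure.map_map (by fun_prop) (by fun_prop)]
    rfl

lemma measurePreserving_column {k m : ℕ} (v : Fin m) :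
    MeasurePreserving (fun H u => H (u, v)) (randomBip k m p) (bernoulliProd (Fin k) p) :=
  (measurePreserving_eval _ v).comp (measurePreserving_columns k m p)

lemma measureReal_pi_sum_ge_le {Ω : Type*} [MeasurableSpace Ω] {ν : Measure Ω}
    [IsProbabilityMeasure ν] {Z : Ω → ℝ} (hZ : AEMeasurable Z ν) {c ε : ℝ}
    (hc : ∀ ω, |Z ω| ≤ c) (hε : 0 ≤ ε) {n : ℕ} (hn : Fintype.card ι ≤ n) :
    (Measure.pi fun _ : ι => ν).real {ω | ε ≤ ∑ i, (Z (ω i) - ∫ x, Z x ∂ν)}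
      ≤ Real.exp (-ε ^ 2 / (2 * (n * c ^ 2))) := by
  let X : Ω → ℝ := fun x => Z x - ∫ y, Z y ∂ν
  have hX : HasSubgaussianMGF X ((‖c - -c‖₊ / 2) ^ 2) ν :=
    hasSubgaussianMGF_of_mem_Icc hZ (ae_of_all ν fun ω => abs_le.mp (hc ω))
  have h_eval (i : ι) : HasSubgaussianMGF (fun ω => X (ω i)) ((‖c - -c‖₊ / 2) ^ 2)
      (Measure.pi fun _ : ι => ν) := by
    refine HasSubgaussianMGF.of_map (X := X) (Y := fun ω : ι → Ω => ω i)
      (measurable_pi_apply i).aemeasurable ?_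
    exact (measurePreserving_eval (fun _ : ι => ν) i).map_eq.symm ▸ hX
  have h_sum := HasSubgaussianMGF.sum_of_iIndepFun (s := Finset.univ)
    (iIndepFun_pi (μ := fun _ : ι => ν) (X := fun _ => X) fun _ => hX.aemeasurable)
    fun i _ => h_eval i
  have h_param : ∑ _i : ι, (‖c - -c‖₊ / 2) ^ 2 ≤ n * ‖c‖₊ ^ 2 := by
    have h_norm : ‖c - -c‖₊ / 2 = ‖c‖₊ := by
      rw [sub_neg_eq_add, ← two_mul, nnnorm_mul, Real.nnnorm_two]
      exact mul_div_cancel_left₀ _ two_ne_zero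
    rw [h_norm, Finset.sum_const, nsmul_eq_mul, Finset.card_univ]
    gcongr
  have h_weak : HasSubgaussianMGF (fun ω : ι → Ω => ∑ i, X (ω i)) (n * ‖c‖₊ ^ 2)
      (Measure.pi fun _ : ι => ν) := by
    refine ⟨h_sum.integrable_exp_mul, fun t => (h_sum.mgf_le t).trans ?_⟩
    gcongr
  simpa only [NNReal.coe_mul, NNReal.coe_natCast, NNReal.coe_pow, coe_nnnorm, Real.norm_eq_abs,
    sq_abs] using h_weak.measure_ge_le hε

end Bernoulli

section TupleSumMoments
variable {k m n s w j : ℕ} {p : unitInterval}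

lemma abs_signedWeight_le (b : Bool) : |signedWeight w s b| ≤ (max w s : ℕ) := by
  cases b <;> simp [signedWeight]

lemma abs_signedWeight_pow_le (b : Bool) (q : ℕ) :
    |(signedWeight w s b : ℝ) ^ q| ≤ ((max w s : ℕ) : ℝ) ^ q := by
  rw [abs_pow]
  exact pow_le_pow_left₀ (abs_nonneg _) (by exact_mod_cast abs_signedWeight_le b) q

lemma abs_prod_signedWeight_le (c : Fin k → Bool) (t : Fin j → Fin k) :
    |∏ i, (signedWeight w s (c (t i)) : ℝ)| ≤ ((max w s : ℕ) : ℝ) ^ j := by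
  rw [Finset.abs_prod]
  calc ∏ i, |(signedWeight w s (c (t i)) : ℝ)| ≤ ∏ _i : Fin j, ((max w s : ℕ) : ℝ) :=
        Finset.prod_le_prod (fun _ _ => abs_nonneg _) fun i _ => by
          exact_mod_cast abs_signedWeight_le (c (t i))
    _ = _ := by simp

lemma abs_mean_signedWeight_pow_le (q : ℕ) :
    |(p : ℝ) * (signedWeight w s true : ℝ) ^ q + (1 - p) * (signedWeight w s false : ℝ) ^ q|
      ≤ ((max w s : ℕ) : ℝ) ^ q := by
  have h_true := abs_le.mp (abs_signedWeight_pow_le (w := w) (s := s) true q)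
  have h_false := abs_le.mp (abs_signedWeight_pow_le (w := w) (s := s) false q)
  have hp := p.2
  rw [abs_le]
  constructor <;> nlinarith [hp.1, hp.2]

lemma abs_mean_signedWeight_le_one (hws : w + s = n) (hs : (s : ℝ) ≤ p * n)
    (hs' : (p : ℝ) * n < s + 1) :
    |(p : ℝ) * signedWeight w s true + (1 - p) * signedWeight w s false| ≤ 1 := by
  have hw : (w : ℝ) = n - s := eq_sub_of_add_eq (by exact_mod_cast hws)
  simp only [signedWeight, if_true, Bool.false_eq_true, if_false, Int.cast_natCast, Int.cast_neg]
  rw [hw, abs_le]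
  constructor <;> nlinarith

/-- The factor of the unrepeated value has mean at most `1`, the other factors are bounded
trivially. -/
lemma integral_prod_signedWeight_le (hws : w + s = n) (hs : (s : ℝ) ≤ p * n)
    (hs' : (p : ℝ) * n < s + 1) (t : Fin j → Fin k) (ht : ¬ AllRepeated t) :
    ∫ c : Fin k → Bool, ∏ i, (signedWeight w s (c (t i)) : ℝ) ∂bernoulliProd (Fin k) p
      ≤ ((max w s : ℕ) : ℝ) ^ (j - 1) := by
  obtain ⟨i₀, hi₀⟩ : ∃ i, ∀ i', i' ≠ i → t i' ≠ t i := by simpa [AllRepeated] using ht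
  set mult : Fin k → ℕ := fun u => (Finset.univ.filter fun i => t i = u).card with h_mult
  have h_one : mult (t i₀) = 1 := Finset.card_eq_one.mpr ⟨i₀, by
    ext i
    simp only [Finset.mem_filter, Finset.mem_univ, true_and, Finset.mem_singleton]
    exact ⟨fun h => by_contra fun hne => hi₀ i hne h, fun h => by rw [h]⟩⟩
  have h_total : ∑ u ∈ Finset.univ.erase (t i₀), mult u = j - 1 := by
    have h_sum : ∑ u, mult u = j := by
      simp only [h_mult, Finset.sum_card_fiberwise_eq_card_filter]
      simp
    rw [← Finset.add_sum_erase _ _ (Finset.mem_univ (t i₀)), h_one] at h_sum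
    lia
  have h_fiber (c : Fin k → Bool) : ∏ i, (signedWeight w s (c (t i)) : ℝ)
      = ∏ u, (signedWeight w s (c u) : ℝ) ^ mult u := by
    rw [← Finset.prod_fiberwise Finset.univ t]
    refine Finset.prod_congr rfl fun u _ => ?_
    rw [← Finset.prod_const]
    exact Finset.prod_congr rfl fun i hi => by rw [(Finset.mem_filter.mp hi).2]
  simp only [h_fiber]
  rw [integral_bernoulliProd_prod fun u b => (signedWeight w s b : ℝ) ^ mult u]
  refine (le_abs_self _).trans ?_
  rw [Finset.abs_prod, ← Finset.mul_prod_erase _ _ (Finset.mem_univ (t i₀)), h_one, ← h_total,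
    ← Finset.prod_pow_eq_pow_sum, ← one_mul (∏ u ∈ _, (_ : ℝ) ^ mult u)]
  gcongr with u
  · simpa only [pow_one] using abs_mean_signedWeight_le_one hws hs hs'
  · exact abs_mean_signedWeight_pow_le (mult u)

lemma one_le_log_of_three_le {x : ℝ} (hx : 3 ≤ x) : 1 ≤ Real.log x := by
  rw [Real.le_log_iff_exp_le (by linarith)]
  exact Real.exp_one_lt_three.le.trans hx

lemma one_le_sqrt_mul_log {r : ℕ} (hn : 3 ≤ n) (hr : 1 ≤ r) : 1 ≤ √(r * n * Real.log n) := by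
  have hn' : (3 : ℝ) ≤ n := by exact_mod_cast hn
  have hr' : (1 : ℝ) ≤ r := by exact_mod_cast hr
  exact Real.one_le_sqrt.mpr (one_le_mul_of_one_le_of_one_le
    (one_le_mul_of_one_le_of_one_le hr' (by linarith)) (one_le_log_of_three_le hn'))

lemma exp_neg_sq_mul_sqrt_mul_log_le (hn : 1 ≤ n) (r : ℕ) {b : ℝ} (hb : 0 < b) :
    Real.exp (-(6 * √(r * n * Real.log n) * b) ^ 2 / (2 * (n * b ^ 2)))
      ≤ ((n : ℝ) ^ (9 * r))⁻¹ := by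
  have hn' : (1 : ℝ) ≤ n := by exact_mod_cast hn
  have h_log : 0 ≤ r * Real.log n := mul_nonneg r.cast_nonneg (Real.log_nonneg hn')
  have h_exponent : -(6 * √(r * n * Real.log n) * b) ^ 2 / (2 * (n * b ^ 2))
      = -(18 * (r * Real.log n)) := by
    rw [mul_pow, mul_pow, Real.sq_sqrt (mul_nonneg (by positivity) (Real.log_nonneg hn'))]
    field_simp
    ring
  have h_pow : ((n : ℝ) ^ (9 * r))⁻¹ = Real.exp (-(9 * (r * Real.log n))) := by
    rw [Real.exp_neg, ← Real.rpow_natCast, Real.rpow_def_of_pos (by linarith)]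
    congr 2
    push_cast
    ring
  rw [h_exponent, h_pow, Real.exp_le_exp]
  linarith

lemma randomBip_tupleSum_ge_le (hn : 3 ≤ n) (hm : m ≤ n) (hws : w + s = n)
    (hs : (s : ℝ) ≤ p * n) (hs' : (p : ℝ) * n < s + 1) {r : ℕ} (hr : 1 ≤ r)
    (t : Fin (2 * r) → Fin k) (ht : ¬ AllRepeated t) :
    (randomBip k m p).real {H | ((max w s : ℕ) : ℝ) ^ (2 * r) * (8 * √(r * n * Real.log n))
        ≤ tupleSum H w s t} ≤ ((n : ℝ) ^ (9 * r))⁻¹ := by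
  have h_mean := integral_prod_signedWeight_le hws hs hs' t ht
  have h_abs (c) := abs_prod_signedWeight_le (w := w) (s := s) c t
  have hμn : (n : ℝ) ≤ 2 * (max w s : ℕ) := by exact_mod_cast (by lia : n ≤ 2 * max w s)
  set Z : (Fin k → Bool) → ℝ := fun c => ∏ i, (signedWeight w s (c (t i)) : ℝ)
  set μ : ℝ := ((max w s : ℕ) : ℝ)
  set S := √(r * n * Real.log n)
  have hS : 1 ≤ S := one_le_sqrt_mul_log hn hr
  have hμ : 0 < μ := by
    have : (3 : ℝ) ≤ n := by exact_mod_cast hn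
    linarith
  have h_shift : m * ∫ c, Z c ∂bernoulliProd (Fin k) p ≤ 2 * μ ^ (2 * r) := by
    calc m * ∫ c, Z c ∂bernoulliProd (Fin k) p ≤ m * μ ^ (2 * r - 1) := by gcongr
      _ ≤ 2 * μ * μ ^ (2 * r - 1) := by
          gcongr
          exact (Nat.cast_le.mpr hm).trans hμn
      _ = 2 * μ ^ (2 * r) := by rw [mul_assoc, mul_pow_sub_one (by lia)]
  have h_hoeffding := measureReal_pi_sum_ge_le (ι := Fin m) (ν := bernoulliProd (Fin k) p)
    (ε := 6 * S * μ ^ (2 * r)) (n := n) (Measurable.of_discrete (f := Z)).aemeasurable h_abs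
    (by positivity) (by simpa using hm)
  rw [← (measurePreserving_columns k m p).measureReal_preimage
    MeasurableSet.of_discrete.nullMeasurableSet] at h_hoeffding
  calc _ ≤ _ := measureReal_mono fun H hH => ?_
    _ ≤ _ := h_hoeffding
    _ ≤ _ := ?_
  · simp only [Set.mem_ofPred_eq, Set.mem_preimage, Finset.sum_sub_distrib, Finset.sum_const,
      Finset.card_univ, Fintype.card_fin, nsmul_eq_mul, tupleSum, Int.cast_sum, Int.cast_prod]
      at hH ⊢
    nlinarith [pow_pos hμ (2 * r)]
  · exact exp_neg_sq_mul_sqrt_mul_log_le (by lia) r (pow_pos hμ _)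

lemma randomBip_degree_ge_le (v : Fin m) :
    (randomBip k m p).real {H | (k : ℝ) - k * (1 - p) / 2
        ≤ ((Finset.univ.filter fun u => H (u, v) = true).card : ℝ)}
      ≤ Real.exp (-(k * (1 - p) ^ 2 / 8)) := by
  have hp := p.2.2
  have h_hoeffding := measureReal_pi_sum_ge_le (ι := Fin k) (ν := bernoulliMeasure true false p)
    (Z := fun b => if b then (1 : ℝ) else 0) (c := 1) (ε := k * (1 - p) / 2) (n := k)
    Measurable.of_discrete.aemeasurable (fun b => by cases b <;> simp)
    (by have := sub_nonneg.mpr hp; positivity) (by simp)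
  rw [← (measurePreserving_column v).measureReal_preimage
    MeasurableSet.of_discrete.nullMeasurableSet] at h_hoeffding
  calc _ ≤ _ := measureReal_mono fun H hH => ?_
    _ ≤ _ := h_hoeffding
    _ = _ := ?_
  · simp only [Set.mem_ofPred_eq, Set.mem_preimage, integral_bernoulliMeasure, smul_eq_mul,
      if_true, Bool.false_eq_true, if_false, Finset.sum_sub_distrib, Finset.sum_const,
      Finset.card_univ, Fintype.card_fin, nsmul_eq_mul, Finset.sum_boole] at hH ⊢
    linarith
  · congr 1
    obtain rfl | hk := k.eq_zero_or_pos
    · simp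
    · field_simp
      ring

end TupleSumMoments

/-! ### Degree `6r + 2`: certificates for random graphs -/

section CertificateBits
variable {k m n : ℕ}

lemma certificate_bits_le {a c W L e : ℕ} (hn : 20 ≤ n) (hk : k ≤ n) (hm : m ≤ n)
    (hL : L ≤ n ^ e) (hW : W ≤ n ^ e) (hc : c ≤ n ^ e) (ha : k ^ a * m ≤ n ^ e) :
    2 * (k + m + 1 + k * m) * (3 * (2 * k + m + 2)) + 3 * (c + k ^ a * m)
      + (1 + 2 * (k + m + 1 + k * m)) * (L * (2 + W.size)) ≤ n ^ (2 * e + 10) := by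
  have h_one : 1 ≤ n ^ e := Nat.one_le_pow _ _ (by lia)
  have h_size : W.size ≤ n ^ e := (Nat.size_le.mpr Nat.lt_two_pow_self).trans hW
  have hkm : k * m ≤ n * n := by gcongr
  have h_idx : 1 + 2 * (k + m + 1 + k * m) ≤ n ^ 3 := by nlinarith
  have h_eqn : 3 * (2 * k + m + 2) ≤ n ^ 2 := by nlinarith
  have h_system : 2 * (k + m + 1 + k * m) * (3 * (2 * k + m + 2)) ≤ n ^ 3 * n ^ 2 := by
    gcongr
    lia
  have h_mult : (1 + 2 * (k + m + 1 + k * m)) * (L * (2 + W.size))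
      ≤ n ^ 3 * (n ^ e * (3 * n ^ e)) := by
    gcongr
    lia
  have h_sq : n ^ e ≤ n ^ e * n ^ e := Nat.le_mul_of_pos_left _ h_one
  have h_cube : n ^ 3 * 20 ^ 2 ≤ n ^ 5 := by
    rw [pow_add n 3 2]
    gcongr
  have h_five : 20 ^ 5 ≤ n ^ 5 := by gcongr
  calc _ ≤ n ^ 5 * (n ^ e * n ^ e) + 6 * (n ^ e * n ^ e) + 3 * n ^ 3 * (n ^ e * n ^ e) := by
        nlinarith
    _ = (n ^ 5 + 6 + 3 * n ^ 3) * (n ^ e * n ^ e) := by ring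
    _ ≤ n ^ 5 * n ^ 5 * (n ^ e * n ^ e) := by
        gcongr
        nlinarith
    _ = n ^ (2 * e + 10) := by ring

lemma bicliqueCertificate_of_no_right {d a B : ℕ} {b : ℝ} (H : BipGraph 1 0) (hb : 0 ≤ b)
    (hB : 48 ≤ B) : BicliqueCertificate H d a b B := by
  refine IntSoSDerives.bicliqueCertificate (W := 1) (c := 0) (L := 0) Nat.one_pos
    (by simpa using hb) ?_ (by simpa using hB)
  simpa [sizeY] using IntSoSDerives.zero

theorem bicliqueCertificate_of_tupleSum {w s r M Δ δ μ c : ℕ} {b : ℝ} {H : BipGraph k m}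
    (hn : 20 ≤ n) (hk : k ≤ n) (hm : m ≤ n) (hws : w + s = n) (hμn : μ ≤ n)
    (hΔn : Δ ≤ n ^ (2 * r + 1)) (hr : 1 ≤ r) (hrn : r ≤ n)
    (hμ : ∀ b, |signedWeight w s b| ≤ μ)
    (hΔ : ∀ t : Fin (2 * r) → Fin k, ¬ AllRepeated t → tupleSum H w s t ≤ Δ)
    (hδ : ∀ v, (Finset.univ.filter fun u => H (u, v) = true).card + δ ≤ k)
    (hδn : δ ≤ n) (hM : M + Δ = w ^ (2 * r) * δ) (hM_pos : 0 < M)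
    (hcn : c ≤ n ^ (40 * r)) (hcb : c ≤ b)
    (hc : m * (m * μ ^ (2 * r) * r ^ (2 * r)) ^ 4 ≤ c * M ^ 4) :
    BicliqueCertificate H (6 * r + 2) (4 * r) b (200 * n ^ (200 * r)) := by
  have mono {e e' : ℕ} (h : e ≤ e') : n ^ e ≤ n ^ e' := Nat.pow_le_pow_right (by lia) h
  have h_cert := IntSoSDerives.of_tupleSum hn hk hm hws.le hμn hΔn hr hrn hμ hΔ hδ hδn hM hcn hc
  refine h_cert.bicliqueCertificate (by positivity) hcb ?_
  calc _ ≤ n ^ (2 * (60 * r) + 10) :=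
        certificate_bits_le hn hk hm le_rfl ?_ (hcn.trans (mono (by lia))) ?_
    _ ≤ n ^ (200 * r) := mono (by lia)
    _ ≤ 200 * n ^ (200 * r) := Nat.le_mul_of_pos_left _ (by norm_num)
  · calc 4 * M ^ 4 ≤ n * (w ^ (2 * r) * δ) ^ 4 := by
          gcongr <;> lia
      _ ≤ n * (n ^ (2 * r) * n) ^ 4 := by
          gcongr
          lia
      _ = n ^ (8 * r + 5) := by ring
      _ ≤ n ^ (60 * r) := mono (by lia)
  · calc k ^ (4 * r) * m ≤ n ^ (4 * r) * n := by gcongr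
      _ = n ^ (4 * r + 1) := by ring
      _ ≤ n ^ (60 * r) := mono (by lia)

end CertificateBits

section WeightRatio
variable {p : ℝ}

/-- The ratio of the largest absolute weight to the weight of an edge, when edges are given the
weight `1 - p` and non-edges the weight `-p`. -/
noncomputable def weightRatio (p : ℝ) : ℝ := max p (1 - p) / (1 - p)

lemma one_le_weightRatio (hp : p < 1) : 1 ≤ weightRatio p :=
  (one_le_div (sub_pos.mpr hp)).mpr (le_max_right _ _)

lemma max_pow_mul_pow_div (hp : 0 < p) (hp' : p < 1) (r : ℕ) :
    max (p / (1 - p)) ((1 - p) / p) ^ r * p ^ r / (1 - p) ^ (r + 1)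
      = weightRatio p ^ (2 * r) / (1 - p) := by
  have hq : 0 < 1 - p := sub_pos.mpr hp'
  have h_sq : max (p / (1 - p)) ((1 - p) / p) * p / (1 - p) = weightRatio p ^ 2 := by
    rw [weightRatio]
    obtain h | h := le_total p (1 - p)
    · rw [max_eq_right h, max_eq_right ((div_le_div_iff₀ hq hp).mpr (mul_self_le_mul_self hp.le h))]
      field_simp
    · rw [max_eq_left h, max_eq_left ((div_le_div_iff₀ hp hq).mpr (mul_self_le_mul_self hq.le h))]
      ring
  rw [pow_mul, ← h_sq, div_pow, mul_pow, pow_succ, div_div]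

lemma max_le_mul_weightRatio {n s w : ℕ} (hp : p < 1) (hws : w + s = n) (hs : (s : ℝ) ≤ p * n) :
    ((max w s : ℕ) : ℝ) ≤ w * weightRatio p := by
  have hq : 0 < 1 - p := sub_pos.mpr hp
  have hn : (n : ℝ) = w + s := by exact_mod_cast hws.symm
  rw [Nat.cast_max, max_le_iff, weightRatio, ← mul_div_assoc, le_div_iff₀ hq, le_div_iff₀ hq]
  constructor
  · gcongr
    exact le_max_right _ _
  · calc (s : ℝ) * (1 - p) ≤ w * p := by
          rw [hn] at hs
          linarith
      _ ≤ w * max p (1 - p) := by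
          gcongr
          exact le_max_left _ _

end WeightRatio

section TupleSumCertificate
variable {k n m w s r : ℕ} {p x Y : ℝ}

lemma two_le_tupleBound (hn : 2 ≤ n) (hr : 1 ≤ r) (hY : 1 ≤ Y) :
    2 ≤ (1000 * (r : ℝ)) ^ (10 * r) * n * Y ^ 4 := by
  have h_base : (1 : ℝ) ≤ 1000 * r := by
    have : (1 : ℝ) ≤ r := by exact_mod_cast hr
    linarith
  calc (2 : ℝ) ≤ n := by exact_mod_cast hn
    _ = 1 * n * 1 := by ring
    _ ≤ _ := by
        gcongr
        · exact one_le_pow₀ h_base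
        · exact one_le_pow₀ hY

lemma tupleBound_le (hn : 1000 ≤ n) (hr : 1 ≤ r) (hrn : r ≤ n) (hY : 0 ≤ Y) (hYn : Y ≤ n) :
    (1000 * (r : ℝ)) ^ (10 * r) * n * Y ^ 4 ≤ (n : ℝ) ^ (40 * r) := by
  have hn' : (1000 : ℝ) ≤ n := by exact_mod_cast hn
  calc (1000 * (r : ℝ)) ^ (10 * r) * n * Y ^ 4 ≤ ((n : ℝ) * n) ^ (10 * r) * n * n ^ 4 := by gcongr
    _ = (n : ℝ) ^ (20 * r + 5) := by ring
    _ ≤ (n : ℝ) ^ (40 * r) := pow_le_pow_right₀ (by linarith) (by lia)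

lemma moment_le_mul_pow_four {μ M c : ℕ} (hm : m ≤ n) (hr : 1 ≤ r) (hx : 0 < x)
    (hμ : (μ : ℝ) ^ (2 * r) ≤ (w : ℝ) ^ (2 * r) * Y) (hM : (w : ℝ) ^ (2 * r) * (x / 4) ≤ M)
    (hc : (1000 * (r : ℝ)) ^ (10 * r) * n * (n * Y / x) ^ 4 ≤ 2 * c) :
    m * (m * μ ^ (2 * r) * r ^ (2 * r)) ^ 4 ≤ c * M ^ 4 := by
  have hr' : (1 : ℝ) ≤ r := by exact_mod_cast hr
  have h_const : 512 * (r : ℝ) ^ (8 * r) ≤ (1000 * (r : ℝ)) ^ (10 * r) := by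
    rw [mul_pow]
    gcongr ?_ * ?_
    · exact (by norm_num : (512 : ℝ) ≤ 1000 ^ 1).trans
        (pow_le_pow_right₀ (by norm_num) (by lia))
    · exact pow_le_pow_right₀ hr' (by lia)
  have h_real : (m : ℝ) * (m * (μ : ℝ) ^ (2 * r) * (r : ℝ) ^ (2 * r)) ^ 4 ≤ c * (M : ℝ) ^ 4 :=
    calc (m : ℝ) * (m * (μ : ℝ) ^ (2 * r) * (r : ℝ) ^ (2 * r)) ^ 4
        ≤ n * (n * ((w : ℝ) ^ (2 * r) * Y) * (r : ℝ) ^ (2 * r)) ^ 4 := by gcongr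
      _ = 512 * (r : ℝ) ^ (8 * r) * n * (n * Y / x) ^ 4 / 2
          * ((w : ℝ) ^ (2 * r) * (x / 4)) ^ 4 := by
          field_simp
          ring
      _ ≤ (1000 * (r : ℝ)) ^ (10 * r) * n * (n * Y / x) ^ 4 / 2 * (M : ℝ) ^ 4 := by gcongr
      _ ≤ 2 * c / 2 * (M : ℝ) ^ 4 := by gcongr
      _ = c * (M : ℝ) ^ 4 := by ring
  exact_mod_cast h_real

lemma mul_quarter_le_sub {W Δ δ : ℕ} (hΔ : (Δ : ℝ) ≤ W * (x / 4)) (hδ : x / 2 ≤ δ) :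
    W * (x / 4) ≤ ((W * δ - Δ : ℕ) : ℝ) :=
  calc W * (x / 4) = W * (x / 2) - W * (x / 4) := by ring
    _ ≤ W * δ - Δ := by gcongr
    _ = ((W * δ : ℕ) : ℝ) - Δ := by push_cast; rfl
    _ ≤ ((W * δ - Δ : ℕ) : ℝ) := by
        rw [sub_le_iff_le_add]
        exact_mod_cast le_tsub_add

theorem bicliqueCertificate_of_tupleSum_le {S : ℝ} {H : BipGraph k m} (hn : 1000 ≤ n)
    (hkn : k ≤ n) (hm : m ≤ n) (hr : 1 ≤ r) (hrn : r ≤ n) (hws : w + s = n) (hw : 0 < w)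
    (hS : 1 ≤ S) (hY : 1 ≤ Y) (hx : 64 * (S * Y) ≤ x) (hxn : x ≤ n)
    (hμ : ((max w s : ℕ) : ℝ) ^ (2 * r) ≤ (w : ℝ) ^ (2 * r) * Y)
    (hΔ : ∀ t : Fin (2 * r) → Fin k, ¬ AllRepeated t →
      (tupleSum H w s t : ℝ) ≤ ((max w s : ℕ) : ℝ) ^ (2 * r) * (8 * S))
    (hdeg : ∀ v, ((Finset.univ.filter fun u => H (u, v) = true).card : ℝ) ≤ k - x / 2) :
    BicliqueCertificate H (6 * r + 2) (4 * r)
      ((1000 * (r : ℝ)) ^ (10 * r) * n * (n * Y / x) ^ 4) (200 * n ^ (200 * r)) := by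
  set Δ := ⌊((max w s : ℕ) : ℝ) ^ (2 * r) * (8 * S)⌋₊
  set δ := ⌈x / 2⌉₊
  set b := (1000 * (r : ℝ)) ^ (10 * r) * n * (n * Y / x) ^ 4
  have hSY : Y ≤ S * Y := le_mul_of_one_le_left (by linarith) hS
  have hx₀ : 0 < x := by linarith
  have hb : 2 ≤ b := two_le_tupleBound (by lia) hr <| (one_le_div hx₀).mpr <|
    hxn.trans (le_mul_of_one_le_right (by positivity) hY)
  have hbn : b ≤ (n : ℝ) ^ (40 * r) := tupleBound_le hn hr hrn (by positivity) <|
    (div_le_iff₀ hx₀).mpr (by gcongr; linarith)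
  have h_floor := Nat.lt_floor_add_one b
  have hΔx : (Δ : ℝ) ≤ ((w ^ (2 * r) : ℕ) : ℝ) * (x / 4) :=
    calc (Δ : ℝ) ≤ ((max w s : ℕ) : ℝ) ^ (2 * r) * (8 * S) := Nat.floor_le (by positivity)
      _ ≤ (w : ℝ) ^ (2 * r) * Y * (8 * S) := by gcongr
      _ = (w : ℝ) ^ (2 * r) * (8 * (S * Y)) := by ring
      _ ≤ _ := by
          push_cast
          gcongr
          linarith
  have hM := mul_quarter_le_sub hΔx (Nat.le_ceil (x / 2))
  have hM_pos : 0 < w ^ (2 * r) * δ - Δ :=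
    Nat.cast_pos.mp ((show (0 : ℝ) < _ by positivity).trans_le hM)
  have hM_add := Nat.sub_add_cancel (Nat.lt_of_sub_pos hM_pos).le
  refine bicliqueCertificate_of_tupleSum (Δ := Δ) (δ := δ) (c := ⌊b⌋₊) (by lia) hkn hm hws
    (by lia) ?_ hr hrn (fun b => by exact_mod_cast abs_signedWeight_le b) (fun t ht => ?_)
    (fun v => ?_) (Nat.ceil_le.mpr (by linarith)) hM_add hM_pos
    (Nat.floor_le_of_le (mod_cast hbn)) (Nat.floor_le (by linarith))
    (moment_le_mul_pow_four hm hr hx₀ hμ (mod_cast hM) (by linarith))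
  · suffices (Δ : ℝ) ≤ (n : ℝ) ^ (2 * r + 1) by exact_mod_cast this
    refine hΔx.trans ?_
    rw [pow_succ]
    push_cast
    gcongr
    · lia
    · linarith
  · refine Int.le_of_lt_add_one ?_
    have h_lt : (tupleSum H w s t : ℝ) < Δ + 1 := (hΔ t ht).trans_lt (Nat.lt_floor_add_one _)
    exact_mod_cast h_lt
  · have h_card := card_finset_fin_le (Finset.univ.filter fun u => H (u, v) = true)
    suffices δ ≤ k - (Finset.univ.filter fun u => H (u, v) = true).card by lia
    rw [Nat.ceil_le, Nat.cast_sub h_card]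
    linarith [hdeg v]

end TupleSumCertificate

section TupleSumCondition
variable {k n r : ℕ} {p : ℝ} (hkn : k ≤ n) (hp₀ : 0 ≤ p) (hp : p < 1)
  (hk : 64 * (√(r * n * Real.log n) * weightRatio p ^ (2 * r)) ≤ k * (1 - p))
include hp hk

lemma mul_log_le_of_tupleSum_condition (hn : 1 ≤ n) :
    4096 * (r * n * Real.log n) ≤ (k * (1 - p)) ^ 2 := by
  have _h_log : 0 ≤ Real.log n := Real.log_nonneg (by exact_mod_cast hn)
  have h_sqrt : 64 * √(r * n * Real.log n) ≤ k * (1 - p) := by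
    refine le_trans ?_ hk
    gcongr
    exact le_mul_of_one_le_right (Real.sqrt_nonneg _) (one_le_pow₀ (one_le_weightRatio hp))
  calc 4096 * (r * n * Real.log n) = (64 * √(r * n * Real.log n)) ^ 2 := by
        rw [mul_pow, Real.sq_sqrt (by positivity)]
        norm_num
    _ ≤ (k * (1 - p)) ^ 2 := by gcongr

include hkn hp₀

lemma mul_log_le_of_tupleSum_condition' (hn : 1 ≤ n) : 4096 * (r * Real.log n) ≤ n := by
  have hn' : (0 : ℝ) < n := by exact_mod_cast hn
  refine le_of_mul_le_mul_right ?_ hn'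
  calc 4096 * (r * Real.log n) * n = 4096 * (r * n * Real.log n) := by ring
    _ ≤ (k * (1 - p)) ^ 2 := mul_log_le_of_tupleSum_condition hp hk hn
    _ ≤ (n * 1) ^ 2 := by
        gcongr
        linarith
    _ = n * n := by ring

lemma le_of_tupleSum_condition (hn : 3 ≤ n) : r ≤ n := by
  have h_log : 1 ≤ Real.log n := one_le_log_of_three_le (by exact_mod_cast hn)
  have h_bound := mul_log_le_of_tupleSum_condition' hkn hp₀ hp hk (by lia)
  have : (r : ℝ) ≤ n := by nlinarith [show (0 : ℝ) ≤ r by positivity]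
  exact_mod_cast this

end TupleSumCondition

section PartTwo
variable {k m n w s : ℕ} {p : unitInterval}

lemma randomBip_exists_tupleSum_gt_le (hn : 3 ≤ n) (hk : k ≤ n) (hm : m ≤ n) (hws : w + s = n)
    (hs : (s : ℝ) ≤ p * n) (hs' : (p : ℝ) * n < s + 1) {r : ℕ} (hr : 1 ≤ r) :
    (randomBip k m p).real {H | ∃ t : Fin (2 * r) → Fin k, ¬ AllRepeated t ∧
      ((max w s : ℕ) : ℝ) ^ (2 * r) * (8 * √(r * n * Real.log n)) < tupleSum H w s t}
        ≤ ((n : ℝ) ^ 7)⁻¹ := by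
  classical
  set bad : Finset (Fin (2 * r) → Fin k) := Finset.univ.filter fun t => ¬ AllRepeated t
  have hn' : (1 : ℝ) ≤ n := by exact_mod_cast (by lia : 1 ≤ n)
  calc _ ≤ (randomBip k m p).real (⋃ t ∈ bad, {H | ((max w s : ℕ) : ℝ) ^ (2 * r)
          * (8 * √(r * n * Real.log n)) ≤ tupleSum H w s t}) :=
        measureReal_mono (by
          rintro H ⟨t, ht, hH⟩
          exact Set.mem_biUnion (Finset.mem_filter.mpr ⟨Finset.mem_univ t, ht⟩) hH.le)
          (measure_ne_top _ _)
    _ ≤ ∑ _t ∈ bad, ((n : ℝ) ^ (9 * r))⁻¹ :=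
        (measureReal_biUnion_finset_le _ _).trans <| Finset.sum_le_sum fun _ ht =>
          randomBip_tupleSum_ge_le hn hm hws hs hs' hr _ (Finset.mem_filter.mp ht).2
    _ ≤ (n : ℝ) ^ (2 * r) * ((n : ℝ) ^ (9 * r))⁻¹ := by
        have h_card : bad.card ≤ n ^ (2 * r) := by
          calc bad.card ≤ k ^ (2 * r) := by simpa using bad.card_le_univ
            _ ≤ n ^ (2 * r) := by gcongr
        rw [Finset.sum_const, nsmul_eq_mul]
        gcongr
        exact_mod_cast h_card
    _ = ((n : ℝ) ^ (7 * r))⁻¹ := by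
        rw [← div_eq_mul_inv, inv_eq_one_div, div_eq_div_iff (by positivity) (by positivity)]
        ring
    _ ≤ ((n : ℝ) ^ 7)⁻¹ := by
        gcongr ?_⁻¹
        exact pow_le_pow_right₀ hn' (by lia)

lemma randomBip_exists_degree_gt_le (hn : 0 < n) (hm : m ≤ n)
    (hk : 64 * Real.log n ≤ k * (1 - p) ^ 2) :
    (randomBip k m p).real {H | ∃ v, (k : ℝ) - k * (1 - p) / 2
      < ((Finset.univ.filter fun u => H (u, v) = true).card : ℝ)} ≤ ((n : ℝ) ^ 7)⁻¹ := by
  have hn' : (0 : ℝ) < n := by exact_mod_cast hn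
  calc _ ≤ (randomBip k m p).real (⋃ v, {H | (k : ℝ) - k * (1 - p) / 2
          ≤ ((Finset.univ.filter fun u => H (u, v) = true).card : ℝ)}) :=
        measureReal_mono <| by
          rintro H ⟨v, hH⟩
          exact Set.mem_iUnion.mpr ⟨v, hH.le⟩
    _ ≤ ∑ _v : Fin m, Real.exp (-(8 * Real.log n)) :=
        (measureReal_iUnion_fintype_le _).trans <| Finset.sum_le_sum fun v _ =>
          (randomBip_degree_ge_le v).trans (Real.exp_le_exp.mpr (by linarith))
    _ = m * ((n : ℝ) ^ 8)⁻¹ := by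
        rw [Finset.sum_const, Finset.card_univ, Fintype.card_fin, nsmul_eq_mul, Real.exp_neg,
          show 8 * Real.log n = ((8 : ℕ) : ℝ) * Real.log n by norm_num, Real.exp_nat_mul,
          Real.exp_log hn']
    _ ≤ n * ((n : ℝ) ^ 8)⁻¹ := by gcongr
    _ = ((n : ℝ) ^ 7)⁻¹ := by field_simp

lemma randomBip_pseudorandom_ge (hn : 1000 ≤ n) (hk : k ≤ n) (hm : m ≤ n) (hws : w + s = n)
    (hs : (s : ℝ) ≤ p * n) (hs' : (p : ℝ) * n < s + 1) (hkp : 64 * Real.log n ≤ k * (1 - p) ^ 2) :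
    0.995 ≤ (randomBip k m p).real {H |
      (∀ r ∈ Finset.Icc 1 n, ∀ t : Fin (2 * r) → Fin k, ¬ AllRepeated t → (tupleSum H w s t : ℝ)
        ≤ ((max w s : ℕ) : ℝ) ^ (2 * r) * (8 * √(r * n * Real.log n))) ∧
      ∀ v, ((Finset.univ.filter fun u => H (u, v) = true).card : ℝ) ≤ k - k * (1 - p) / 2} := by
  set dense : Set (BipGraph k m) := {H | ∃ v, (k : ℝ) - k * (1 - p) / 2
    < ((Finset.univ.filter fun u => H (u, v) = true).card : ℝ)}
  set large : ℕ → Set (BipGraph k m) := fun r => {H | ∃ t : Fin (2 * r) → Fin k, ¬ AllRepeated t ∧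
    ((max w s : ℕ) : ℝ) ^ (2 * r) * (8 * √(r * n * Real.log n)) < tupleSum H w s t}
  have hn' : (1000 : ℝ) ≤ n := by exact_mod_cast hn
  have h_large : (randomBip k m p).real (⋃ r ∈ Finset.Icc 1 n, large r) ≤ n * ((n : ℝ) ^ 7)⁻¹ :=
    calc _ ≤ ∑ _r ∈ Finset.Icc 1 n, ((n : ℝ) ^ 7)⁻¹ :=
          (measureReal_biUnion_finset_le _ _).trans <| Finset.sum_le_sum fun r hr =>
            randomBip_exists_tupleSum_gt_le (by lia) hk hm hws hs hs' (Finset.mem_Icc.mp hr).1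
      _ = _ := by simp
  have h_bad : (randomBip k m p).real ((⋃ r ∈ Finset.Icc 1 n, large r) ∪ dense) ≤ 0.005 :=
    calc _ ≤ n * ((n : ℝ) ^ 7)⁻¹ + ((n : ℝ) ^ 7)⁻¹ := (measureReal_union_le _ _).trans <|
          add_le_add h_large (randomBip_exists_degree_gt_le (by lia) hm hkp)
      _ = (n + 1) / (n : ℝ) ^ 7 := by ring
      _ ≤ 0.005 := by
        rw [div_le_iff₀ (by positivity)]
        nlinarith [pow_le_pow_right₀ (by linarith : 1 ≤ (n : ℝ)) (by norm_num : 2 ≤ 7)]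
  calc (0.995 : ℝ) ≤ 1 - (randomBip k m p).real ((⋃ r ∈ Finset.Icc 1 n, large r) ∪ dense) := by
        linarith
    _ = (randomBip k m p).real ((⋃ r ∈ Finset.Icc 1 n, large r) ∪ dense)ᶜ :=
        (probReal_compl_eq_one_sub MeasurableSet.of_discrete).symm
    _ ≤ _ := measureReal_mono fun H hH => ?_
  simp only [large, dense, Set.compl_union, Set.compl_iUnion, Set.mem_inter_iff, Set.mem_iInter,
    Set.mem_compl_iff, Set.mem_ofPred_eq, not_exists, not_and, not_lt] at hH
  exact hH

lemma log_le_of_tupleSum_condition {r : ℕ} (hk : 1 ≤ k) (hkn : k ≤ n) (hr : 1 ≤ r)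
    (hp : (p : ℝ) < 1)
    (h : 64 * (√(r * n * Real.log n) * weightRatio p ^ (2 * r)) ≤ k * (1 - p)) :
    64 * Real.log n ≤ k * (1 - p) ^ 2 := by
  have _h_log : 0 ≤ Real.log n := Real.log_natCast_nonneg n
  have hk' : (0 : ℝ) < k := by exact_mod_cast hk
  have hr' : (1 : ℝ) ≤ r := by exact_mod_cast hr
  refine le_of_mul_le_mul_right ?_ hk'
  calc 64 * Real.log n * k ≤ 4096 * (r * n * Real.log n) := by
        have h_le : (1 : ℝ) * k * Real.log n ≤ r * n * Real.log n := by gcongr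
        nlinarith [show 0 ≤ r * n * Real.log n by positivity]
    _ ≤ (k * (1 - p)) ^ 2 := mul_log_le_of_tupleSum_condition hp h (by lia)
    _ = k * (1 - p) ^ 2 * k := by ring

lemma randomBip_ge_of_forall {P : BipGraph k m → Prop} (h : ∀ H, P H) :
    0.995 ≤ (randomBip k m p).real {H | P H} := by
  have h_univ : {H | P H} = Set.univ := Set.eq_univ_of_forall h
  rw [h_univ, probReal_univ]
  norm_num

theorem randomBip_partTwo (hk : 1 ≤ k) (hkn : k ≤ n) (hp : (p : ℝ) < 1) :
    0.995 ≤ (randomBip k (n - k) p).real {H | ∀ r : ℕ, 1 ≤ r →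
      64 * (√(r * n * Real.log n) * weightRatio p ^ (2 * r)) ≤ k * (1 - p) →
      BicliqueCertificate H (6 * r + 2) (4 * r)
        ((1000 * (r : ℝ)) ^ (10 * r) * n * (n * weightRatio p ^ (2 * r) / (k * (1 - p))) ^ 4)
        (200 * n ^ (200 * r))} := by
  have _hq : 0 < 1 - (p : ℝ) := sub_pos.mpr hp
  have hp₀ : 0 ≤ (p : ℝ) := p.2.1
  obtain rfl | hn : n = 1 ∨ 2 ≤ n := by lia
  · obtain rfl : k = 1 := by lia
    exact randomBip_ge_of_forall fun H r _ _ =>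
      bicliqueCertificate_of_no_right H (by positivity) (by simp)
  by_cases h_cond : ∃ r : ℕ, 1 ≤ r ∧
      64 * (√(r * n * Real.log n) * weightRatio p ^ (2 * r)) ≤ k * (1 - p)
  swap
  · exact randomBip_ge_of_forall fun H r hr h => (h_cond ⟨r, hr, h⟩).elim
  obtain ⟨r₀, hr₀, h_cond⟩ := h_cond
  have h_log : 1 / 2 ≤ Real.log n :=
    (by linarith [Real.log_two_gt_d9] : (1 / 2 : ℝ) ≤ Real.log 2).trans <|
      Real.log_le_log (by norm_num) (by exact_mod_cast hn)
  have hn' : 1000 ≤ n := by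
    have h_le := mul_log_le_of_tupleSum_condition' hkn hp₀ hp h_cond (by lia)
    have hr' : (1 : ℝ) ≤ r₀ := by exact_mod_cast hr₀
    have : (1000 : ℝ) ≤ n := by nlinarith
    exact_mod_cast this
  set s := ⌊(p : ℝ) * n⌋₊
  have hs : (s : ℝ) ≤ p * n := Nat.floor_le (by positivity)
  have hsn : s < n := (Nat.floor_lt' (by lia)).mpr <|
    mul_lt_of_lt_one_left (by exact_mod_cast (by lia : 0 < n)) hp
  have hws : (n - s) + s = n := Nat.sub_add_cancel hsn.le
  refine (randomBip_pseudorandom_ge hn' hkn (n.sub_le k) hws hs (Nat.lt_floor_add_one _)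
    (log_le_of_tupleSum_condition hk hkn hr₀ hp h_cond)).trans (measureReal_mono ?_)
  intro H ⟨h_tuple, h_degree⟩ r hr h
  have hrn := le_of_tupleSum_condition hkn hp₀ hp h (by lia)
  refine bicliqueCertificate_of_tupleSum_le hn' hkn (n.sub_le k) hr hrn hws (by lia)
    (one_le_sqrt_mul_log (by lia) hr) (one_le_pow₀ (one_le_weightRatio hp)) h ?_ ?_
    (h_tuple r (Finset.mem_Icc.mpr ⟨hr, hrn⟩)) h_degree
  · calc (k : ℝ) * (1 - p) ≤ n * 1 := by
          gcongr
          linarith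
      _ = n := mul_one _
  · rw [← mul_pow]
    gcongr
    exact max_le_mul_weightRatio hp hws hs

end PartTwo

/-! ### Moments of sparse random matrices -/

section OperatorNorm
open scoped Matrix.Norms.L2Operator
variable {κ μ : Type*} [Fintype κ] [Fintype μ] [DecidableEq μ]

lemma sum_mulVec_sq_le (Z : Matrix κ μ ℝ) (y : μ → ℝ) :
    ∑ u, (Z.mulVec y u) ^ 2 ≤ ‖Z‖ ^ 2 * ∑ v, y v ^ 2 := by
  have h := pow_le_pow_left₀ (norm_nonneg _) (Z.l2_opNorm_mulVec (WithLp.toLp 2 y)) 2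
  rw [mul_pow, EuclideanSpace.norm_sq_eq, EuclideanSpace.norm_sq_eq] at h
  simpa using h

lemma dotProduct_mulVec_le (Z : Matrix κ μ ℝ) (x : κ → ℝ) (y : μ → ℝ) {a c : ℝ} (ha : 0 ≤ a)
    (hc : 0 ≤ c) (hx : ∑ u, x u ^ 2 ≤ a ^ 2) (hy : ∑ v, y v ^ 2 ≤ c ^ 2) :
    x ⬝ᵥ Z.mulVec y ≤ ‖Z‖ * a * c := by
  refine (abs_le_of_sq_le_sq' ?_ (by positivity)).2
  calc (x ⬝ᵥ Z.mulVec y) ^ 2 ≤ (∑ u, x u ^ 2) * ∑ u, (Z.mulVec y u) ^ 2 :=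
        Finset.sum_mul_sq_le_sq_mul_sq _ _ _
    _ ≤ a ^ 2 * (‖Z‖ ^ 2 * c ^ 2) := by
        gcongr
        exact (sum_mulVec_sq_le Z y).trans (by gcongr)
    _ = _ := by ring

lemma l2_opNorm_le_of_dotProduct_le (Z : Matrix κ μ ℝ) {c : ℝ} (hc : 0 ≤ c)
    (h : ∀ (x : κ → ℝ) (y : μ → ℝ), ∑ u, x u ^ 2 ≤ 1 → ∑ v, y v ^ 2 ≤ 1 → x ⬝ᵥ Z.mulVec y ≤ c) :
    ‖Z‖ ≤ c := by
  rw [Matrix.l2_opNorm_def]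
  refine ContinuousLinearMap.opNorm_le_of_re_inner_le hc fun y x hy hx => ?_
  have h_le := h x.ofLp y.ofLp (by rw [← EuclideanSpace.real_norm_sq_eq, hx, one_pow])
    (by rw [← EuclideanSpace.real_norm_sq_eq, hy, one_pow])
  simpa [EuclideanSpace.inner_eq_star_dotProduct] using h_le

lemma l2_opNorm_sq_le_sum_sq (Z : Matrix κ μ ℝ) : ‖Z‖ ^ 2 ≤ ∑ u, ∑ v, Z u v ^ 2 := by
  refine (Real.le_sqrt (norm_nonneg _) (by positivity)).mp ?_
  refine l2_opNorm_le_of_dotProduct_le Z (Real.sqrt_nonneg _) fun x y hx hy => ?_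
  refine Real.le_sqrt_of_sq_le ?_
  calc (x ⬝ᵥ Z.mulVec y) ^ 2 ≤ (∑ u, x u ^ 2) * ∑ u, (Z.mulVec y u) ^ 2 :=
        Finset.sum_mul_sq_le_sq_mul_sq _ _ _
    _ ≤ 1 * ∑ u, ∑ v, Z u v ^ 2 := by
        gcongr with u
        exact (Finset.sum_mul_sq_le_sq_mul_sq _ _ _).trans
          (mul_le_of_le_one_right (by positivity) hy)
    _ = _ := one_mul _

variable [DecidableEq κ]

lemma l2_opNorm_transpose (Z : Matrix κ μ ℝ) : ‖Z.transpose‖ = ‖Z‖ := by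
  rw [← Matrix.conjTranspose_eq_transpose_of_trivial, Z.l2_opNorm_conjTranspose]

lemma l2_opNorm_mul_transpose (Z : Matrix κ μ ℝ) : ‖Z * Z.transpose‖ = ‖Z‖ ^ 2 := by
  have h := Z.transpose.l2_opNorm_conjTranspose_mul_self
  rwa [Matrix.conjTranspose_eq_transpose_of_trivial, Matrix.transpose_transpose,
    l2_opNorm_transpose, ← pow_two] at h

lemma apply_le_l2_opNorm (A : Matrix κ κ ℝ) (u : κ) : A u u ≤ ‖A‖ := by
  simpa using dotProduct_mulVec_le A (Pi.single u 1) (Pi.single u 1) zero_le_one zero_le_one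
    (by simp [Pi.single_apply]) (by simp [Pi.single_apply])

lemma trace_mul_transpose_pow_le (Z : Matrix κ μ ℝ) {l : ℕ} (hl : l ≠ 0) :
    ((Z * Z.transpose) ^ l).trace ≤ Fintype.card κ * ‖Z‖ ^ (2 * l) :=
  calc ((Z * Z.transpose) ^ l).trace ≤ ∑ _u : κ, ‖Z‖ ^ (2 * l) :=
        Finset.sum_le_sum fun u _ => (apply_le_l2_opNorm _ u).trans <| by
          rw [pow_mul, ← l2_opNorm_mul_transpose]
          exact norm_pow_le' _ hl.pos
    _ = _ := by simp

lemma sum_sq_eq_trace_sq {A : Matrix κ κ ℝ} (hA : A.IsSymm) :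
    ∑ u, ∑ v, A u v ^ 2 = (A ^ 2).trace := by
  simp only [Matrix.trace, pow_two, Matrix.diag_apply, Matrix.mul_apply]
  exact Finset.sum_congr rfl fun u _ => Finset.sum_congr rfl fun v _ => by rw [hA.apply]

lemma l2_opNorm_pow_le_trace {A : Matrix κ κ ℝ} (hA : A.IsSymm) (i : ℕ) :
    ‖A‖ ^ 2 ^ (i + 1) ≤ (A ^ 2 ^ (i + 1)).trace := by
  have h_selfAdjoint : IsSelfAdjoint A := by
    rw [IsSelfAdjoint, Matrix.star_eq_conjTranspose, Matrix.conjTranspose_eq_transpose_of_trivial,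
      hA]
  have h_norm : ‖A ^ 2 ^ i‖ = ‖A‖ ^ 2 ^ i :=
    congrArg NNReal.toReal (h_selfAdjoint.nnnorm_pow_two_pow i)
  calc ‖A‖ ^ 2 ^ (i + 1) = ‖A ^ 2 ^ i‖ ^ 2 := by rw [h_norm, ← pow_mul, pow_succ]
    _ ≤ ∑ u, ∑ v, (A ^ 2 ^ i) u v ^ 2 := l2_opNorm_sq_le_sum_sq _
    _ = (A ^ 2 ^ (i + 1)).trace := by rw [sum_sq_eq_trace_sq (hA.pow _), ← pow_mul, ← pow_succ]

lemma l2_opNorm_pow_le_trace_mul_transpose (Z : Matrix κ μ ℝ) (i : ℕ) :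
    (‖Z‖ ^ 2) ^ 2 ^ (i + 1) ≤ ((Z * Z.transpose) ^ 2 ^ (i + 1)).trace := by
  rw [← l2_opNorm_mul_transpose]
  exact l2_opNorm_pow_le_trace (by simp [Matrix.IsSymm]) i

end OperatorNorm

open scoped Matrix.Norms.L2Operator in
lemma sum_vecMul_sq_le_of_trace_le {κ μ : Type*} [Fintype κ] [Fintype μ] [DecidableEq κ]
    (Z : Matrix κ μ ℝ) {i : ℕ} {L : ℝ} (hL : 0 ≤ L)
    (h : ((Z * Z.transpose) ^ 2 ^ (i + 1)).trace ≤ L ^ 2 ^ (i + 1)) (x : κ → ℝ) :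
    ∑ v, (∑ u, Z u v * x u) ^ 2 ≤ L * ∑ u, x u ^ 2 := by
  classical
  have h_norm : ‖Z‖ ^ 2 ≤ L := le_of_pow_le_pow_left₀ (by positivity) hL
    ((l2_opNorm_pow_le_trace_mul_transpose Z i).trans h)
  calc ∑ v, (∑ u, Z u v * x u) ^ 2 ≤ ‖Z.transpose‖ ^ 2 * ∑ u, x u ^ 2 :=
        sum_mulVec_sq_le Z.transpose x
    _ ≤ _ := by
        rw [l2_opNorm_transpose]
        gcongr

section LatticeBall
variable {ι : Type*} [Fintype ι] {S : Finset ι} {R : ℕ}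

lemma exists_int_sq_le_and_sub_sq_le_one (t : ℝ) :
    ∃ z : ℤ, (z : ℝ) ^ 2 ≤ t ^ 2 ∧ (t - z) ^ 2 ≤ 1 := by
  rcases le_total 0 t with h | h
  · have h_nonneg : (0 : ℝ) ≤ ⌊t⌋ := by exact_mod_cast Int.floor_nonneg.mpr h
    exact ⟨⌊t⌋, by nlinarith [Int.floor_le t],
      by nlinarith [Int.floor_le t, Int.lt_floor_add_one t]⟩
  · have h_nonpos : (⌈t⌉ : ℝ) ≤ 0 := by exact_mod_cast Int.ceil_le.mpr (by simpa using h)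
    exact ⟨⌈t⌉, by nlinarith [Int.le_ceil t],
      by nlinarith [Int.le_ceil t, Int.ceil_lt_add_one t]⟩

lemma exists_lattice_approx {x : ι → ℝ} (hx : ∀ i ∉ S, x i = 0) {D : ℝ} (hD : 0 < D) :
    ∃ z : ι → ℤ, (∀ i, (D⁻¹ * z i) ^ 2 ≤ x i ^ 2) ∧
      ∑ i, (x i - D⁻¹ * z i) ^ 2 ≤ (D ^ 2)⁻¹ * S.card := by
  classical
  choose round h_sq h_sub using exists_int_sq_le_and_sub_sq_le_one
  have h_sq' (i) : (D⁻¹ * round (D * x i)) ^ 2 ≤ x i ^ 2 := by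
    calc (D⁻¹ * round (D * x i)) ^ 2 ≤ D⁻¹ ^ 2 * (D * x i) ^ 2 := by
          rw [mul_pow]
          gcongr ?_ * ?_
          exact h_sq _
      _ = x i ^ 2 := by field_simp
  refine ⟨fun i => round (D * x i), h_sq', ?_⟩
  calc ∑ i, (x i - D⁻¹ * round (D * x i)) ^ 2 ≤ ∑ i, if i ∈ S then (D ^ 2)⁻¹ else 0 := by
        gcongr with i
        split_ifs with hi
        · calc (x i - D⁻¹ * round (D * x i)) ^ 2
              = (D ^ 2)⁻¹ * (D * x i - round (D * x i)) ^ 2 := by field_simp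
            _ ≤ (D ^ 2)⁻¹ := mul_le_of_le_one_right (by positivity) (h_sub _)
        · have h_zero := (h_sq' i).trans_eq (by rw [hx i hi, zero_pow two_ne_zero])
          rw [sq_nonpos_iff] at h_zero
          rw [h_zero, hx i hi]
          norm_num
    _ = (D ^ 2)⁻¹ * S.card := by
        rw [Finset.sum_ite_mem, Finset.univ_inter, Finset.sum_const, nsmul_eq_mul, mul_comm]

variable [DecidableEq ι]

/-- The lattice points supported on `S` whose squared Euclidean norm is at most `R`. Rescaled, they
form a net of the Euclidean unit ball of `ℝ^S`. -/
noncomputable def latticeBall (S : Finset ι) (R : ℕ) : Finset (ι → ℤ) :=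
  (Fintype.piFinset fun i => if i ∈ S then Finset.Icc (-(R : ℤ)) R else {0}).filter
    fun z => ∑ i, z i ^ 2 ≤ R

lemma mem_latticeBall {z : ι → ℤ} :
    z ∈ latticeBall S R ↔ (∀ i ∉ S, z i = 0) ∧ ∑ i, z i ^ 2 ≤ R := by
  rw [latticeBall, Finset.mem_filter, Fintype.mem_piFinset]
  refine ⟨fun h => ⟨fun i hi => by simpa [hi] using h.1 i, h.2⟩, fun h => ⟨fun i => ?_, h.2⟩⟩
  split_ifs with hi
  · rw [Finset.mem_Icc, ← abs_le]
    calc |z i| ≤ z i ^ 2 := by rw [← sq_abs]; exact Int.le_self_sq _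
      _ ≤ ∑ j, z j ^ 2 :=
          Finset.single_le_sum (f := fun j => z j ^ 2) (fun _ _ => sq_nonneg _) (Finset.mem_univ i)
      _ ≤ R := h.2
  · simpa using h.1 i hi

lemma sum_Icc_half_pow_natAbs_le (B : ℕ) :
    ∑ z ∈ Finset.Icc (-(B : ℤ)) B, (1 / 2 : ℝ) ^ z.natAbs ≤ 3 := by
  have h_sum : ∑ z ∈ Finset.Icc (-(B : ℤ)) B, (1 / 2 : ℝ) ^ z.natAbs = 3 - 2 * (1 / 2) ^ B := by
    induction B with
    | zero => norm_num
    | succ B ih =>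
      have h_insert : Finset.Icc (-((B + 1 : ℕ) : ℤ)) (B + 1 : ℕ)
          = insert (-((B + 1 : ℕ) : ℤ)) (insert ((B + 1 : ℕ) : ℤ) (Finset.Icc (-(B : ℤ)) B)) := by
        ext z
        simp only [Finset.mem_Icc, Finset.mem_insert]
        lia
      rw [h_insert, Finset.sum_insert (by simp only [Finset.mem_Icc, Finset.mem_insert]; lia),
        Finset.sum_insert (by simp only [Finset.mem_Icc]; lia), ih, Int.natAbs_neg,
        Int.natAbs_natCast, pow_succ]
      ring
  rw [h_sum, sub_le_self_iff]
  positivity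

lemma one_le_two_pow_mul_prod_half_pow {z : ι → ℤ} (hz : z ∈ latticeBall S R) :
    (1 : ℝ) ≤ 2 ^ R * ∏ i, (1 / 2 : ℝ) ^ (z i).natAbs := by
  rw [Finset.prod_pow_eq_pow_sum, one_div, inv_pow, ← div_eq_mul_inv, one_le_div (by positivity)]
  refine pow_le_pow_right₀ (by norm_num) ?_
  zify
  refine (Finset.sum_le_sum fun i _ => ?_).trans (mem_latticeBall.mp hz).2
  rw [← sq_abs]
  exact Int.le_self_sq _

-- The weights `2 ^ (-|z i|)` have total mass at most `3` on each coordinate in `S`.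
lemma card_latticeBall_le (S : Finset ι) (R : ℕ) :
    ((latticeBall S R).card : ℝ) ≤ 2 ^ R * 3 ^ S.card := by
  calc ((latticeBall S R).card : ℝ) = ∑ z ∈ latticeBall S R, 1 := by simp
    _ ≤ ∑ z ∈ latticeBall S R, 2 ^ R * ∏ i, (1 / 2 : ℝ) ^ (z i).natAbs :=
        Finset.sum_le_sum fun _ => one_le_two_pow_mul_prod_half_pow
    _ ≤ ∑ z ∈ Fintype.piFinset fun i => if i ∈ S then Finset.Icc (-(R : ℤ)) R else {0},
          2 ^ R * ∏ i, (1 / 2 : ℝ) ^ (z i).natAbs :=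
        Finset.sum_le_sum_of_subset_of_nonneg (Finset.filter_subset _ _) fun _ _ _ => by positivity
    _ = 2 ^ R * ∏ i, ∑ j ∈ (if i ∈ S then Finset.Icc (-(R : ℤ)) R else {0}),
          (1 / 2 : ℝ) ^ j.natAbs := by
        rw [← Finset.mul_sum, Finset.prod_univ_sum]
    _ ≤ 2 ^ R * ∏ i, if i ∈ S then 3 else 1 := by
        gcongr with i
        split_ifs
        · exact sum_Icc_half_pow_natAbs_le R
        · simp
    _ = _ := by rw [Finset.prod_ite_mem, Finset.univ_inter, Finset.prod_const]

end LatticeBall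

section NetArgument
open scoped Matrix.Norms.L2Operator
variable {κ μ : Type*} [Fintype κ] [Fintype μ] [DecidableEq κ] [DecidableEq μ]

/-- The bilinear form of `Z` at the two halves of a lattice point. -/
noncomputable def latticeForm (Z : Matrix κ μ ℝ) (z : κ ⊕ μ → ℤ) : ℝ :=
  (fun u => (z (Sum.inl u) : ℝ)) ⬝ᵥ Z.mulVec (fun v => (z (Sum.inr v) : ℝ))

variable {Z : Matrix κ μ ℝ} {S : Finset (κ ⊕ μ)} {N : ℝ}

lemma mem_latticeBall_of_sq_le (hS : S.Nonempty) {x : κ ⊕ μ → ℝ} (hx : ∀ w ∉ S, x w = 0)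
    (hx₁ : ∑ u, x (Sum.inl u) ^ 2 ≤ 1) (hx₂ : ∑ v, x (Sum.inr v) ^ 2 ≤ 1) {z : κ ⊕ μ → ℤ}
    (hz : ∀ w, ((4 * √S.card)⁻¹ * z w) ^ 2 ≤ x w ^ 2) : z ∈ latticeBall S (32 * S.card) := by
  have hS' : (0 : ℝ) < S.card := by exact_mod_cast hS.card_pos
  refine mem_latticeBall.mpr ⟨fun w hw => ?_, ?_⟩
  · have h_zero := hz w
    rw [hx w hw, zero_pow two_ne_zero, sq_nonpos_iff] at h_zero
    simpa [hS'.ne', hS.ne_empty] using h_zero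
  have h_le : ∑ w, (z w : ℝ) ^ 2 ≤ 32 * S.card :=
    calc ∑ w, (z w : ℝ) ^ 2 = 16 * S.card * ∑ w, ((4 * √S.card)⁻¹ * z w) ^ 2 := by
          simp only [mul_pow, inv_pow, Real.sq_sqrt hS'.le, Finset.mul_sum]
          exact Finset.sum_congr rfl fun w _ => by field_simp; norm_num
      _ ≤ 16 * S.card * (1 + 1) := by
          gcongr
          calc _ ≤ ∑ w, x w ^ 2 := Finset.sum_le_sum fun w _ => hz w
            _ ≤ 1 + 1 := by
                rw [Fintype.sum_sum_type]
                exact add_le_add hx₁ hx₂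
      _ = 32 * S.card := by ring
  exact_mod_cast h_le

-- Rounding `x` to the lattice with mesh `(4 * √#S)⁻¹` moves it by at most `1 / 4`.
lemma dotProduct_mulVec_le_of_latticeForm_le (hS : S.Nonempty)
    (h : ∀ z ∈ latticeBall S (32 * S.card), (16 * S.card : ℝ)⁻¹ * latticeForm Z z ≤ N)
    {x : κ ⊕ μ → ℝ} (hx : ∀ w ∉ S, x w = 0) (hx₁ : ∑ u, x (Sum.inl u) ^ 2 ≤ 1)
    (hx₂ : ∑ v, x (Sum.inr v) ^ 2 ≤ 1) :
    (fun u => x (Sum.inl u)) ⬝ᵥ Z.mulVec (fun v => x (Sum.inr v)) ≤ N + ‖Z‖ / 2 := by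
  have hS' : (0 : ℝ) < S.card := by exact_mod_cast hS.card_pos
  set D : ℝ := 4 * √S.card with hD
  have hD_sq : D ^ 2 = 16 * S.card := by
    rw [hD, mul_pow, Real.sq_sqrt hS'.le]
    norm_num
  obtain ⟨z, hz, hz_sub⟩ := exists_lattice_approx hx (by positivity : 0 < D)
  rw [hD_sq, show (16 * S.card : ℝ)⁻¹ * S.card = (1 / 4) ^ 2 by field_simp; norm_num,
    Fintype.sum_sum_type] at hz_sub
  set a : κ → ℝ := fun u => x (Sum.inl u)
  set b : μ → ℝ := fun v => x (Sum.inr v)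
  set a' : κ → ℝ := fun u => D⁻¹ * z (Sum.inl u)
  set b' : μ → ℝ := fun v => D⁻¹ * z (Sum.inr v)
  have h_split : a ⬝ᵥ Z.mulVec b
      = a' ⬝ᵥ Z.mulVec b' + (a - a') ⬝ᵥ Z.mulVec b + a' ⬝ᵥ Z.mulVec (b - b') := by
    rw [sub_dotProduct, Matrix.mulVec_sub, dotProduct_sub]
    ring
  have h_lattice : a' ⬝ᵥ Z.mulVec b' = (16 * S.card : ℝ)⁻¹ * latticeForm Z z := by
    calc a' ⬝ᵥ Z.mulVec b' = (D⁻¹ • fun u => (z (Sum.inl u) : ℝ))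
            ⬝ᵥ Z.mulVec (D⁻¹ • fun v => (z (Sum.inr v) : ℝ)) := rfl
      _ = (D ^ 2)⁻¹ * latticeForm Z z := by
          rw [Matrix.mulVec_smul, smul_dotProduct, dotProduct_smul, smul_eq_mul, smul_eq_mul,
            latticeForm]
          ring
      _ = _ := by rw [hD_sq]
  have h_left := dotProduct_mulVec_le Z (a - a') b (by norm_num) zero_le_one
    ((le_add_of_nonneg_right (by positivity)).trans hz_sub) (hx₂.trans_eq (one_pow 2).symm)
  have h_right := dotProduct_mulVec_le Z a' (b - b') zero_le_one (by norm_num)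
    ((Finset.sum_le_sum fun u _ => hz (Sum.inl u)).trans (hx₁.trans_eq (one_pow 2).symm))
    ((le_add_of_nonneg_left (by positivity)).trans hz_sub)
  have h_net := h z (mem_latticeBall_of_sq_le hS hx hx₁ hx₂ hz)
  linarith

lemma l2_opNorm_le_of_latticeForm_le
    (hZ : ∀ u v, Z u v ≠ 0 → Sum.inl u ∈ S ∧ Sum.inr v ∈ S) (hN : 0 ≤ N)
    (h : ∀ z ∈ latticeBall S (32 * S.card), (16 * S.card : ℝ)⁻¹ * latticeForm Z z ≤ N) :
    ‖Z‖ ≤ 2 * N := by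
  obtain rfl | hS := S.eq_empty_or_nonempty
  · have h_zero : Z = 0 := by
      ext u v
      by_contra h_ne
      simpa using (hZ u v h_ne).1
    rw [h_zero, norm_zero]
    positivity
  suffices ‖Z‖ ≤ N + ‖Z‖ / 2 by linarith
  refine l2_opNorm_le_of_dotProduct_le Z (by positivity) fun x y hx hy => ?_
  set t : κ ⊕ μ → ℝ := fun w => if w ∈ S then Sum.elim x y w else 0 with ht
  have h_sq (w) : t w ^ 2 ≤ Sum.elim x y w ^ 2 := by
    simp only [ht]
    split_ifs
    · rfl
    · rw [zero_pow two_ne_zero]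
      positivity
  calc x ⬝ᵥ Z.mulVec y = (fun u => t (Sum.inl u)) ⬝ᵥ Z.mulVec (fun v => t (Sum.inr v)) := by
        simp only [dotProduct, Matrix.mulVec, Finset.mul_sum]
        refine Finset.sum_congr rfl fun u _ => Finset.sum_congr rfl fun v _ => ?_
        by_cases h_ne : Z u v = 0
        · simp [h_ne]
        · simp [ht, hZ u v h_ne]
    _ ≤ N + ‖Z‖ / 2 := dotProduct_mulVec_le_of_latticeForm_le hS h (fun w hw => if_neg hw)
        ((Finset.sum_le_sum fun u _ => h_sq (Sum.inl u)).trans hx)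
        ((Finset.sum_le_sum fun v _ => h_sq (Sum.inr v)).trans hy)

lemma exists_latticeBall_l2_opNorm_le (hZ : ∀ u v, Z u v ≠ 0 → Sum.inl u ∈ S ∧ Sum.inr v ∈ S) :
    ∃ z ∈ latticeBall S (32 * S.card), ‖Z‖ ≤ 2 * ((16 * S.card : ℝ)⁻¹ * latticeForm Z z) := by
  have h_zero : 0 ∈ latticeBall S (32 * S.card) := mem_latticeBall.mpr (by simp)
  obtain ⟨z, hz, h_max⟩ := (latticeBall S (32 * S.card)).exists_max_image
    (fun z => (16 * S.card : ℝ)⁻¹ * latticeForm Z z) ⟨0, h_zero⟩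
  refine ⟨z, hz, l2_opNorm_le_of_latticeForm_le hZ (le_trans ?_ (h_max 0 h_zero)) h_max⟩
  simp [latticeForm, dotProduct]

end NetArgument

section SkewSigns
variable {ι : Type*} [Fintype ι]

/-- The probability of `true` that centers `skewSign`. -/
noncomputable def skewProb : unitInterval := ⟨1 / 3, by norm_num, by norm_num⟩

/-- A two-point variable of mean zero under `skewProb`. Unlike for a Rademacher variable, its third
moment is positive, so that its moments dominate those of a centered Bernoulli variable. -/
def skewSign (b : Bool) : ℝ := if b then 2 else -1

lemma integral_exp_mul_skewSign_le (t : ℝ) :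
    ∫ b, Real.exp (t * skewSign b) ∂bernoulliMeasure true false skewProb
      ≤ Real.exp (9 / 8 * t ^ 2) := by
  have h_range (b : Bool) : skewSign b ∈ Set.Icc (-1 : ℝ) 2 := by
    cases b <;> norm_num [skewSign]
  have h_mean : ∫ b, skewSign b ∂bernoulliMeasure true false skewProb = 0 := by
    rw [integral_bernoulliMeasure]
    norm_num [skewSign, skewProb]
  refine ((hasSubgaussianMGF_of_mem_Icc_of_integral_eq_zero (by fun_prop)
    (ae_of_all _ h_range) h_mean).mgf_le t).trans_eq ?_
  congr 1
  simp only [NNReal.coe_pow, NNReal.coe_div, coe_nnnorm]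
  norm_num
  ring

lemma integral_exp_sum_mul_skewSign_le (c : ι → ℝ) :
    ∫ Y, Real.exp (∑ e, c e * skewSign (Y e)) ∂bernoulliProd ι skewProb
      ≤ Real.exp (9 / 8 * ∑ e, c e ^ 2) := by
  simp only [Real.exp_sum, Finset.mul_sum]
  rw [integral_fintype_prod_eq_prod fun e b => Real.exp (c e * skewSign b)]
  exact Finset.prod_le_prod (fun e _ => by positivity) fun e _ => integral_exp_mul_skewSign_le _

lemma pow_two_mul_le_pow_mul_exp {l : ℕ} (hl : l ≠ 0) {x : ℝ} (hx : 0 ≤ x) :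
    x ^ (2 * l) ≤ (l : ℝ) ^ l * Real.exp (2 * √l * x) := by
  have hl_pos : (0 : ℝ) < l := by exact_mod_cast Nat.pos_of_ne_zero hl
  have h_le : x ≤ √l * Real.exp (x / √l) := by
    rw [← div_le_iff₀' (by positivity)]
    linarith [Real.add_one_le_exp (x / √l)]
  calc x ^ (2 * l) ≤ (√l * Real.exp (x / √l)) ^ (2 * l) := by gcongr
    _ = (l : ℝ) ^ l * Real.exp ((2 * l : ℕ) * (x / √l)) := by
        rw [mul_pow, pow_mul (√l), Real.sq_sqrt hl_pos.le, Real.exp_nat_mul]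
    _ = (l : ℝ) ^ l * Real.exp (2 * √l * x) := by
        congr 2
        push_cast
        field_simp
        rw [Real.sq_sqrt hl_pos.le, mul_comm]

end SkewSigns

section SparseMatrix
variable {κ μ : Type*} {l : ℕ}

/-- The matrix of skew signs, with all rows and columns not selected by `ξ` replaced by zero. -/
def sparseMatrix (ξ : κ ⊕ μ → Bool) (Y : κ × μ → Bool) : Matrix κ μ ℝ :=
  Matrix.of fun u v => (ξ (Sum.inl u)).toNat * (ξ (Sum.inr v)).toNat * skewSign (Y (u, v))

variable [Fintype κ] [Fintype μ]

lemma latticeForm_sparseMatrix (ξ : κ ⊕ μ → Bool) (Y : κ × μ → Bool) (z : κ ⊕ μ → ℤ) :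
    latticeForm (sparseMatrix ξ Y) z = ∑ e : κ × μ, ((z (Sum.inl e.1) * z (Sum.inr e.2)) *
      ((ξ (Sum.inl e.1)).toNat * (ξ (Sum.inr e.2)).toNat)) * skewSign (Y e) := by
  simp only [latticeForm, sparseMatrix, dotProduct, Matrix.mulVec, Matrix.of_apply, Finset.mul_sum,
    Fintype.sum_prod_type]
  exact Finset.sum_congr rfl fun u _ => Finset.sum_congr rfl fun v _ => by ring

lemma mem_of_sparseMatrix_ne_zero {ξ : κ ⊕ μ → Bool} {Y : κ × μ → Bool} {u : κ} {v : μ}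
    (h : sparseMatrix ξ Y u v ≠ 0) :
    Sum.inl u ∈ Finset.univ.filter (fun w => ξ w = true) ∧
      Sum.inr v ∈ Finset.univ.filter (fun w => ξ w = true) := by
  simp only [Finset.mem_filter_univ]
  contrapose! h
  by_cases hu : ξ (Sum.inl u) = true
  · simp [sparseMatrix, h hu]
  · simp [sparseMatrix, hu]

variable [DecidableEq κ]

lemma sum_sq_mul_sum_sq_le_of_mem_latticeBall [DecidableEq μ] {S : Finset (κ ⊕ μ)} {R : ℕ}
    {z : κ ⊕ μ → ℤ}
    (hz : z ∈ latticeBall S (2 * R)) :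
    (∑ u, (z (Sum.inl u) : ℝ) ^ 2) * ∑ v, (z (Sum.inr v) : ℝ) ^ 2 ≤ R ^ 2 := by
  have h_sum : ∑ u, (z (Sum.inl u) : ℝ) ^ 2 + ∑ v, (z (Sum.inr v) : ℝ) ^ 2 ≤ 2 * R := by
    rw [← Fintype.sum_sum_type fun w => (z w : ℝ) ^ 2]
    exact_mod_cast (mem_latticeBall.mp hz).2
  set a := ∑ u, (z (Sum.inl u) : ℝ) ^ 2
  set b := ∑ v, (z (Sum.inr v) : ℝ) ^ 2
  calc a * b ≤ ((a + b) / 2) ^ 2 := by linarith [sq_nonneg (a - b)]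
    _ ≤ R ^ 2 := by gcongr; linarith

lemma integral_exp_latticeForm_sparseMatrix_le [DecidableEq μ] (ξ : κ ⊕ μ → Bool)
    {S : Finset (κ ⊕ μ)} {R : ℕ} {z : κ ⊕ μ → ℤ} (hz : z ∈ latticeBall S (2 * R)) (t : ℝ) :
    ∫ Y, Real.exp (t * latticeForm (sparseMatrix ξ Y) z) ∂bernoulliProd (κ × μ) skewProb
      ≤ Real.exp (9 / 8 * (t * R) ^ 2) := by
  simp only [latticeForm_sparseMatrix, Finset.mul_sum, ← mul_assoc]
  refine (integral_exp_sum_mul_skewSign_le _).trans ?_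
  have h_bool (b : Bool) : (b.toNat : ℝ) ^ 2 ≤ 1 := by cases b <;> simp
  gcongr
  calc ∑ e : κ × μ, (t * z (Sum.inl e.1) * z (Sum.inr e.2) * (ξ (Sum.inl e.1)).toNat *
          (ξ (Sum.inr e.2)).toNat) ^ 2
      ≤ ∑ e : κ × μ, t ^ 2 * (z (Sum.inl e.1) ^ 2 * z (Sum.inr e.2) ^ 2) := by
        gcongr with e
        simp only [mul_pow]
        rw [mul_assoc _ (_ ^ 2) (_ ^ 2), ← mul_assoc (t ^ 2)]
        exact mul_le_of_le_one_right (by positivity)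
          (mul_le_one₀ (h_bool _) (by positivity) (h_bool _))
    _ = t ^ 2 * ((∑ u, (z (Sum.inl u) : ℝ) ^ 2) * ∑ v, (z (Sum.inr v) : ℝ) ^ 2) := by
        rw [← Finset.mul_sum, Finset.sum_mul_sum, Fintype.sum_prod_type]
    _ ≤ t ^ 2 * R ^ 2 := by gcongr; exact sum_sq_mul_sum_sq_le_of_mem_latticeBall hz
    _ = (t * R) ^ 2 := by rw [mul_pow]

open scoped Matrix.Norms.L2Operator in
lemma trace_mul_transpose_pow_le_sum_exp [DecidableEq μ] {Z : Matrix κ μ ℝ} {S : Finset (κ ⊕ μ)}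
    (hZ : ∀ u v, Z u v ≠ 0 → Sum.inl u ∈ S ∧ Sum.inr v ∈ S) (hl : l ≠ 0) :
    ((Z * Z.transpose) ^ l).trace ≤ Fintype.card κ * ((l : ℝ) ^ l *
      ∑ z ∈ latticeBall S (32 * S.card),
        Real.exp (4 * √l * (16 * S.card : ℝ)⁻¹ * latticeForm Z z)) := by
  obtain ⟨z, hz, h_norm⟩ := exists_latticeBall_l2_opNorm_le hZ
  calc ((Z * Z.transpose) ^ l).trace ≤ Fintype.card κ * ‖Z‖ ^ (2 * l) :=
        trace_mul_transpose_pow_le Z hl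
    _ ≤ Fintype.card κ * ((l : ℝ) ^ l * Real.exp (2 * √l * ‖Z‖)) := by
        gcongr
        exact pow_two_mul_le_pow_mul_exp hl (norm_nonneg Z)
    _ ≤ Fintype.card κ * ((l : ℝ) ^ l *
          Real.exp (2 * √l * (2 * ((16 * S.card : ℝ)⁻¹ * latticeForm Z z)))) := by gcongr
    _ = Fintype.card κ * ((l : ℝ) ^ l *
          Real.exp (4 * √l * (16 * S.card : ℝ)⁻¹ * latticeForm Z z)) := by ring_nf
    _ ≤ _ := by
        gcongr
        exact Finset.single_le_sum
          (f := fun z => Real.exp (4 * √l * (16 * S.card : ℝ)⁻¹ * latticeForm Z z))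
          (fun _ _ => (Real.exp_pos _).le) hz

lemma integral_trace_sparseMatrix_le (ξ : κ ⊕ μ → Bool) (hl : l ≠ 0) :
    ∫ Y, ((sparseMatrix ξ Y * (sparseMatrix ξ Y).transpose) ^ l).trace
        ∂bernoulliProd (κ × μ) skewProb
      ≤ Fintype.card κ * ((l : ℝ) ^ l * Real.exp (18 * l)) *
        (3 * 2 ^ 32) ^ (Finset.univ.filter fun w => ξ w = true).card := by
  classical
  set S := Finset.univ.filter fun w => ξ w = true
  set t : ℝ := 4 * √l * (16 * S.card : ℝ)⁻¹ with ht
  have h_exponent : 9 / 8 * (t * (16 * S.card : ℕ)) ^ 2 ≤ 18 * l := by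
    calc 9 / 8 * (t * (16 * S.card : ℕ)) ^ 2
        = 18 * √l ^ 2 * ((16 * S.card : ℝ)⁻¹ * (16 * S.card)) ^ 2 := by
          rw [ht]
          push_cast
          ring
      _ ≤ 18 * √l ^ 2 * 1 := by
          gcongr
          exact pow_le_one₀ (by positivity) inv_mul_le_one
      _ = 18 * l := by rw [mul_one, Real.sq_sqrt l.cast_nonneg]
  calc _ ≤ ∫ Y, Fintype.card κ * ((l : ℝ) ^ l * ∑ z ∈ latticeBall S (32 * S.card),
          Real.exp (t * latticeForm (sparseMatrix ξ Y) z)) ∂bernoulliProd (κ × μ) skewProb :=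
        integral_mono .of_finite .of_finite fun Y =>
          trace_mul_transpose_pow_le_sum_exp (fun u v => mem_of_sparseMatrix_ne_zero) hl
    _ = Fintype.card κ * ((l : ℝ) ^ l * ∑ z ∈ latticeBall S (32 * S.card),
          ∫ Y, Real.exp (t * latticeForm (sparseMatrix ξ Y) z)
            ∂bernoulliProd (κ × μ) skewProb) := by
        rw [integral_const_mul, integral_const_mul, integral_finsetSum _ fun _ _ => .of_finite]
    _ ≤ Fintype.card κ * ((l : ℝ) ^ l *
          ∑ z ∈ latticeBall S (32 * S.card), Real.exp (18 * l)) := by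
        gcongr with z hz
        refine (integral_exp_latticeForm_sparseMatrix_le ξ (S := S) (R := 16 * S.card) ?_ t).trans
          (Real.exp_le_exp.mpr h_exponent)
        rwa [← mul_assoc]
    _ = Fintype.card κ * ((l : ℝ) ^ l * Real.exp (18 * l)) *
          (latticeBall S (32 * S.card)).card := by
        rw [Finset.sum_const, nsmul_eq_mul]
        ring
    _ ≤ _ := by
        gcongr
        exact (card_latticeBall_le S _).trans_eq (by rw [pow_mul, ← mul_pow, mul_comm (3 : ℝ)])

lemma integral_pow_card_filter_le {ι : Type*} [Fintype ι] (s : unitInterval) {C : ℝ} :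
    ∫ ξ, C ^ (Finset.univ.filter fun w => ξ w = true).card ∂bernoulliProd ι s
      = (s * C + (1 - s)) ^ Fintype.card ι := by
  have h_prod (ξ : ι → Bool) : C ^ (Finset.univ.filter fun w => ξ w = true).card
      = ∏ w, if ξ w = true then C else 1 := by
    rw [Finset.prod_ite, Finset.prod_const, Finset.prod_const_one, mul_one]
  simp only [h_prod]
  rw [integral_bernoulliProd_prod fun _ b => if b = true then C else 1]
  simp

lemma integral_integral_trace_sparseMatrix_le (hl : l ≠ 0) {s : unitInterval}
    (hs : (Fintype.card (κ ⊕ μ) : ℝ) * s ≤ l) :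
    ∫ ξ, ∫ Y, ((sparseMatrix ξ Y * (sparseMatrix ξ Y).transpose) ^ l).trace
        ∂bernoulliProd (κ × μ) skewProb ∂bernoulliProd (κ ⊕ μ) s
      ≤ Fintype.card κ * ((l : ℝ) ^ l * Real.exp ((18 + 3 * 2 ^ 32) * l)) := by
  calc _ ≤ ∫ ξ, Fintype.card κ * ((l : ℝ) ^ l * Real.exp (18 * l)) *
          (3 * 2 ^ 32) ^ (Finset.univ.filter fun w => ξ w = true).card
            ∂bernoulliProd (κ ⊕ μ) s :=
        integral_mono .of_finite .of_finite fun ξ => integral_trace_sparseMatrix_le ξ hl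
    _ = Fintype.card κ * ((l : ℝ) ^ l * Real.exp (18 * l)) *
          (s * (3 * 2 ^ 32) + (1 - s)) ^ Fintype.card (κ ⊕ μ) := by
        rw [integral_const_mul, integral_pow_card_filter_le]
    _ ≤ Fintype.card κ * ((l : ℝ) ^ l * Real.exp (18 * l)) * Real.exp (3 * 2 ^ 32 * l) := by
        have h_one_sub := sub_nonneg.mpr s.2.2
        have h_nonneg := s.2.1
        gcongr
        calc (s * (3 * 2 ^ 32) + (1 - s) : ℝ) ^ Fintype.card (κ ⊕ μ)
            ≤ Real.exp (3 * 2 ^ 32 * s) ^ Fintype.card (κ ⊕ μ) := by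
              gcongr
              linarith [Real.add_one_le_exp (3 * 2 ^ 32 * s : ℝ)]
          _ = Real.exp (3 * 2 ^ 32 * (Fintype.card (κ ⊕ μ) * s)) := by
              rw [← Real.exp_nat_mul]
              ring_nf
          _ ≤ Real.exp (3 * 2 ^ 32 * l) := by gcongr
    _ = _ := by
        rw [mul_assoc, mul_assoc, ← Real.exp_add]
        ring_nf

end SparseMatrix

/-! ### Moments of the centered adjacency matrix -/

section TracePolynomial
variable {κ μ : Type*} [DecidableEq κ] [Fintype κ] [Fintype μ]

/-- The trace of `(Z * Zᵀ) ^ l` as a polynomial in the entries of `Z`. Its monomials are the closed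
walks of length `2 * l` in the complete bipartite graph. -/
noncomputable def tracePoly (κ μ : Type*) [DecidableEq κ] [Fintype κ] [Fintype μ] (l : ℕ) :
    MvPolynomial (κ × μ) ℕ :=
  ((Matrix.mvPolynomialX κ μ ℕ * (Matrix.mvPolynomialX κ μ ℕ).transpose) ^ l).trace

lemma trace_mul_transpose_pow_eq_sum (Z : Matrix κ μ ℝ) (l : ℕ) :
    ((Z * Z.transpose) ^ l).trace
      = ∑ a ∈ (tracePoly κ μ l).support, ((coeff a (tracePoly κ μ l) : ℕ) : ℝ) *
          ∏ e, Z e.1 e.2 ^ a e := by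
  set φ : MvPolynomial (κ × μ) ℕ →+* ℝ := eval₂Hom (Nat.castRingHom ℝ) fun e => Z e.1 e.2 with hφ
  have h_map : (Matrix.mvPolynomialX κ μ ℕ).map φ = Z := by
    ext u v
    simp [hφ]
  have h_trace : φ (tracePoly κ μ l)
      = (φ.mapMatrix ((Matrix.mvPolynomialX κ μ ℕ *
          (Matrix.mvPolynomialX κ μ ℕ).transpose) ^ l)).trace :=
    AddMonoidHom.map_trace φ.toAddMonoidHom _
  rw [map_pow, RingHom.mapMatrix_apply, Matrix.map_mul, Matrix.transpose_map, h_map] at h_trace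
  rw [← h_trace]
  exact eval₂_eq' (Nat.castRingHom ℝ) _ _

end TracePolynomial

section Walks
variable {κ μ : Type*} [DecidableEq κ] [DecidableEq μ]

/-- The vertices of the edges that occur in a monomial in the entries of a matrix. -/
def touched (a : κ × μ →₀ ℕ) : Finset (κ ⊕ μ) :=
  a.support.biUnion fun e => {Sum.inl e.1, Sum.inr e.2}

/-- The edges of `a` lie in a vertex set that contains `w` and `w'` and has at most one vertex more
than `a` has distinct edges, as is the case for the edges of a walk from `w` to `w'`. -/
def WalkLike (a : κ × μ →₀ ℕ) (w w' : κ ⊕ μ) : Prop :=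
  ∃ S : Finset (κ ⊕ μ), w ∈ S ∧ w' ∈ S ∧ touched a ⊆ S ∧ S.card ≤ a.support.card + 1

lemma WalkLike.zero (w : κ ⊕ μ) : WalkLike 0 w w :=
  ⟨{w}, by simp, by simp, by simp [touched], by simp⟩

lemma support_add_single_one {α : Type*} [DecidableEq α] (a : α →₀ ℕ) (e : α) :
    (a + Finsupp.single e 1).support = insert e a.support := by
  ext x
  by_cases hx : e = x
  · simp [hx]
  · simp [Ne.symm hx]

lemma WalkLike.add_single {a : κ × μ →₀ ℕ} {w w' w'' : κ ⊕ μ} (h : WalkLike a w w') {e : κ × μ}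
    (he : ({Sum.inl e.1, Sum.inr e.2} : Finset (κ ⊕ μ)) = {w', w''}) :
    WalkLike (a + Finsupp.single e 1) w w'' := by
  obtain ⟨S, hw, hw', h_touched, h_card⟩ := h
  refine ⟨insert w'' S, Finset.mem_insert_of_mem hw, Finset.mem_insert_self _ _, ?_, ?_⟩
  · rw [touched, support_add_single_one, Finset.biUnion_insert, he]
    refine Finset.union_subset ?_ (h_touched.trans (Finset.subset_insert _ _))
    simp [Finset.insert_subset_iff, hw']
  rw [support_add_single_one]
  by_cases hw'' : w'' ∈ S
  · rw [Finset.insert_eq_of_mem hw'']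
    exact h_card.trans (by gcongr; exact Finset.subset_insert _ _)
  · have h_new : e ∉ a.support := fun h_mem =>
      hw'' (h_touched (Finset.mem_biUnion.mpr ⟨e, h_mem, by simp [he]⟩))
    rw [Finset.card_insert_of_notMem hw'', Finset.card_insert_of_notMem h_new]
    lia

variable [Fintype κ] [Fintype μ]

lemma walkLike_of_mem_support {l : ℕ} {u u' : κ} {a : κ × μ →₀ ℕ}
    (ha : a ∈ (((Matrix.mvPolynomialX κ μ ℕ *
      (Matrix.mvPolynomialX κ μ ℕ).transpose) ^ l) u u').support) :
    WalkLike a (Sum.inl u) (Sum.inl u') := by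
  induction l generalizing u' a with
  | zero =>
    rw [pow_zero, Matrix.one_apply] at ha
    split_ifs at ha with h
    · subst h
      have h_zero : a = 0 := by simpa using ha
      exact h_zero ▸ WalkLike.zero _
    · simp at ha
  | succ l ih =>
    rw [pow_succ, Matrix.mul_apply] at ha
    obtain ⟨i, -, ha⟩ := Finset.mem_biUnion.mp (support_sum ha)
    rw [Matrix.mul_apply, Finset.mul_sum] at ha
    obtain ⟨v, -, ha⟩ := Finset.mem_biUnion.mp (support_sum ha)
    rw [Matrix.transpose_apply, Matrix.mvPolynomialX_apply, Matrix.mvPolynomialX_apply,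
      ← mul_assoc, support_mul_X, Finset.mem_map] at ha
    obtain ⟨a', ha', rfl⟩ := ha
    rw [support_mul_X, Finset.mem_map] at ha'
    obtain ⟨a'', ha'', rfl⟩ := ha'
    have h_step : WalkLike (a'' + Finsupp.single (i, v) 1) (Sum.inl u) (Sum.inr v) :=
      (ih ha'').add_single rfl
    exact h_step.add_single (Finset.pair_comm _ _)

lemma card_touched_le_of_mem_support {l : ℕ} {a : κ × μ →₀ ℕ}
    (ha : a ∈ (tracePoly κ μ l).support) : (touched a).card ≤ a.support.card + 1 := by
  obtain ⟨u, -, ha⟩ := Finset.mem_biUnion.mp (support_sum ha)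
  obtain ⟨S, -, -, h_touched, h_card⟩ := walkLike_of_mem_support ha
  exact (Finset.card_le_card h_touched).trans h_card

end Walks

section Comparison
variable {κ μ : Type*} [Fintype κ] [Fintype μ] {p : unitInterval}

/-- The value at `b` of a Bernoulli variable of parameter `p`, minus its mean. -/
def centered (p : ℝ) (b : Bool) : ℝ := if b then 1 - p else -p

/-- The biadjacency matrix of a random bipartite graph, minus its mean. -/
def centeredMatrix (p : ℝ) (H : κ × μ → Bool) : Matrix κ μ ℝ :=
  Matrix.of fun u v => centered p (H (u, v))

/-- The variance `p * (1 - p)` of a Bernoulli variable, as a probability. -/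
def bernoulliVar (p : unitInterval) : unitInterval := p * unitInterval.symm p

/-- The `j`-th moment of a skew sign. -/
noncomputable def skewMoment (j : ℕ) : ℝ := 1 / 3 * 2 ^ j + 2 / 3 * (-1) ^ j

lemma coe_bernoulliVar : (bernoulliVar p : ℝ) = p * (1 - p) := rfl

lemma one_le_skewMoment {j : ℕ} (hj : j ≠ 1) : 1 ≤ skewMoment j := by
  rw [skewMoment]
  rcases Nat.even_or_odd j with h_even | h_odd
  · rw [h_even.neg_one_pow]
    linarith [one_le_pow₀ (n := j) (one_le_two : (1 : ℝ) ≤ 2)]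
  · have h_three : 3 ≤ j := by
      obtain ⟨i, rfl⟩ := h_odd
      lia
    rw [h_odd.neg_one_pow]
    linarith [pow_le_pow_right₀ (one_le_two : (1 : ℝ) ≤ 2) h_three]

lemma skewMoment_nonneg (j : ℕ) : 0 ≤ skewMoment j := by
  rcases eq_or_ne j 1 with rfl | hj
  · norm_num [skewMoment]
  · exact zero_le_one.trans (one_le_skewMoment hj)

lemma abs_mean_centered_pow_le {j : ℕ} (hj : 2 ≤ j) :
    |(p : ℝ) * centered p true ^ j + (1 - p) * centered p false ^ j| ≤ bernoulliVar p := by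
  obtain ⟨j, rfl⟩ := Nat.exists_eq_add_of_le' hj
  have hp := p.2.1
  have hq : (0 : ℝ) ≤ 1 - p := sub_nonneg.mpr p.2.2
  have h_pow (t : ℝ) (ht : 0 ≤ t) (ht' : t ≤ 1) : t ^ (j + 1) ≤ t :=
    pow_le_of_le_one ht ht' j.succ_ne_zero
  simp only [centered, if_true, Bool.false_eq_true, if_false]
  calc |(p : ℝ) * (1 - p) ^ (j + 2) + (1 - p) * (-p) ^ (j + 2)|
      ≤ |(p : ℝ) * (1 - p) ^ (j + 2)| + |(1 - p) * (-p : ℝ) ^ (j + 2)| := abs_add_le _ _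
    _ = p * (1 - p) * ((1 - p) ^ (j + 1) + (p : ℝ) ^ (j + 1)) := by
        rw [abs_mul, abs_mul, abs_pow, abs_pow, abs_neg, abs_of_nonneg hp, abs_of_nonneg hq]
        ring
    _ ≤ p * (1 - p) * ((1 - p) + p) := by
        gcongr
        · exact h_pow _ hq (sub_le_self _ hp)
        · exact h_pow _ hp p.2.2
    _ = bernoulliVar p := by rw [sub_add_cancel, mul_one, coe_bernoulliVar]

lemma integral_prod_centered_pow_le {ι : Type*} [Fintype ι] (a : ι →₀ ℕ) :
    ∫ H, ∏ e, centered p (H e) ^ a e ∂bernoulliProd ι p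
      ≤ if ∃ e, a e = 1 then 0 else (bernoulliVar p : ℝ) ^ a.support.card := by
  classical
  rw [integral_bernoulliProd_prod fun e b => centered p b ^ a e]
  split_ifs with h
  · obtain ⟨e, he⟩ := h
    refine (Finset.prod_eq_zero (Finset.mem_univ e) ?_).le
    simp only [he, centered, if_true, Bool.false_eq_true, if_false]
    ring
  push Not at h
  refine (le_abs_self _).trans ?_
  rw [Finset.abs_prod]
  calc ∏ e, |(p : ℝ) * centered p true ^ a e + (1 - p) * centered p false ^ a e|
      ≤ ∏ e, if e ∈ a.support then (bernoulliVar p : ℝ) else 1 := by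
        refine Finset.prod_le_prod (fun _ _ => abs_nonneg _) fun e _ => ?_
        split_ifs with he
        · refine abs_mean_centered_pow_le ?_
          have h_ne := Finsupp.mem_support_iff.mp he
          have h_one := h e
          lia
        · simp [Finsupp.notMem_support_iff.mp he]
    _ = _ := by rw [Finset.prod_ite_mem, Finset.univ_inter, Finset.prod_const]

lemma integral_prod_skewSign_pow {ι : Type*} [Fintype ι] (a : ι → ℕ) :
    ∫ Y, ∏ e, skewSign (Y e) ^ a e ∂bernoulliProd ι skewProb = ∏ e, skewMoment (a e) := by
  rw [integral_bernoulliProd_prod fun e b => skewSign b ^ a e]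
  simp only [skewMoment, skewSign, skewProb, if_true, Bool.false_eq_true, if_false]
  norm_num

lemma integral_prod_selected {ι : Type*} [Fintype ι] [DecidableEq ι] (s : unitInterval)
    (S : Finset ι) :
    ∫ ξ, ∏ w, (if w ∈ S then ((ξ w).toNat : ℝ) else 1) ∂bernoulliProd ι s
      = (s : ℝ) ^ S.card := by
  rw [integral_bernoulliProd_prod fun w b => if w ∈ S then (b.toNat : ℝ) else 1]
  calc _ = ∏ w, if w ∈ S then (s : ℝ) else 1 :=
        Finset.prod_congr rfl fun w _ => by split_ifs <;> simp
    _ = _ := by rw [Finset.prod_ite_mem, Finset.univ_inter, Finset.prod_const]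

variable [DecidableEq κ]

lemma prod_selected_pow [DecidableEq μ] (ξ : κ ⊕ μ → Bool) (a : κ × μ →₀ ℕ) :
    ∏ e, (((ξ (Sum.inl e.1)).toNat : ℝ) * (ξ (Sum.inr e.2)).toNat) ^ a e
      = ∏ w, if w ∈ touched a then ((ξ w).toNat : ℝ) else 1 := by
  by_cases h : ∀ w ∈ touched a, ξ w = true
  · trans 1
    · refine Finset.prod_eq_one fun e _ => ?_
      by_cases he : e ∈ a.support
      · simp [h (Sum.inl e.1) (Finset.mem_biUnion.mpr ⟨e, he, by simp⟩),
          h (Sum.inr e.2) (Finset.mem_biUnion.mpr ⟨e, he, by simp⟩)]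
      · rw [Finsupp.notMem_support_iff.mp he, pow_zero]
    · refine (Finset.prod_eq_one fun w _ => ?_).symm
      split_ifs with hw
      · simp [h w hw]
      · rfl
  · push Not at h
    obtain ⟨w, hw, hξ⟩ := h
    rw [ne_eq, Bool.not_eq_true] at hξ
    rw [Finset.prod_eq_zero (i := w) (Finset.mem_univ _) (by simp [hw, hξ])]
    obtain ⟨e, he, hwe⟩ := Finset.mem_biUnion.mp hw
    refine Finset.prod_eq_zero (i := e) (Finset.mem_univ _) ?_
    have h_ne := Finsupp.mem_support_iff.mp he
    simp only [Finset.mem_insert, Finset.mem_singleton] at hwe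
    rcases hwe with rfl | rfl <;> simp [hξ, h_ne]

lemma integral_integral_prod_sparseMatrix_pow [DecidableEq μ] (s : unitInterval) (a : κ × μ →₀ ℕ) :
    ∫ ξ, ∫ Y, ∏ e : κ × μ, sparseMatrix ξ Y e.1 e.2 ^ a e
        ∂bernoulliProd (κ × μ) skewProb ∂bernoulliProd (κ ⊕ μ) s
      = (s : ℝ) ^ (touched a).card * ∏ e, skewMoment (a e) := by
  simp only [sparseMatrix, Matrix.of_apply, Prod.mk.eta, mul_pow _ (skewSign _),
    Finset.prod_mul_distrib, prod_selected_pow, integral_const_mul, integral_prod_skewSign_pow,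
    integral_mul_const, integral_prod_selected]

-- A closed walk visits at most one vertex more than it has distinct edges, so the probability that
-- all its vertices are selected loses only one factor against its moment in the centered matrix.
lemma integral_trace_centeredMatrix_le (hp : 0 < (bernoulliVar p : ℝ)) (l : ℕ) :
    ∫ H, ((centeredMatrix p H * (centeredMatrix p H).transpose) ^ l).trace
        ∂bernoulliProd (κ × μ) p
      ≤ (bernoulliVar p : ℝ)⁻¹ * ∫ ξ, ∫ Y,
          ((sparseMatrix ξ Y * (sparseMatrix ξ Y).transpose) ^ l).trace
            ∂bernoulliProd (κ × μ) skewProb ∂bernoulliProd (κ ⊕ μ) (bernoulliVar p) := by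
  classical
  simp only [trace_mul_transpose_pow_eq_sum]
  simp only [integral_finsetSum _ fun _ _ => Integrable.of_finite, integral_const_mul,
    integral_integral_prod_sparseMatrix_pow, Finset.mul_sum]
  refine Finset.sum_le_sum fun a ha => ?_
  rw [mul_left_comm]
  gcongr
  refine (integral_prod_centered_pow_le a).trans ?_
  split_ifs with h
  · have h_nonneg := Finset.prod_nonneg fun e (_ : e ∈ Finset.univ) => skewMoment_nonneg (a e)
    positivity
  push Not at h
  calc (bernoulliVar p : ℝ) ^ a.support.card
      = (bernoulliVar p : ℝ)⁻¹ * (bernoulliVar p : ℝ) ^ (a.support.card + 1) := by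
        rw [pow_succ', inv_mul_cancel_left₀ hp.ne']
    _ ≤ (bernoulliVar p : ℝ)⁻¹ * ((bernoulliVar p : ℝ) ^ (touched a).card * 1) := by
        rw [mul_one]
        refine mul_le_mul_of_nonneg_left ?_ (by positivity)
        exact pow_le_pow_of_le_one hp.le (bernoulliVar p).2.2 (card_touched_le_of_mem_support ha)
    _ ≤ _ := by
        gcongr
        exact Finset.one_le_prod fun e _ => one_le_skewMoment (h e)

end Comparison

/-! ### Degree `4`: certificates for random graphs -/

section SpectralCertificate
variable {n k m w s : ℕ} {p L E : ℝ}

lemma sum_signedWeight_sq_le (hk : k ≤ n) (hm : m ≤ n) (hws : w + s = n) (hs : (s : ℝ) ≤ p * n)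
    (hs' : p * n < s + 1) {H : BipGraph k m}
    (h : ∀ x : Fin k → ℝ, ∑ v, (∑ u, centeredMatrix p H u v * x u) ^ 2 ≤ L * ∑ u, x u ^ 2)
    (x : Fin k → ℝ) :
    ∑ v, (∑ u, (signedWeight w s (H (u, v)) : ℝ) * x u) ^ 2
      ≤ (2 * n ^ 2 * L + 2 * n ^ 2) * ∑ u, x u ^ 2 := by
  have hn : (n : ℝ) = w + s := by exact_mod_cast hws.symm
  have h_split (u v) : (signedWeight w s (H (u, v)) : ℝ)
      = n * centeredMatrix p H u v + (n * p - s) := by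
    simp only [centeredMatrix, Matrix.of_apply]
    cases H (u, v) <;> simp [signedWeight, centered, hn] <;> ring
  have h_error : (n * p - s) ^ 2 ≤ 1 := by
    rw [sq_le_one_iff_abs_le_one, abs_le]
    constructor <;> linarith
  have h_cauchy : (∑ u, x u) ^ 2 ≤ n * ∑ u, x u ^ 2 :=
    calc (∑ u, x u) ^ 2 ≤ (Finset.univ : Finset (Fin k)).card * ∑ u, x u ^ 2 :=
          sq_sum_le_card_mul_sum_sq
      _ ≤ n * ∑ u, x u ^ 2 := by
        rw [Finset.card_fin]
        gcongr
  have h_row (v) : (∑ u, (signedWeight w s (H (u, v)) : ℝ) * x u) ^ 2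
      ≤ 2 * n ^ 2 * (∑ u, centeredMatrix p H u v * x u) ^ 2 + 2 * (n * ∑ u, x u ^ 2) :=
    calc _ = (n * (∑ u, centeredMatrix p H u v * x u) + (n * p - s) * ∑ u, x u) ^ 2 := by
          simp only [h_split, add_mul, Finset.sum_add_distrib, mul_assoc, Finset.mul_sum]
      _ ≤ 2 * n ^ 2 * (∑ u, centeredMatrix p H u v * x u) ^ 2
          + 2 * ((n * p - s) ^ 2 * (∑ u, x u) ^ 2) := add_sq_le.trans_eq (by ring)
      _ ≤ 2 * n ^ 2 * (∑ u, centeredMatrix p H u v * x u) ^ 2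
          + 2 * (1 * (n * ∑ u, x u ^ 2)) := by gcongr
      _ = _ := by rw [one_mul]
  calc _ ≤ ∑ v, (2 * n ^ 2 * (∑ u, centeredMatrix p H u v * x u) ^ 2
          + 2 * (n * ∑ u, x u ^ 2)) := Finset.sum_le_sum fun v _ => h_row v
    _ = 2 * n ^ 2 * ∑ v, (∑ u, centeredMatrix p H u v * x u) ^ 2
          + m * (2 * (n * ∑ u, x u ^ 2)) := by
        rw [Finset.sum_add_distrib, ← Finset.mul_sum, Finset.sum_const, Finset.card_univ,
          Fintype.card_fin, nsmul_eq_mul]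
    _ ≤ 2 * n ^ 2 * (L * ∑ u, x u ^ 2) + n * (2 * (n * ∑ u, x u ^ 2)) := by
        gcongr
        exact h x
    _ = _ := by ring

theorem bicliqueCertificate_of_spectral {Λ c : ℕ} {b : ℝ} {H : BipGraph k m} (hn : 20 ≤ n)
    (hk : k ≤ n) (hm : m ≤ n) (hws : w + s ≤ n) (hw : 0 < w) (hΛ_pos : 0 < Λ) (hΛn : Λ ≤ n ^ 6)
    (hcn : c ≤ n ^ 6) (hc : Λ ≤ c * w ^ 2) (hcb : (c : ℝ) ≤ b)
    (hΛ : ∀ x : Fin k → ℝ,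
      ∑ v, (∑ u, (signedWeight w s (H (u, v)) : ℝ) * x u) ^ 2 ≤ Λ * ∑ u, x u ^ 2) :
    BicliqueCertificate H 4 1 b (200 * n ^ 200) := by
  have mono {e e' : ℕ} (h : e ≤ e') : n ^ e ≤ n ^ e' := Nat.pow_le_pow_right (by lia) h
  have h_cert := IntSoSDerives.of_spectral hn hk hm hws hΛn hcn hc hΛ
  refine h_cert.bicliqueCertificate (by positivity) hcb ?_
  calc _ ≤ n ^ (2 * 20 + 10) :=
        certificate_bits_le hn hk hm le_rfl ?_ (hcn.trans (mono (by lia))) ?_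
    _ ≤ n ^ 200 := mono (by lia)
    _ ≤ 200 * n ^ 200 := Nat.le_mul_of_pos_left _ (by norm_num)
  · calc 4 * Λ * w ^ 2 ≤ n * n ^ 6 * n ^ 2 := by
          gcongr <;> lia
      _ = n ^ 9 := by ring
      _ ≤ n ^ 20 := mono (by lia)
  · calc k ^ 1 * m ≤ n ^ 1 * n := by gcongr
      _ = n ^ 2 := by ring
      _ ≤ n ^ 20 := mono (by lia)

lemma natCeil_spectral_le (hn : 1 ≤ n) (hL₀ : 0 ≤ L) (hpq : 1 ≤ n * (p * (1 - p)))
    (hL : L ≤ 2 * E * (n * (p * (1 - p)))) :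
    (⌈2 * (n : ℝ) ^ 2 * L + 2 * n ^ 2⌉₊ : ℝ) ≤ (4 * E + 3) * (n ^ 2 * (n * (p * (1 - p)))) := by
  have h_sq : (1 : ℝ) ≤ n ^ 2 := one_le_pow₀ (by exact_mod_cast hn)
  calc (⌈2 * (n : ℝ) ^ 2 * L + 2 * n ^ 2⌉₊ : ℝ) ≤ 2 * n ^ 2 * L + 2 * n ^ 2 + 1 :=
        (Nat.ceil_lt_add_one (by positivity)).le
    _ ≤ 2 * n ^ 2 * L + 3 * (n ^ 2 * 1) := by linarith
    _ ≤ 2 * n ^ 2 * (2 * E * (n * (p * (1 - p)))) + 3 * (n ^ 2 * (n * (p * (1 - p)))) := by gcongr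
    _ = _ := by ring

lemma one_le_mul_div_of_variance (hp : 0 ≤ p) (hp' : p < 1) (hpq : 1 ≤ n * (p * (1 - p))) :
    1 ≤ n * p / (1 - p) := by
  have hq : 0 < 1 - p := sub_pos.mpr hp'
  rw [one_le_div hq]
  calc 1 - p ≤ 1 := by linarith
    _ ≤ n * p * (1 - p) := by rwa [mul_assoc]
    _ ≤ n * p := mul_le_of_le_one_right (mul_nonneg n.cast_nonneg hp) (by linarith)

lemma mul_div_le_sq_of_variance (hp' : p < 1) (hpq : 1 ≤ n * (p * (1 - p))) :
    n * p / (1 - p) ≤ (n : ℝ) ^ 2 := by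
  have hq : 0 < 1 - p := sub_pos.mpr hp'
  rw [div_le_iff₀ hq]
  calc n * p ≤ n * 1 := by gcongr
    _ ≤ n * (n * (p * (1 - p))) := by gcongr
    _ ≤ n * (n * (1 * (1 - p))) := by gcongr
    _ = n ^ 2 * (1 - p) := by ring

theorem bicliqueCertificate_of_centeredMatrix {H : BipGraph k m} (hE : 4 ≤ E)
    (hn : 4 * E + 4 ≤ n) (hk : k ≤ n) (hm : m ≤ n) (hp : 0 < p) (hp' : p < 1)
    (hpq : 1 ≤ n * (p * (1 - p))) (hL₀ : 0 ≤ L) (hL : L ≤ 2 * E * (n * (p * (1 - p))))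
    (h : ∀ x : Fin k → ℝ, ∑ v, (∑ u, centeredMatrix p H u v * x u) ^ 2 ≤ L * ∑ u, x u ^ 2) :
    BicliqueCertificate H 4 1 ((4 * E + 4) * (n * p / (1 - p))) (200 * n ^ 200) := by
  have hq : 0 < 1 - p := sub_pos.mpr hp'
  have hn' : (20 : ℝ) ≤ n := by linarith
  have hn₂₀ : 20 ≤ n := by exact_mod_cast hn'
  have mono {e e' : ℕ} (he : e ≤ e') : (n : ℝ) ^ e ≤ n ^ e' :=
    pow_le_pow_right₀ (by linarith) he
  set s := ⌊p * n⌋₊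
  set Λ := ⌈2 * (n : ℝ) ^ 2 * L + 2 * n ^ 2⌉₊
  set c := ⌊(4 * E + 4) * (n * p / (1 - p))⌋₊
  have hs : (s : ℝ) ≤ p * n := Nat.floor_le (by positivity)
  have hsn : s < n := (Nat.floor_lt' (by lia)).mpr <| mul_lt_of_lt_one_left (by linarith) hp'
  have hw : n * (1 - p) ≤ ((n - s : ℕ) : ℝ) := by
    rw [Nat.cast_sub hsn.le]
    linarith
  have hΛ : (Λ : ℝ) ≤ (4 * E + 3) * (n ^ 2 * (n * (p * (1 - p)))) :=
    natCeil_spectral_le (by lia) hL₀ hpq hL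
  have h_floor : (c : ℝ) ≤ (4 * E + 4) * (n * p / (1 - p)) := Nat.floor_le (by positivity)
  have hc : (4 * E + 3) * (n * p / (1 - p)) ≤ c := by
    have h_lt : (4 * E + 4) * (n * p / (1 - p)) < c + 1 := Nat.lt_floor_add_one _
    linarith [one_le_mul_div_of_variance hp.le hp' hpq]
  refine bicliqueCertificate_of_spectral (s := s) (Λ := Λ) (c := c) hn₂₀ hk hm
    (Nat.sub_add_cancel hsn.le).le (by lia) (Nat.ceil_pos.mpr (by positivity)) ?_ ?_ ?_ h_floor
    fun x => (sum_signedWeight_sq_le hk hm (Nat.sub_add_cancel hsn.le) hs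
      (Nat.lt_floor_add_one _) h x).trans (by gcongr; exact Nat.le_ceil _)
  · suffices (Λ : ℝ) ≤ (n : ℝ) ^ 6 by exact_mod_cast this
    calc (Λ : ℝ) ≤ n * (n ^ 2 * (n * (1 * 1))) := hΛ.trans (by gcongr <;> linarith)
      _ = (n : ℝ) ^ 4 := by ring
      _ ≤ (n : ℝ) ^ 6 := mono (by lia)
  · suffices (c : ℝ) ≤ (n : ℝ) ^ 6 by exact_mod_cast this
    calc (c : ℝ) ≤ n * n ^ 2 := h_floor.trans <| by
          gcongr
          exact mul_div_le_sq_of_variance hp' hpq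
      _ = (n : ℝ) ^ 3 := by ring
      _ ≤ (n : ℝ) ^ 6 := mono (by lia)
  · suffices (Λ : ℝ) ≤ c * ((n - s : ℕ) : ℝ) ^ 2 by exact_mod_cast this
    calc (Λ : ℝ) ≤ (4 * E + 3) * (n * p / (1 - p)) * (n * (1 - p)) ^ 2 :=
          hΛ.trans_eq (by field_simp)
      _ ≤ c * ((n - s : ℕ) : ℝ) ^ 2 := by gcongr

end SpectralCertificate

section PartOne
variable {n k m l : ℕ} {p : unitInterval}

/-- The constant in the bound `‖M‖² ≤ spectralConst * l` on the spectral norm of the centered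
adjacency matrix, as given by its `2 * l`-th moment. -/
noncomputable def spectralConst : ℝ := Real.exp (20 + 3 * 2 ^ 32)

lemma fifteen_le_spectralConst : 15 ≤ spectralConst := by
  have h_exp : (20 + 3 * 2 ^ 32 : ℝ) + 1 ≤ spectralConst := Real.add_one_le_exp _
  linarith

lemma integral_trace_centeredMatrix_le_pow (hkm : k + m = n) (hl : l ≠ 0)
    (hpq : 1 ≤ n * (p * (1 - p) : ℝ)) (hl' : n * (p * (1 - p) : ℝ) ≤ l) :
    ∫ H, ((centeredMatrix p H * (centeredMatrix p H).transpose) ^ l).trace ∂randomBip k m p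
      ≤ n ^ 2 * ((l : ℝ) ^ l * Real.exp ((18 + 3 * 2 ^ 32) * l)) := by
  have hk : (k : ℝ) ≤ n := by exact_mod_cast (by lia : k ≤ n)
  have hσ : 0 < (bernoulliVar p : ℝ) := pos_of_mul_pos_right (one_pos.trans_le hpq) n.cast_nonneg
  have hσ_inv : (bernoulliVar p : ℝ)⁻¹ ≤ n := (inv_le_iff_one_le_mul₀ hσ).mpr hpq
  have h_sparse := integral_integral_trace_sparseMatrix_le (κ := Fin k) (μ := Fin m) hl
    (s := bernoulliVar p) (by simpa [← hkm, coe_bernoulliVar] using hl')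
  rw [Fintype.card_fin] at h_sparse
  calc _ ≤ (bernoulliVar p : ℝ)⁻¹ * (k * ((l : ℝ) ^ l * Real.exp ((18 + 3 * 2 ^ 32) * l))) :=
        (integral_trace_centeredMatrix_le hσ l).trans (by gcongr)
    _ ≤ n * (n * ((l : ℝ) ^ l * Real.exp ((18 + 3 * 2 ^ 32) * l))) := by gcongr
    _ = _ := by ring

lemma randomBip_trace_ge_le (hkm : k + m = n)
    (hpq : 1 ≤ n * (p * (1 - p) : ℝ)) (hl : n * (p * (1 - p) : ℝ) ≤ l) :
    (randomBip k m p).real {H | (spectralConst * l) ^ l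
        ≤ ((centeredMatrix p H * (centeredMatrix p H).transpose) ^ l).trace}
      ≤ n ^ 2 * Real.exp (-(2 * l)) := by
  have hl₀ : (0 : ℝ) < l := by linarith
  have h_nonneg (H : BipGraph k m) :
      0 ≤ ((centeredMatrix p H * (centeredMatrix p H).transpose) ^ l).trace :=
    ((Matrix.posSemidef_self_mul_conjTranspose (centeredMatrix (p : ℝ) H)).pow l).trace_nonneg
  have h_markov := mul_meas_ge_le_integral_of_nonneg (μ := randomBip k m p)
    (Filter.Eventually.of_forall h_nonneg) Integrable.of_finite ((spectralConst * l) ^ l)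
  have h_const : 0 < spectralConst := Real.exp_pos _
  refine le_of_mul_le_mul_left (h_markov.trans ?_) (by positivity : 0 < (spectralConst * l) ^ l)
  refine (integral_trace_centeredMatrix_le_pow hkm (Nat.cast_pos.mp hl₀).ne' hpq hl).trans_eq ?_
  rw [mul_pow, spectralConst, ← Real.exp_nat_mul,
    show (18 + 3 * 2 ^ 32) * (l : ℝ) = l * (20 + 3 * 2 ^ 32) + -(2 * l) by ring, Real.exp_add]
  ring

theorem randomBip_partOne (hk : k ≤ n) (hp : 0 < (p : ℝ)) (hp' : (p : ℝ) < 1)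
    (hn : 4 * spectralConst + 4 ≤ n) (hpq : 1 ≤ n * (p * (1 - p) : ℝ))
    (h_exp : n ^ 2 * Real.exp (-(2 * (n * (p * (1 - p))))) ≤ 0.005) :
    0.995 ≤ (randomBip k (n - k) p).real {H |
      BicliqueCertificate H 4 1 ((4 * spectralConst + 4) * (n * p / (1 - p))) (200 * n ^ 200)} := by
  obtain ⟨i, hi, hi'⟩ := exists_nat_pow_near hpq one_lt_two
  obtain ⟨l, hl⟩ : ∃ l : ℕ, l = 2 ^ (i + 1) := ⟨_, rfl⟩
  have hl_cast : (l : ℝ) = 2 ^ (i + 1) := by exact_mod_cast hl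
  rw [← hl_cast] at hi'
  have hl_le : (l : ℝ) ≤ 2 * (n * (p * (1 - p))) := by
    rw [hl_cast, pow_succ']
    gcongr
  set large : Set (BipGraph k (n - k)) := {H | (spectralConst * l) ^ l
    ≤ ((centeredMatrix p H * (centeredMatrix p H).transpose) ^ l).trace}
  have h_large : (randomBip k (n - k) p).real large ≤ 0.005 :=
    calc _ ≤ n ^ 2 * Real.exp (-(2 * l)) :=
          randomBip_trace_ge_le (Nat.add_sub_of_le hk) hpq hi'.le
      _ ≤ n ^ 2 * Real.exp (-(2 * (n * (p * (1 - p))))) := by gcongr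
      _ ≤ 0.005 := h_exp
  have h_const := fifteen_le_spectralConst
  calc (0.995 : ℝ) ≤ 1 - (randomBip k (n - k) p).real large := by linarith
    _ = (randomBip k (n - k) p).real largeᶜ :=
        (probReal_compl_eq_one_sub MeasurableSet.of_discrete).symm
    _ ≤ _ := measureReal_mono fun H hH => ?_
  refine bicliqueCertificate_of_centeredMatrix (L := spectralConst * l) (by linarith) hn hk
    (n.sub_le k) hp hp' hpq (by positivity) ?_ (sum_vecMul_sq_le_of_trace_le (i := i) _
      (by positivity) ?_)
  · calc spectralConst * l ≤ spectralConst * (2 * (n * (p * (1 - p)))) := by gcongr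
      _ = _ := by ring
  · rw [← hl]
    exact le_of_not_ge hH

end PartOne

lemma rpow_div_two_le_mul_of_le {n : ℕ} {p ε : ℝ} (hn : 0 < n) (hp : (n : ℝ) ^ (-(1 - ε)) ≤ p)
    (hq : (n : ℝ) ^ (-(1 - ε)) ≤ 1 - p) : (n : ℝ) ^ ε / 2 ≤ n * (p * (1 - p)) := by
  have hn' : (0 : ℝ) < n := by exact_mod_cast hn
  have h_rpow : (n : ℝ) ^ ε = n * (n : ℝ) ^ (-(1 - ε)) :=
    calc (n : ℝ) ^ ε = (n : ℝ) ^ (1 + -(1 - ε)) := by ring_nf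
      _ = n * (n : ℝ) ^ (-(1 - ε)) := by rw [Real.rpow_add hn', Real.rpow_one]
  have h_pos : 0 < (n : ℝ) ^ (-(1 - ε)) := Real.rpow_pos_of_pos hn' _
  rw [h_rpow, mul_div_assoc]
  gcongr
  obtain h | h := le_total p (1 / 2)
  · exact (mul_le_mul hp (by linarith : 1 / 2 ≤ 1 - p) (by norm_num)
      (by linarith)).trans_eq' (by ring)
  · exact (mul_le_mul h hq h_pos.le (by linarith)).trans_eq' (by ring)

lemma exists_forall_dense {ε : ℝ} (hε : 0 < ε) (B : ℝ) : ∃ N : ℕ, ∀ (n : ℕ) (p : ℝ), N ≤ n →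
    (n : ℝ) ^ (-(1 - ε)) ≤ p → (n : ℝ) ^ (-(1 - ε)) ≤ 1 - p →
      B ≤ n ∧ 1 ≤ n * (p * (1 - p)) ∧
        n ^ 2 * Real.exp (-(2 * (n * (p * (1 - p))))) ≤ 0.005 := by
  have h_rpow : Filter.Tendsto (fun n : ℕ => (n : ℝ) ^ ε) Filter.atTop Filter.atTop :=
    (tendsto_rpow_atTop hε).comp tendsto_natCast_atTop_atTop
  have h_exp := ((tendsto_rpow_mul_exp_neg_mul_atTop_nhds_zero (2 / ε) 1 one_pos).comp
    h_rpow).eventually_le_const (show (0 : ℝ) < 0.005 by norm_num)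
  obtain ⟨N, hN⟩ := Filter.eventually_atTop.mp <| (h_rpow.eventually_ge_atTop 2).and <|
    h_exp.and <| (tendsto_natCast_atTop_atTop.eventually_ge_atTop B).and <|
    Filter.eventually_gt_atTop 0
  refine ⟨N, fun n p hn hp hq => ?_⟩
  obtain ⟨h_two, h_exp, hB, hn₀⟩ := hN n hn
  have h_var := rpow_div_two_le_mul_of_le hn₀ hp hq
  refine ⟨hB, by linarith, ?_⟩
  calc (n : ℝ) ^ 2 * Real.exp (-(2 * (n * (p * (1 - p)))))
      ≤ (n : ℝ) ^ 2 * Real.exp (-(n : ℝ) ^ ε) := by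
        gcongr
        linarith
    _ = ((n : ℝ) ^ ε) ^ (2 / ε) * Real.exp (-1 * (n : ℝ) ^ ε) := by
        rw [← Real.rpow_mul n.cast_nonneg, mul_div_cancel₀ _ hε.ne', Real.rpow_two, neg_one_mul]
    _ ≤ 0.005 := h_exp

lemma probReal_and_ge {Ω : Type*} [MeasurableSpace Ω] [DiscreteMeasurableSpace Ω] {ν : Measure Ω}
    [IsProbabilityMeasure ν] {P Q : Ω → Prop} {a b : ℝ} (hP : 1 - a ≤ ν.real {ω | P ω})
    (hQ : 1 - b ≤ ν.real {ω | Q ω}) : 1 - (a + b) ≤ ν.real {ω | P ω ∧ Q ω} := by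
  have h_union := measureReal_union_add_inter (μ := ν) (s := {ω | P ω}) (t := {ω | Q ω})
    MeasurableSet.of_discrete
  have h_le : ν.real ({ω | P ω} ∪ {ω | Q ω}) ≤ 1 := measureReal_le_one
  have h_inter : ν.real ({ω | P ω} ∩ {ω | Q ω}) = ν.real {ω | P ω ∧ Q ω} := rfl
  linarith

lemma le_mul_of_max_pow_le {A x y p : ℝ} {r : ℕ} (hp : 0 < p) (hp' : p < 1) (hx : 0 ≤ x)
    (hA : 64 ≤ A)
    (h : A * (x * (max (p / (1 - p)) ((1 - p) / p) ^ r * p ^ r / (1 - p) ^ (r + 1))) ≤ y) :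
    64 * (x * weightRatio p ^ (2 * r)) ≤ y * (1 - p) := by
  have hq : 0 < 1 - p := sub_pos.mpr hp'
  rw [max_pow_mul_pow_div hp hp', ← mul_div_assoc, ← mul_div_assoc, div_le_iff₀ hq] at h
  have h_ratio := zero_le_one.trans (one_le_weightRatio hp')
  exact le_trans (by gcongr) h

lemma mul_max_pow_div {x y p : ℝ} (hp : 0 < p) (hp' : p < 1) (r : ℕ) :
    x * max (p / (1 - p)) ((1 - p) / p) ^ r * p ^ r / (y * (1 - p) ^ (r + 1))
      = x * weightRatio p ^ (2 * r) / (y * (1 - p)) := by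
  rw [mul_assoc, mul_div_mul_comm, max_pow_mul_pow_div hp hp', mul_div_mul_comm]

theorem theorem4p6 :
    ∃ (A : ℝ) (K : ℕ), 0 < A ∧
      ∀ ε : ℝ, 0 < ε → ∃ N : ℕ,
        ∀ (n k : ℕ) (p : unitInterval), 1 ≤ k → k ≤ n → 0 < (p : ℝ) → (p : ℝ) < 1 →
          0.99 ≤ (randomBip k (n - k) p).real
            {H : BipGraph k (n - k) |
              (N ≤ n → (n : ℝ) ^ (-(1 - ε)) ≤ (p : ℝ) → (n : ℝ) ^ (-(1 - ε)) ≤ 1 - (p : ℝ) →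
                BicliqueCertificate H 4 1 (A * ((n : ℝ) * p / (1 - p))) (K * n ^ K)) ∧
              (∀ r : ℕ, 1 ≤ r →
                A * (Real.sqrt (r * n * Real.log n) *
                    (max ((p : ℝ) / (1 - p)) ((1 - p) / p) ^ r * (p : ℝ) ^ r
                      / (1 - (p : ℝ)) ^ (r + 1))) ≤ (k : ℝ) →
                A * (Real.log n * (p : ℝ) / (1 - p)) ≤ (k : ℝ) →
                BicliqueCertificate H (6 * r + 2) (4 * r)
                  ((1000 * (r : ℝ)) ^ (10 * r) * n *
                    (n * max ((p : ℝ) / (1 - p)) ((1 - p) / p) ^ r * (p : ℝ) ^ r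
                      / (k * (1 - (p : ℝ)) ^ (r + 1))) ^ 4)
                  (K * n ^ (K * r)))} := by
  have hA : 64 ≤ 4 * spectralConst + 4 := by linarith [fifteen_le_spectralConst]
  refine ⟨4 * spectralConst + 4, 200, by linarith, fun ε hε => ?_⟩
  obtain ⟨N, hN⟩ := exists_forall_dense hε (4 * spectralConst + 4)
  refine ⟨N, fun n k p hk hkn hp hp' => ?_⟩
  refine (by norm_num : (0.99 : ℝ) ≤ 1 - (0.005 + 0.005)).trans (probReal_and_ge ?_ ?_)
  · by_cases h : N ≤ n ∧ (n : ℝ) ^ (-(1 - ε)) ≤ p ∧ (n : ℝ) ^ (-(1 - ε)) ≤ 1 - p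
    · obtain ⟨hn, hpq, h_exp⟩ := hN n p h.1 h.2.1 h.2.2
      refine le_trans (by norm_num) ((randomBip_partOne hkn hp hp' hn hpq h_exp).trans ?_)
      exact measureReal_mono fun H hH _ _ _ => hH
    · exact le_trans (by norm_num)
        (randomBip_ge_of_forall fun H h₁ h₂ h₃ => (h ⟨h₁, h₂, h₃⟩).elim)
  · refine le_trans (by norm_num) ((randomBip_partTwo hk hkn hp').trans (measureReal_mono ?_))
    intro H hH r hr h _
    rw [mul_max_pow_div hp hp']
    exact hH r hr (le_mul_of_max_pow_le hp hp' (Real.sqrt_nonneg _) hA h)
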